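/- **Conventions.** Let $d\ge 1$. Write $\mathscr P_{k,d}=\binom{k+d}{d}$ for $k\ge 0$ and $\mathscr P_{-1,d}=0$. Let $x_1,\dots,x_n$ be distinct points of $\mathbb R^d$, let $\Omega=\{x_1,\dots,x_n\}$, and let $\mathbf V_j$ be the matrix of the monomials of degree $j$ evaluated at $x_1,\dots,x_n$ (one row per point), $\mathbf V_{\le k}=[\mathbf V_0\,\cdots\,\mathbf V_k]$ (no columns if $k=-1$), $\mathbf D^{(k)}=[\|x_i-x_j\|^k]_{i,j}$. For $X\subseteq\Omega$, $\mathbf A_X$ is the principal submatrix of $\mathbf A$ and $\mathbf V_{X,:}$ the set of rows of $\mathbf V$ indexed by $X$; $\det\mathbf A_\varnothing=1$. - For $\mathbf L$ positive semidefinite, $\mathrm{DPP}(\mathbf L)$ is the random subset with $\mathbb P(\mathcal X=X)\propto\det\mathbf L_X$, and $|\mathrm{DPP}|_m(\mathbf L)$ is the random subset with $\mathbb P(\mathcal X=X)\propto\det\mathbf L_X\,\mathbf 1_{|X|=m}$. - For $\mathbf L$ symmetric and $\mathbf V\in\mathbb R^{n\times q}$ of full column rank such that $c^\top\mathbf Lc\ge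 0$ whenever $\mathbf V^\top c=0$, $\mathrm{DPP}(\mathbf L;\mathbf V)$ is the random subset with $\mathbb P(\mathcal X=X)\propto(-1)^q\det\begin{pmatrix}\mathbf L_X&\mathbf V_{X,:}\\ \mathbf V_{X,:}^\top&0\end{pmatrix}$ (a partial-projection DPP if $q\ge 1$). Let $\kappa(x,y)=f(\|x-y\|_2)$ be a positive kernel on $\mathbb R^d$ (all its Gram matrices are positive semidefinite) with $f$ analytic at $0$, $f_i=f^{(i)}(0)/i!$, and let $r=\min\{k\ge 1: f_{2k-1}\ne 0\}\in\{1,2,\dots\}\cup\{\infty\}$ be its smoothness order. Let $\mathbf W_{\le k}=\big[\kappa^{(\boldsymbol a,\boldsymbol b)}(0,0)/(\boldsymbol a!\,\boldsymbol b!)\big]_{|\boldsymbol a|,|\boldsymbol b|\le k}$ be the Wronskian matrix (empty if $k=-1$). **Theorem.** Let $p\in\mathbb N$, $\alpha>0$, $\mathbf L_\varepsilon=[f(\varepsilon\|x_i-x_j\|)]_{i,j}$ and $\mathcal X_\varepsilon\sim\mathrm{DPP}(\alpha\varepsilon^{-p}\mathbf L_\varepsilon)$ for $\varepsilon>0$.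 Let $l$ be whichever of $p/2$, $(p+1)/2$ is an integer. If $r\ge\frac{p+1}2$, assume that $\mathbf V_{\le l-1}$ has maximal rank $\min(n,\mathscr P_{l-1,d})$; if $r=\infty$, assume that $\mathbf W_{\le l-1}$ is invertible. Then, as $\varepsilon\to0^+$, $\mathcal X_\varepsilon$ converges in law as follows. - If $\mathscr P_{l-1,d}\ge n$, or if $r<\frac{p+1}2$, the limit is $\Omega$ with probability one. - If $\mathscr P_{l-1,d}<n$, $r>\frac{p+1}2$ and $p$ is odd, the limit is $|\mathrm{DPP}|_{\mathscr P_{l-1,d}}(\mathbf V_{\le l-1}\mathbf V_{\le l-1}^\top)$. - If $\mathscr P_{l-1,d}<n$, $r>\frac{p+1}2$ and $p$ is even, the limit is $\mathrm{DPP}(\alpha\mathbf V_l\bar{\mathbf W}\mathbf V_l^\top;\mathbf V_{\le l-1})$, where $\bar{\mathbf W}=\mathbf W_\lrcorner-\mathbf W_\llcorner\mathbf W_{\le l-1}^{-1}\mathbf W_\urcorner$ is the Schur complement of $\mathbf W_{\le l-1}$ in $\mathbf W_{\le l}=\begin{pmatrix}\mathbf W_{\le l-1}&\mathbf W_\urcorner\\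 \mathbf W_\llcorner&\mathbf W_\lrcorner\end{pmatrix}$. - If $\mathscr P_{l-1,d}<n$ and $r=\frac{p+1}2$, the limit is the partial-projection DPP $\mathrm{DPP}(\alpha f_{2r-1}\mathbf D^{(2r-1)};\mathbf V_{\le r-1})$. In particular the pairs appearing in the last two items satisfy the conditions under which $\mathrm{DPP}(\mathbf L;\mathbf V)$ is defined. -/

import Mathlib

open Filter Topology

noncomputable section

/-- The stationary kernel `κ(x, y) = f(‖x - y‖₂)` on `ℝ^d`. -/
def stationaryKernel (d : ℕ) (f : ℝ → ℝ) (x y : EuclideanSpace ℝ (Fin d)) : ℝ :=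
  f ‖x - y‖

/-- `κ` is a positive kernel: all its Gram matrices are positive semidefinite. -/
def IsPositiveKernel {E : Type*} (κ : E → E → ℝ) : Prop :=
  ∀ (m : ℕ) (y : Fin m → E), (Matrix.of fun i j => κ (y i) (y j)).PosSemidef

/-- The Taylor coefficient `f_i = f^{(i)}(0) / i!`. -/
def taylorCoeffAtZero (f : ℝ → ℝ) (i : ℕ) : ℝ :=
  iteratedDeriv i f 0 / (i.factorial : ℝ)

/-- The smoothness order: the smallest `k ≥ 1` with `f_{2k-1} ≠ 0`, and `⊤` if there is none. -/
def smoothnessOrder (f : ℝ → ℝ) : ℕ∞ :=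
  sInf {r : ℕ∞ | ∃ k : ℕ, 1 ≤ k ∧ taylorCoeffAtZero f (2 * k - 1) ≠ 0 ∧ r = (k : ℕ∞)}

/-- The matrix `L_ε = [f(ε ‖x_i - x_j‖)]`. -/
def scaledKernelMatrix {d n : ℕ} (f : ℝ → ℝ) (ε : ℝ) (x : Fin n → EuclideanSpace ℝ (Fin d)) :
    Matrix (Fin n) (Fin n) ℝ :=
  Matrix.of fun i j => f (ε * ‖x i - x j‖)

/-- The matrix `D^{(k)} = [‖x_i - x_j‖^k]`. -/
def distancePowerMatrix {d n : ℕ} (k : ℕ) (x : Fin n → EuclideanSpace ℝ (Fin d)) :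
    Matrix (Fin n) (Fin n) ℝ :=
  Matrix.of fun i j => ‖x i - x j‖ ^ k

/-- The number of monomials in `d` variables of degree `< l`:
it is `0` for `l = 0`, and `(l - 1 + d).choose d` for `l ≥ 1`. -/
def numMonomialsLT (d : ℕ) : ℕ → ℕ
  | 0 => 0
  | k + 1 => (k + d).choose d

/-- Multi-indices in `ℕ^d` of total degree `< l` (all their entries are then `< l`). -/
abbrev MonLT (d l : ℕ) : Type :=
  {a : Fin d → Fin l // ∑ i, (a i : ℕ) < l}

/-- Multi-indices in `ℕ^d` of total degree equal to `l`. -/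
abbrev MonEq (d l : ℕ) : Type :=
  {a : Fin d → Fin (l + 1) // ∑ i, (a i : ℕ) = l}

/-- The underlying multi-index in `ℕ^d`. -/
def MonLT.toFun {d l : ℕ} (a : MonLT d l) : Fin d → ℕ := fun i => (a.1 i : ℕ)

/-- The underlying multi-index in `ℕ^d`. -/
def MonEq.toFun {d l : ℕ} (a : MonEq d l) : Fin d → ℕ := fun i => (a.1 i : ℕ)

/-- The monomial `x^a = ∏ x_i ^ a_i`. -/
def monomialEval {d : ℕ} (a : Fin d → ℕ) (x : EuclideanSpace ℝ (Fin d)) : ℝ :=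
  ∏ i, x i ^ a i

/-- The multivariate Vandermonde matrix with all monomials of degree `< l`, that is `V_{≤ l-1}`
(no columns if `l = 0`). -/
def vandermondeLT {d n : ℕ} (x : Fin n → EuclideanSpace ℝ (Fin d)) (l : ℕ) :
    Matrix (Fin n) (MonLT d l) ℝ :=
  Matrix.of fun i a => monomialEval a.toFun (x i)

/-- The block `V_l` of the monomials of degree exactly `l`. -/
def vandermondeEq {d n : ℕ} (x : Fin n → EuclideanSpace ℝ (Fin d)) (l : ℕ) :
    Matrix (Fin n) (MonEq d l) ℝ :=
  Matrix.of fun i a => monomialEval a.toFun (x i)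

/-- The partial derivative `∂g/∂x_i`. -/
def partialDeriv {d : ℕ} (i : Fin d) (g : EuclideanSpace ℝ (Fin d) → ℝ) :
    EuclideanSpace ℝ (Fin d) → ℝ :=
  fun x => lineDeriv ℝ g x (EuclideanSpace.single i (1 : ℝ))

/-- The partial derivative `∂^{|a|} g / ∂x_1^{a_1} ⋯ ∂x_d^{a_d}`. -/
def multiDeriv {d : ℕ} (a : Fin d → ℕ) (g : EuclideanSpace ℝ (Fin d) → ℝ) :
    EuclideanSpace ℝ (Fin d) → ℝ :=
  (List.finRange d).foldr (fun i h => (partialDeriv i)^[a i] h) g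

/-- The Wronskian entry `κ^{(a,b)}(0,0) / (a! b!)`: order `a` in the first variable and
order `b` in the second one. -/
def wronskianEntry {d : ℕ} (κ : EuclideanSpace ℝ (Fin d) → EuclideanSpace ℝ (Fin d) → ℝ)
    (a b : Fin d → ℕ) : ℝ :=
  multiDeriv a (fun x => multiDeriv b (fun y => κ x y) 0) 0 /
    ((∏ i, ((a i).factorial : ℝ)) * ∏ i, ((b i).factorial : ℝ))

/-- The Wronskian matrix of all degrees `< l`, that is `W_{≤ l-1}` (empty if `l = 0`). -/
def wronskianLT {d : ℕ} (κ : EuclideanSpace ℝ (Fin d) → EuclideanSpace ℝ (Fin d) → ℝ) (l : ℕ) :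
    Matrix (MonLT d l) (MonLT d l) ℝ :=
  Matrix.of fun a b => wronskianEntry κ a.toFun b.toFun

/-- The Schur complement of `W_{≤ l-1}` in `W_{≤ l}`. -/
def wronskianSchur {d : ℕ} (κ : EuclideanSpace ℝ (Fin d) → EuclideanSpace ℝ (Fin d) → ℝ)
    (l : ℕ) : Matrix (MonEq d l) (MonEq d l) ℝ :=
  let upperRight : Matrix (MonLT d l) (MonEq d l) ℝ :=
    Matrix.of fun a b => wronskianEntry κ a.toFun b.toFun
  let lowerLeft : Matrix (MonEq d l) (MonLT d l) ℝ :=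
    Matrix.of fun a b => wronskianEntry κ a.toFun b.toFun
  let lowerRight : Matrix (MonEq d l) (MonEq d l) ℝ :=
    Matrix.of fun a b => wronskianEntry κ a.toFun b.toFun
  lowerRight - lowerLeft * (wronskianLT κ l)⁻¹ * upperRight

/-- The principal minor `det L_X`, equal to `1` for `X = ∅`. -/
def principalMinor {n : ℕ} (L : Matrix (Fin n) (Fin n) ℝ) (X : Finset (Fin n)) : ℝ :=
  (L.submatrix (fun i : X => (i : Fin n)) (fun i : X => (i : Fin n))).det

/-- The determinant of the bordered matrix `[L_X, V_X; V_Xᵀ, 0]`. -/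
def borderedMinor {n : ℕ} {ι : Type*} [Fintype ι] [DecidableEq ι]
    (L : Matrix (Fin n) (Fin n) ℝ) (V : Matrix (Fin n) ι ℝ) (X : Finset (Fin n)) : ℝ :=
  (Matrix.fromBlocks
    (L.submatrix (fun i : X => (i : Fin n)) (fun i : X => (i : Fin n)))
    (V.submatrix (fun i : X => (i : Fin n)) id)
    (V.submatrix (fun i : X => (i : Fin n)) id).transpose
    0).det

/-- `μ` is the law of the L-ensemble `DPP(L)`: `P(X) = det L_X / Z`. -/
def IsLEnsemble {n : ℕ} (L : Matrix (Fin n) (Fin n) ℝ) (μ : PMF (Finset (Fin n))) : Prop :=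
  L.PosSemidef ∧ ∃ Z : ℝ, 0 < Z ∧ ∀ X, (μ X).toReal = principalMinor L X / Z

/-- `μ` is the law of the fixed-size L-ensemble `|DPP|_m(L)`. -/
def IsFixedSizeLEnsemble {n : ℕ} (m : ℕ) (L : Matrix (Fin n) (Fin n) ℝ)
    (μ : PMF (Finset (Fin n))) : Prop :=
  L.PosSemidef ∧ ∃ Z : ℝ, 0 < Z ∧
    ∀ X, (μ X).toReal = if X.card = m then principalMinor L X / Z else 0

/-- `(L; V)` is a nonnegative pair: `V` has full column rank, and `L` is symmetric and
positive semidefinite on the orthogonal complement of the column span of `V`. -/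
def IsNonnegativePair {n : ℕ} {ι : Type*} [Fintype ι]
    (L : Matrix (Fin n) (Fin n) ℝ) (V : Matrix (Fin n) ι ℝ) : Prop :=
  L.IsSymm ∧ V.rank = Fintype.card ι ∧
    ∀ c : Fin n → ℝ, V.transpose.mulVec c = 0 → 0 ≤ c ⬝ᵥ L.mulVec c

/-- `μ` is the law of the extended L-ensemble (partial-projection DPP, if `V` has a column)
`DPP(L; V)`. -/
def IsExtendedLEnsemble {n : ℕ} {ι : Type*} [Fintype ι] [DecidableEq ι]
    (L : Matrix (Fin n) (Fin n) ℝ) (V : Matrix (Fin n) ι ℝ) (μ : PMF (Finset (Fin n))) : Prop :=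
  IsNonnegativePair L V ∧ ∃ Z : ℝ, 0 < Z ∧
    ∀ X, (μ X).toReal = (-1) ^ Fintype.card ι * borderedMinor L V X / Z

/-- Convergence in law, as `ε → 0⁺`, of random subsets of a finite set: all the point
probabilities converge. -/
def ConvergesInLaw {n : ℕ} (μ : ℝ → PMF (Finset (Fin n))) (ν : PMF (Finset (Fin n))) : Prop :=
  ∀ X, Tendsto (fun ε => (μ ε X).toReal) (𝓝[>] 0) (𝓝 (ν X).toReal)

end

noncomputable section

/-! Even powers of `‖x - y‖` are polynomials in `x` and `y`, whereas odd powers are singular on the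
diagonal. If the odd Taylor coefficients below order `s = 2M - 1` vanish, then `f(ε‖x - y‖)` is `∑
ε^(|a|+|b|) W_ab x^a y^b` over `|a| + |b| < s`, plus `ε^s f_s ‖x - y‖^s`, plus `O(ε^(s+1))`, with
`W_ab` the Wronskian entries (`kernel_expansion`). Isolating the monomials of degree below `l` and
completing the square (`SingularDecomposition.of_expansion`) writes the rescaled matrix as `B_ε +
V_ε A_ε V_εᵀ`. Here `V_ε → V_{≤l-1}`, and `A_ε = α ε^(-p) D W D` with `D = diag(ε^|a|)` blows up in
every direction once `W = W_{≤l-1}` is positive definite. The limit `B` of `B_ε` is `α f_p D^(p)`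
for odd `p` (hence `0` when `f_p = 0`), and `α V_l W̄ V_lᵀ` for even `p`, the Schur complement being
what the completed square leaves over.

The limit laws then follow from determinants. A Schur complement gives `(det A)⁻¹ det L_X = det
[B_X, V_X; -V_Xᵀ, A⁻¹]`, and `A⁻¹ → 0`. So the rescaled minors converge to signed bordered minors,
not all of which vanish when `V` has full column rank (`SingularDecomposition.exists_limit_law`).
For `B = 0` these are the minors of `V Vᵀ` of a fixed size (`borderedMinor_zero`). If instead `Vᵀ`
is injective, the matrix itself blows up and `P(Ω) = 1 / det(1 + L⁻¹) → 1` (`convergesInLaw_univ`).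
If `r < (p+1)/2`, the matrix rescaled by `ε^(-(2r-1))` is already uniformly coercive, and the
surplus power of `1/ε` makes it blow up.

What remains is positivity, extracted from Gram matrices of well-chosen weighted configurations at
small scale. On weights with vanishing moments of degree below `r`, the polynomial part of the
expansion disappears, so `f_{2r-1} ‖x - y‖^(2r-1)` is conditionally nonnegative. By Cauchy–Schwarz,
a null vector pairs to zero with every admissible test configuration. A one-dimensional
extrapolation functional centred at one of the points detects the kink of `‖·‖^(2r-1)` there and
kills the corresponding weight (`eq_zero_of_odd_form_eq_zero`). Definiteness of `W` for finite `r`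
uses the same device. A Wronskian null vector of top degree `m` is realised by a configuration
shrinking to the origin, and testing it against extrapolation functionals on lines through the
origin forces a polar form to vanish. That form is a positive combination of squares which includes
the squares of all top moments (`wronskian_null_top`). -/

theorem exists_taylor_remainder {f : ℝ → ℝ} (hf : AnalyticAt ℝ f 0) (n : ℕ) :
    ∃ h : ℝ → ℝ, AnalyticAt ℝ h 0 ∧
      ∀ s, f s = ∑ k ∈ Finset.range n, taylorCoeffAtZero f k * s ^ k + s ^ n * h s := by
  obtain ⟨h, hh, H⟩ := hf.exists_eq_sum_add_pow_mul n
  refine ⟨h, hh, fun s => ?_⟩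
  rw [H s]
  simp only [taylorCoeffAtZero, smul_eq_mul]
  congr 1
  exact Finset.sum_congr rfl fun k _ => by ring

/-! ### Jets at the origin of functions with a radial singularity. -/

section Symbols
variable {d : ℕ}

theorem abs_eval_le_of_isHomogeneous {P : MvPolynomial (Fin d) ℝ} {n : ℕ}
    (hP : P.IsHomogeneous n) :
    ∃ C, ∀ z : EuclideanSpace ℝ (Fin d), |MvPolynomial.eval z.ofLp P| ≤ C * ‖z‖ ^ n := by
  refine ⟨∑ c ∈ P.support, |P.coeff c|, fun z => ?_⟩
  rw [MvPolynomial.eval_eq', Finset.sum_mul]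
  refine (Finset.abs_sum_le_sum_abs _ _).trans (Finset.sum_le_sum fun c hc => ?_)
  rw [abs_mul]
  refine mul_le_mul_of_nonneg_left ?_ (abs_nonneg _)
  have hdeg : ∑ i, c i = n := by
    have := hP (MvPolynomial.mem_support_iff.mp hc)
    rw [← this, Finsupp.weight_apply, Finsupp.sum_fintype] <;> simp
  rw [Finset.abs_prod, ← hdeg, ← Finset.prod_pow_eq_pow_sum]
  refine Finset.prod_le_prod (fun _ _ => abs_nonneg _) fun i _ => ?_
  rw [abs_pow]
  exact pow_le_pow_left₀ (abs_nonneg _) (PiLp.norm_apply_le z i) _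

theorem hasLineDerivAt_eval (P : MvPolynomial (Fin d) ℝ) (i : Fin d)
    (z : EuclideanSpace ℝ (Fin d)) :
    HasLineDerivAt ℝ (fun z : EuclideanSpace ℝ (Fin d) => MvPolynomial.eval z.ofLp P)
      (MvPolynomial.eval z.ofLp (MvPolynomial.pderiv i P)) z (EuclideanSpace.single i 1) := by
  unfold HasLineDerivAt
  induction P using MvPolynomial.induction_on with
  | C a => simpa using hasDerivAt_const (0 : ℝ) a
  | add p q hp hq => simpa using HasDerivAt.fun_add hp hq
  | mul_X p j hp =>
    have hj : HasDerivAt (fun t : ℝ => (z + t • EuclideanSpace.single i (1 : ℝ)).ofLp j)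
        (if j = i then 1 else 0) 0 := by
      by_cases h : j = i
      · subst h; simpa using (hasDerivAt_id (0 : ℝ)).const_add (z j)
      · simpa [h] using hasDerivAt_const (0 : ℝ) (z j)
    have := hp.mul hj
    simp only [map_mul, MvPolynomial.eval_X, Derivation.leibniz, MvPolynomial.pderiv_X,
      smul_eq_mul, map_add]
    convert! this using 1
    simp only [zero_smul, add_zero]
    by_cases h : j = i
    · subst h; simp; ring
    · simp [h]; ring

/-- Sums of functions `P(z) ‖z‖^e h(‖z‖)`, with `P` homogeneous, `h` analytic at `0`, and
`deg P + e = k`. -/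
inductive RadialSymbol (d : ℕ) (k : ℤ) : (EuclideanSpace ℝ (Fin d) → ℝ) → Prop
  | zero : RadialSymbol d k fun _ => 0
  | term (P : MvPolynomial (Fin d) ℝ) (n : ℕ) (hP : P.IsHomogeneous n) (e : ℤ)
      (h : ℝ → ℝ) (hh : AnalyticAt ℝ h 0) (hk : (n : ℤ) + e = k) :
      RadialSymbol d k fun z => MvPolynomial.eval z.ofLp P * (‖z‖ ^ e * h ‖z‖)
  | add (g₁ g₂ : EuclideanSpace ℝ (Fin d) → ℝ) :
      RadialSymbol d k g₁ → RadialSymbol d k g₂ → RadialSymbol d k fun z => g₁ z + g₂ z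

theorem tendsto_norm_punctured :
    Tendsto (fun z : EuclideanSpace ℝ (Fin d) => ‖z‖) (𝓝[≠] 0) (𝓝 0) :=
  tendsto_norm_zero.mono_left nhdsWithin_le_nhds

theorem RadialSymbol.isBigO {k : ℤ} {g : EuclideanSpace ℝ (Fin d) → ℝ}
    (hg : RadialSymbol d k g) : g =O[𝓝[≠] 0] fun z => ‖z‖ ^ k := by
  induction hg with
  | zero => exact Asymptotics.isBigO_zero _ _
  | add g₁ g₂ _ _ h₁ h₂ => exact h₁.add h₂
  | term P n hP e h hh hk =>
    obtain ⟨C, hC⟩ := abs_eval_le_of_isHomogeneous hP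
    have h1 : (fun z : EuclideanSpace ℝ (Fin d) => MvPolynomial.eval z.ofLp P)
        =O[𝓝[≠] 0] fun z => ‖z‖ ^ n :=
      Asymptotics.IsBigO.of_bound C (Eventually.of_forall fun z => by
        simpa using hC z)
    have h2 : (fun z : EuclideanSpace ℝ (Fin d) => h ‖z‖) =O[𝓝[≠] 0] fun _ => (1 : ℝ) :=
      (hh.continuousAt.tendsto.comp tendsto_norm_punctured).isBigO_one ℝ
    refine (h1.mul ((Asymptotics.isBigO_refl (fun z : EuclideanSpace ℝ (Fin d) => ‖z‖ ^ e)
      (𝓝[≠] 0)).mul h2)).congr' (EventuallyEq.rfl) ?_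
    filter_upwards [self_mem_nhdsWithin] with z hz
    rw [mul_one, ← hk, zpow_add₀ (norm_ne_zero_iff.mpr hz), zpow_natCast]

theorem hasDerivAt_norm_line {z : EuclideanSpace ℝ (Fin d)} (hz : z ≠ 0) (i : Fin d) :
    HasDerivAt (fun t : ℝ => ‖z + t • EuclideanSpace.single i (1 : ℝ)‖) (z i / ‖z‖) 0 := by
  have h1 : HasDerivAt (fun t : ℝ => z + t • EuclideanSpace.single i (1 : ℝ))
      (EuclideanSpace.single i (1 : ℝ)) 0 := by
    simpa using ((hasDerivAt_id (0 : ℝ)).smul_const (EuclideanSpace.single i (1 : ℝ))).const_add z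
  have h2 := h1.norm_sq.sqrt (by simpa using hz)
  simp only [zero_smul, add_zero, Real.sqrt_sq (norm_nonneg _)] at h2
  convert! h2 using 1
  simp [EuclideanSpace.inner_single_right]
  field_simp

/-- The class is built to be stable under differentiation off the origin, each derivative costing
one order. Non-smooth remainders of the radial expansion can thus be differentiated repeatedly. -/
theorem RadialSymbol.exists_hasLineDerivAt {k : ℤ} {g : EuclideanSpace ℝ (Fin d) → ℝ}
    (hg : RadialSymbol d k g) (i : Fin d) :
    ∃ g', RadialSymbol d (k - 1) g' ∧
      ∀ᶠ z in 𝓝[≠] 0, HasLineDerivAt ℝ g (g' z) z (EuclideanSpace.single i 1) := by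
  induction hg with
  | zero =>
    exact ⟨_, .zero, Eventually.of_forall fun z => hasDerivAt_const _ _⟩
  | add g₁ g₂ _ _ h₁ h₂ =>
    obtain ⟨g₁', h₁', H₁⟩ := h₁
    obtain ⟨g₂', h₂', H₂⟩ := h₂
    refine ⟨_, .add _ _ h₁' h₂', ?_⟩
    filter_upwards [H₁, H₂] with z a b using HasDerivAt.add a b
  | term P n hP e h hh hk =>
    -- The derivative of `‖z‖^e h(‖z‖)` along `e_i` is `z_i ‖z‖^(e-2) (e h + ‖z‖ h')`, with an
    -- analytic profile again.
    have hh' : AnalyticAt ℝ (fun s => e * h s + s * deriv h s) 0 :=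
      (analyticAt_const.mul hh).add (analyticAt_id.mul hh.deriv)
    have key : ∀ᶠ z : EuclideanSpace ℝ (Fin d) in 𝓝[≠] 0,
        HasLineDerivAt ℝ (fun z => MvPolynomial.eval z.ofLp P * (‖z‖ ^ e * h ‖z‖))
        (MvPolynomial.eval z.ofLp (MvPolynomial.pderiv i P) * (‖z‖ ^ e * h ‖z‖) +
          MvPolynomial.eval z.ofLp (P * MvPolynomial.X i) *
            (‖z‖ ^ (e - 2) * (e * h ‖z‖ + ‖z‖ * deriv h ‖z‖))) z
        (EuclideanSpace.single i 1) := by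
      filter_upwards [self_mem_nhdsWithin,
        tendsto_norm_punctured.eventually hh.eventually_analyticAt] with z hz hana
      have hz0 : ‖z‖ ≠ 0 := norm_ne_zero_iff.mpr hz
      have hφ : HasDerivAt (fun s => s ^ e * h s)
          (e * ‖z‖ ^ (e - 1) * h ‖z‖ + ‖z‖ ^ e * deriv h ‖z‖) ‖z‖ :=
        (hasDerivAt_zpow e ‖z‖ (Or.inl hz0)).mul hana.differentiableAt.hasDerivAt
      have h1 := hasDerivAt_norm_line hz i
      have h2 : HasDerivAt (fun t : ℝ => ‖z + t • EuclideanSpace.single i (1 : ℝ)‖ ^ e *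
          h ‖z + t • EuclideanSpace.single i (1 : ℝ)‖)
          ((e * ‖z‖ ^ (e - 1) * h ‖z‖ + ‖z‖ ^ e * deriv h ‖z‖) * (z i / ‖z‖)) 0 := by
        have hφ' : HasDerivAt (fun s => s ^ e * h s)
          (e * ‖z‖ ^ (e - 1) * h ‖z‖ + ‖z‖ ^ e * deriv h ‖z‖)
            ‖z + (0 : ℝ) • EuclideanSpace.single i (1 : ℝ)‖ := by simpa using hφ
        exact HasDerivAt.comp (0 : ℝ) hφ' h1
      have h3 := HasDerivAt.mul (hasLineDerivAt_eval P i z) h2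
      unfold HasLineDerivAt
      convert! h3 using 1
      simp only [zero_smul, add_zero, map_mul, MvPolynomial.eval_X]
      rw [show e - 2 = e - 1 - 1 by ring, zpow_sub_one₀ hz0 (e - 1), zpow_sub_one₀ hz0 e]
      field_simp
    refine ⟨_, RadialSymbol.add (k := k - 1) _ _ ?_ ?_, key⟩
    -- For `n = 0` the truncated degree `n - 1` would break the count `deg P + e`, but then `P` is
    -- constant and this term is zero.
    · rcases Nat.eq_zero_or_pos n with rfl | hn
      · have : MvPolynomial.pderiv i P = 0 := by
          rw [MvPolynomial.totalDegree_eq_zero_iff_eq_C.mp (Nat.le_zero.mp hP.totalDegree_le)]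
          simp
        simpa [this] using RadialSymbol.zero (d := d) (k := k - 1)
      · exact .term _ (n - 1) hP.pderiv e h hh (by omega)
    · exact .term _ (n + 1) (hP.mul (MvPolynomial.isHomogeneous_X _ i)) (e - 2) _ hh'
        (by push_cast; omega)

/-- Near `0`, the function `g` is the polynomial `P` up to a radial symbol of order `k`. -/
def HasJet (k : ℤ) (g : EuclideanSpace ℝ (Fin d) → ℝ) (P : MvPolynomial (Fin d) ℝ) : Prop :=
  g 0 = MvPolynomial.eval 0 P ∧ ∃ σ, RadialSymbol d k σ ∧
    ∀ᶠ z in 𝓝[≠] 0, g z = MvPolynomial.eval z.ofLp P + σ z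

/-- Order at least `2` makes the remainder `O(‖z‖²)`, so at the origin it has zero derivative. The
value at `0` must be tracked separately because symbols are controlled only on a punctured
neighbourhood. -/
theorem HasJet.partialDeriv {k : ℤ} (hk : 2 ≤ k) {g : EuclideanSpace ℝ (Fin d) → ℝ}
    {P : MvPolynomial (Fin d) ℝ} (hg : HasJet k g P) (i : Fin d) :
    HasJet (k - 1) (partialDeriv i g) (MvPolynomial.pderiv i P) := by
  obtain ⟨h0, σ, hσ, hgσ⟩ := hg
  obtain ⟨σ', hσ', hd⟩ := hσ.exists_hasLineDerivAt i
  refine ⟨?_, σ', hσ', ?_⟩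
  · apply HasLineDerivAt.lineDeriv
    have hP := hasLineDerivAt_eval P i (0 : EuclideanSpace ℝ (Fin d))
    unfold HasLineDerivAt at hP ⊢
    simp only [zero_add] at hP ⊢
    have hrem : HasDerivAt (fun t : ℝ => g (t • EuclideanSpace.single i (1 : ℝ)) -
        MvPolynomial.eval (t • EuclideanSpace.single i (1 : ℝ) : EuclideanSpace ℝ (Fin d)).ofLp P)
        0 0 := by
      have hbig : (fun z => g z - MvPolynomial.eval z.ofLp P)
          =O[𝓝 (0 : EuclideanSpace ℝ (Fin d))] fun z => ‖z‖ ^ (2 : ℕ) := by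
        have h1 : (fun z => g z - MvPolynomial.eval z.ofLp P)
            =O[𝓝[≠] (0 : EuclideanSpace ℝ (Fin d))] fun z => ‖z‖ ^ (2 : ℕ) := by
          refine (hσ.isBigO.congr' (hgσ.mono fun z hz => by simp [hz]) EventuallyEq.rfl).trans ?_
          refine Asymptotics.IsBigO.of_bound 1 ?_
          have : ∀ᶠ z : EuclideanSpace ℝ (Fin d) in 𝓝[≠] 0, ‖z‖ < 1 :=
            tendsto_norm_punctured.eventually (gt_mem_nhds one_pos)
          filter_upwards [this, self_mem_nhdsWithin] with z hz hz0
          have hpos : 0 < ‖z‖ := norm_pos_iff.mpr hz0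
          rw [one_mul, Real.norm_of_nonneg (by positivity), Real.norm_of_nonneg (by positivity),
            ← zpow_natCast]
          exact zpow_le_zpow_right_of_le_one₀ hpos hz.le (by exact_mod_cast hk)
        obtain ⟨C, hC⟩ := h1.bound
        refine Asymptotics.IsBigO.of_bound C ?_
        rw [eventually_nhdsWithin_iff] at hC
        filter_upwards [hC] with z hz
        by_cases hz0 : z = 0
        · subst hz0; simp [h0]
        · exact hz hz0
      have htend : Tendsto (fun t : ℝ => t • EuclideanSpace.single i (1 : ℝ)) (𝓝 0)
          (𝓝 (0 : EuclideanSpace ℝ (Fin d))) := by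
        have : Continuous fun t : ℝ => t • EuclideanSpace.single i (1 : ℝ) := by fun_prop
        simpa using this.tendsto 0
      have h2 := hbig.comp_tendsto htend
      rw [hasDerivAt_iff_isLittleO]
      simp only [sub_zero, smul_zero, zero_smul, WithLp.ofLp_zero, h0, sub_self]
      refine Asymptotics.IsBigO.trans_isLittleO (g := fun t : ℝ => t ^ 2) ?_ ?_
      · refine h2.trans (Asymptotics.IsBigO.of_bound 1 (Eventually.of_forall fun t => ?_))
        simp [norm_smul]
      · simpa using Asymptotics.isLittleO_pow_id (𝕜 := ℝ) one_lt_two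
    have := HasDerivAt.fun_add hrem hP
    simpa using this
  · have h1 := eventually_eventually_nhdsWithin.mpr hgσ
    filter_upwards [h1, hd, self_mem_nhdsWithin] with z hz hdz hz0
    apply HasLineDerivAt.lineDeriv
    -- Away from the origin, a punctured neighbourhood of `0` is an ordinary neighbourhood of `z`.
    have hz' : g =ᶠ[𝓝 z] fun z => MvPolynomial.eval z.ofLp P + σ z := by
      rwa [(isOpen_compl_singleton.nhdsWithin_eq hz0)] at hz
    exact (HasDerivAt.add (hasLineDerivAt_eval P i z) hdz).congr_of_eventuallyEq (by
      have htend : Tendsto (fun t : ℝ => z + t • EuclideanSpace.single i (1 : ℝ)) (𝓝 0)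
          (𝓝 z) := by
        have : Continuous fun t : ℝ => z + t • EuclideanSpace.single i (1 : ℝ) := by fun_prop
        simpa using this.tendsto 0
      exact htend.eventually hz')

end Symbols

/-! ### Wronskian entries as Taylor coefficients, and the kernel expansion. -/

section Wronskian
variable {d : ℕ}

theorem HasJet.iterate_partialDeriv {k : ℤ} {g : EuclideanSpace ℝ (Fin d) → ℝ}
    {P : MvPolynomial (Fin d) ℝ} (hg : HasJet k g P) (i : Fin d) (n : ℕ) (h : (n : ℤ) + 1 ≤ k) :
    HasJet (k - n) ((_root_.partialDeriv i)^[n] g) ((MvPolynomial.pderiv i)^[n] P) := by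
  induction n with
  | zero => simpa using hg
  | succ n ih =>
    rw [Function.iterate_succ_apply', Function.iterate_succ_apply']
    have := (ih (by push_cast at h; omega)).partialDeriv (by push_cast at h; omega) i
    convert! this using 1
    push_cast; ring

theorem HasJet.foldr_partialDeriv (a : Fin d → ℕ) (l : List (Fin d)) {k : ℤ}
    {g : EuclideanSpace ℝ (Fin d) → ℝ} {P : MvPolynomial (Fin d) ℝ} (hg : HasJet k g P)
    (h : ((l.map a).sum : ℤ) + 1 ≤ k) :
    HasJet (k - (l.map a).sum) (l.foldr (fun i h => (_root_.partialDeriv i)^[a i] h) g)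
      (l.foldr (fun i Q => (MvPolynomial.pderiv i)^[a i] Q) P) := by
  induction l with
  | nil => simpa using hg
  | cons i l ih =>
    simp only [List.map_cons, List.sum_cons, List.foldr_cons] at h ⊢
    rw [Nat.cast_add] at h
    have := (ih (by omega)).iterate_partialDeriv i (a i) (by omega)
    convert! this using 1
    rw [Nat.cast_add]; ring

theorem coeff_iterate_pderiv (P : MvPolynomial (Fin d) ℝ) (i : Fin d) (n : ℕ) (c : Fin d →₀ ℕ) :
    ((MvPolynomial.pderiv i)^[n] P).coeff c =
      P.coeff (c + Finsupp.single i n) * ((c i + 1).ascFactorial n : ℕ) := by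
  induction n generalizing c with
  | zero => simp
  | succ n ih =>
    rw [Function.iterate_succ_apply', MvPolynomial.coeff_pderiv, ih, add_assoc,
      ← Finsupp.single_add, add_comm 1 n, mul_assoc]
    congr 1
    have h1 := Nat.succ_ascFactorial (c i + 1) n
    have h2 : (c i + 1).ascFactorial (n + 1) = (c i + 1 + n) * (c i + 1).ascFactorial n :=
      Nat.ascFactorial_succ
    rw [h2, ← h1]
    simp only [Finsupp.add_apply, Finsupp.single_eq_same, Nat.succ_eq_add_one]
    push_cast; ring

/-- Without repetitions in `l`, the index shift caused by one direction leaves the factorial factors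
of the others unchanged. -/
theorem coeff_foldr_pderiv (P : MvPolynomial (Fin d) ℝ) (a : Fin d → ℕ) (l : List (Fin d))
    (hl : l.Nodup) (c : Fin d →₀ ℕ) :
    (l.foldr (fun i Q => (MvPolynomial.pderiv i)^[a i] Q) P).coeff c =
      P.coeff (c + (l.map fun i => Finsupp.single i (a i)).sum) *
        (l.map fun i => (((c i + 1).ascFactorial (a i) : ℕ) : ℝ)).prod := by
  induction l generalizing c with
  | nil => simp
  | cons i l ih =>
    rw [List.nodup_cons] at hl
    simp only [List.foldr_cons, List.map_cons, List.sum_cons, List.prod_cons]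
    rw [coeff_iterate_pderiv, ih hl.2, add_assoc]
    have : (l.map fun j => ((((c + Finsupp.single i (a i)) j + 1).ascFactorial (a j) : ℕ) : ℝ)) =
        l.map fun j => (((c j + 1).ascFactorial (a j) : ℕ) : ℝ) := by
      refine List.map_congr_left fun j hj => ?_
      have : i ≠ j := fun h => hl.1 (h ▸ hj)
      simp [this]
    rw [this]; ring

/-- A multi-index as a finitely supported function. -/
def toFinsupp (a : Fin d → ℕ) : Fin d →₀ ℕ := Finsupp.equivFunOnFinite.symm a

@[simp] theorem toFinsupp_apply (a : Fin d → ℕ) (i : Fin d) : toFinsupp a i = a i := rfl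

theorem coeff_multi_pderiv (P : MvPolynomial (Fin d) ℝ) (a : Fin d → ℕ) (c : Fin d →₀ ℕ) :
    ((List.finRange d).foldr (fun i Q => (MvPolynomial.pderiv i)^[a i] Q) P).coeff c =
      P.coeff (c + toFinsupp a) * ∏ i, (((c i + 1).ascFactorial (a i) : ℕ) : ℝ) := by
  rw [coeff_foldr_pderiv P a _ (List.nodup_finRange d), ← Fin.sum_univ_def, ← Fin.prod_univ_def]
  congr 3
  exact Finsupp.univ_sum_single (toFinsupp a)

theorem HasJet.multiDeriv {k : ℤ} {g : EuclideanSpace ℝ (Fin d) → ℝ}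
    {P : MvPolynomial (Fin d) ℝ} (hg : HasJet k g P) (a : Fin d → ℕ)
    (h : ((∑ i, a i : ℕ) : ℤ) + 1 ≤ k) :
    HasJet (k - (∑ i, a i : ℕ)) (_root_.multiDeriv a g)
      ((List.finRange d).foldr (fun i Q => (MvPolynomial.pderiv i)^[a i] Q) P) := by
  rw [Fin.sum_univ_def] at h ⊢
  exact hg.foldr_partialDeriv a _ h

/-- The sign comes from reversing the line parameter. The `deriv` identities used need no
differentiability, so this holds for arbitrary `g`; the constant `c` makes it iterable. -/
theorem partialDeriv_const_mul_comp_sub (c : ℝ) (g : EuclideanSpace ℝ (Fin d) → ℝ)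
    (x : EuclideanSpace ℝ (Fin d)) (i : Fin d) :
    partialDeriv i (fun y => c * g (x - y)) = fun y => -c * partialDeriv i g (x - y) := by
  funext y
  unfold partialDeriv lineDeriv
  rw [deriv_const_mul_field, neg_mul, ← mul_neg]
  congr 1
  have := deriv_comp_neg (fun t : ℝ => g (x - y + t • EuclideanSpace.single i (1 : ℝ))) 0
  rw [neg_zero] at this
  rw [← this]
  congr 1
  funext t
  congr 1
  module

theorem multiDeriv_const_mul_comp_sub (c : ℝ) (g : EuclideanSpace ℝ (Fin d) → ℝ)
    (x : EuclideanSpace ℝ (Fin d)) (a : Fin d → ℕ) :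
    multiDeriv a (fun y => c * g (x - y)) =
      fun y => (-1) ^ (∑ i, a i) * c * multiDeriv a g (x - y) := by
  have hiter : ∀ (i : Fin d) (n : ℕ) (c : ℝ) (g : EuclideanSpace ℝ (Fin d) → ℝ),
      (partialDeriv i)^[n] (fun y => c * g (x - y)) =
        fun y => (-1) ^ n * c * (partialDeriv i)^[n] g (x - y) := by
    intro i n
    induction n with
    | zero => simp
    | succ n ih =>
      intro c g
      rw [Function.iterate_succ_apply', ih, partialDeriv_const_mul_comp_sub]
      funext y
      rw [Function.iterate_succ_apply']; ring
  unfold multiDeriv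
  rw [Fin.sum_univ_def]
  induction List.finRange d with
  | nil => simp
  | cons i l ih =>
    simp only [List.foldr_cons, List.map_cons, List.sum_cons]
    rw [ih, hiter]
    funext y
    ring

theorem multiDeriv_const_mul (c : ℝ) (g : EuclideanSpace ℝ (Fin d) → ℝ) (a : Fin d → ℕ) :
    multiDeriv a (fun y => c * g y) = fun y => c * multiDeriv a g y := by
  have h1 : ∀ (i : Fin d) (c : ℝ) (g : EuclideanSpace ℝ (Fin d) → ℝ),
      partialDeriv i (fun y => c * g y) = fun y => c * partialDeriv i g y := by
    intro i c g
    funext y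
    exact deriv_const_mul_field c
  have h2 : ∀ (i : Fin d) (n : ℕ) (g : EuclideanSpace ℝ (Fin d) → ℝ),
      (partialDeriv i)^[n] (fun y => c * g y) = fun y => c * (partialDeriv i)^[n] g y := by
    intro i n
    induction n with
    | zero => simp
    | succ n ih => intro g; rw [Function.iterate_succ_apply', ih, h1, Function.iterate_succ_apply']
  unfold multiDeriv
  induction List.finRange d with
  | nil => simp
  | cons i l ih => simp only [List.foldr_cons]; rw [ih, h2]

/-- Derivatives in the second variable are, up to `(-1)^|b|`, derivatives of `z ↦ f ‖z‖`. The jet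
allows total order at most `k - 1`, and the factorials combine into binomial coefficients. -/
theorem wronskianEntry_eq {f : ℝ → ℝ} {k : ℤ} {P : MvPolynomial (Fin d) ℝ}
    (hP : HasJet k (fun z : EuclideanSpace ℝ (Fin d) => f ‖z‖) P) (a b : Fin d → ℕ)
    (h : ((∑ i, a i : ℕ) : ℤ) + (∑ i, b i : ℕ) + 1 ≤ k) :
    wronskianEntry (stationaryKernel d f) a b =
      (-1) ^ (∑ i, b i) * P.coeff (toFinsupp a + toFinsupp b) *
        ∏ i, ((a i + b i).choose (b i) : ℝ) := by
  set F : EuclideanSpace ℝ (Fin d) → ℝ := fun z => f ‖z‖ with hF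
  have h1 : (fun x => multiDeriv b (fun y => stationaryKernel d f x y) 0) =
      fun x => (-1) ^ (∑ i, b i) * multiDeriv b F x := by
    funext x
    have := multiDeriv_const_mul_comp_sub 1 F x b
    simp only [one_mul, mul_one] at this
    have h2 : (fun y => stationaryKernel d f x y) = fun y => F (x - y) := rfl
    rw [h2, this]; simp
  have hj := (hP.multiDeriv b (by omega)).multiDeriv a (by omega)
  unfold wronskianEntry
  rw [h1, multiDeriv_const_mul]
  beta_reduce
  rw [hj.1, MvPolynomial.eval_zero, MvPolynomial.constantCoeff_eq, coeff_multi_pderiv, zero_add,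
    coeff_multi_pderiv]
  simp only [toFinsupp_apply, Finsupp.coe_zero, Pi.zero_apply, zero_add,
    Nat.choose_self, mul_one,
    Nat.ascFactorial_eq_factorial_mul_choose, Nat.cast_mul, Finset.prod_mul_distrib]
  have ha : (∏ i, ((a i).factorial : ℝ)) ≠ 0 := by positivity
  have hb : (∏ i, ((b i).factorial : ℝ)) ≠ 0 := by positivity
  field_simp

theorem MonLT.toFun_injective {K : ℕ} : Function.Injective (MonLT.toFun : MonLT d K → Fin d → ℕ) :=
  fun _ _ h => Subtype.ext (funext fun i => Fin.ext (congrFun h i))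

theorem MonLT.sum_lt {K : ℕ} (a : MonLT d K) : ∑ i, a.toFun i < K := a.2

theorem MonLT.exists_toFun_eq {K : ℕ} (a : Fin d → ℕ) (h : ∑ i, a i < K) :
    ∃ b : MonLT d K, b.toFun = a :=
  ⟨⟨fun i => ⟨a i, (Finset.single_le_sum (fun j _ => Nat.zero_le (a j))
    (Finset.mem_univ i)).trans_lt h⟩, h⟩, rfl⟩

theorem prod_sub_pow_eq {K : ℕ} (c : Fin d → ℕ) (hc : ∑ i, c i < K) (x y : Fin d → ℝ) :
    ∏ i, (x i - y i) ^ c i = ∑ a : MonLT d K, ∑ b : MonLT d K,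
      if a.toFun + b.toFun = c then (-1) ^ (∑ i, b.toFun i) *
        (∏ i, ((a.toFun i + b.toFun i).choose (b.toFun i) : ℝ)) *
          (∏ i, x i ^ a.toFun i) * ∏ i, y i ^ b.toFun i else 0 := by
  have h1 : ∀ i, (x i - y i) ^ c i = ∑ m ∈ Finset.range (c i + 1),
      x i ^ m * (-y i) ^ (c i - m) * ((c i).choose m : ℝ) := fun i => by
    rw [sub_eq_add_neg, add_pow]
  rw [Finset.prod_congr rfl fun i _ => h1 i, Finset.prod_univ_sum, ← Fintype.sum_prod_type',
    ← Finset.sum_filter]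
  symm
  refine Finset.sum_bij (fun p _ => p.1.toFun) ?_ ?_ ?_ ?_
  · intro p hp
    simp only [Finset.mem_filter, Finset.mem_univ, true_and] at hp
    simp only [Fintype.mem_piFinset, Finset.mem_range]
    intro i
    have := congrFun hp i
    simp only [Pi.add_apply] at this
    omega
  · intro p hp q hq h
    simp only [Finset.mem_filter, Finset.mem_univ, true_and] at hp hq
    refine Prod.ext (MonLT.toFun_injective h) (MonLT.toFun_injective ?_)
    rw [h] at hp
    exact add_left_cancel (hp.trans hq.symm)
  · intro a ha
    simp only [Fintype.mem_piFinset, Finset.mem_range] at ha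
    obtain ⟨a', ha'⟩ := MonLT.exists_toFun_eq (K := K) a
      ((Finset.sum_le_sum fun i _ => Nat.lt_succ_iff.mp (ha i)).trans_lt hc)
    obtain ⟨b', hb'⟩ := MonLT.exists_toFun_eq (K := K) (c - a)
      ((Finset.sum_le_sum fun i _ => Nat.sub_le (c i) (a i)).trans_lt hc)
    refine ⟨(a', b'), ?_, ha'⟩
    simp only [Finset.mem_filter, Finset.mem_univ, true_and, ha', hb']
    funext i
    have := ha i
    simp only [Pi.add_apply, Pi.sub_apply]
    omega
  · intro p hp
    simp only [Finset.mem_filter, Finset.mem_univ, true_and] at hp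
    rw [← Finset.prod_pow_eq_pow_sum, ← Finset.prod_mul_distrib, ← Finset.prod_mul_distrib,
      ← Finset.prod_mul_distrib]
    refine Finset.prod_congr rfl fun i _ => ?_
    rw [← hp]
    simp only [Pi.add_apply, Nat.add_sub_cancel_left]
    rw [neg_pow, Nat.choose_symm_add]
    ring

/-- Binomial expansion of `P(x - y)` in monomials of both arguments. The coefficients are exactly
the numbers in `wronskianEntry_eq`. -/
theorem eval_sub_eq_sum {K : ℕ} (P : MvPolynomial (Fin d) ℝ) (hP : P.totalDegree < K)
    (x y : Fin d → ℝ) :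
    MvPolynomial.eval (x - y) P = ∑ a : MonLT d K, ∑ b : MonLT d K,
      (-1) ^ (∑ i, b.toFun i) * P.coeff (toFinsupp a.toFun + toFinsupp b.toFun) *
        (∏ i, ((a.toFun i + b.toFun i).choose (b.toFun i) : ℝ)) *
          (∏ i, x i ^ a.toFun i) * ∏ i, y i ^ b.toFun i := by
  rw [MvPolynomial.eval_eq']
  have hdeg : ∀ c ∈ P.support, ∑ i, c i < K := fun c hc => by
    have := (MvPolynomial.le_totalDegree hc).trans_lt hP
    rwa [Finsupp.sum_fintype _ _ fun _ => rfl] at this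
  rw [Finset.sum_congr rfl fun c hc => by
    rw [show (∏ i, (x - y) i ^ c i) = _ from prod_sub_pow_eq (fun i => c i) (hdeg c hc) x y,
      Finset.mul_sum, Finset.sum_congr rfl fun a _ => Finset.mul_sum _ _ _]]
  rw [Finset.sum_comm]
  refine Finset.sum_congr rfl fun a _ => ?_
  rw [Finset.sum_comm]
  refine Finset.sum_congr rfl fun b _ => ?_
  have hiff : ∀ c : Fin d →₀ ℕ, (a.toFun + b.toFun = fun i => c i) ↔
      c = toFinsupp a.toFun + toFinsupp b.toFun := fun c =>
    ⟨fun h => Finsupp.ext fun i => (congrFun h i).symm, fun h => by rw [h]; rfl⟩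
  simp only [hiff, mul_ite, mul_zero]
  rw [Finset.sum_ite_eq']
  split_ifs with h
  · ring
  · rw [MvPolynomial.notMem_support_iff.mp h]; ring


/-- The Taylor polynomial `∑_{j<M} f_{2j} ‖z‖^{2j}` of `z ↦ f ‖z‖`, when the odd coefficients
vanish. -/
def radialTaylor (d : ℕ) (f : ℝ → ℝ) (M : ℕ) : MvPolynomial (Fin d) ℝ :=
  ∑ j ∈ Finset.range M, MvPolynomial.C (taylorCoeffAtZero f (2 * j)) *
    (∑ i, MvPolynomial.X i ^ 2) ^ j

theorem eval_radialTaylor (f : ℝ → ℝ) (M : ℕ) (z : EuclideanSpace ℝ (Fin d)) :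
    MvPolynomial.eval z.ofLp (radialTaylor d f M) =
      ∑ j ∈ Finset.range M, taylorCoeffAtZero f (2 * j) * ‖z‖ ^ (2 * j) := by
  simp [radialTaylor, EuclideanSpace.real_norm_sq_eq, pow_mul]

theorem totalDegree_radialTaylor_lt (f : ℝ → ℝ) {M : ℕ} (hM : 1 ≤ M) :
    (radialTaylor d f M).totalDegree < 2 * M - 1 := by
  have : (radialTaylor d f M).totalDegree ≤ 2 * (M - 1) := by
    refine MvPolynomial.totalDegree_finsetSum_le fun j hj => ?_
    have hj' : 2 * j ≤ 2 * (M - 1) := by have := Finset.mem_range.mp hj; omega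
    refine (MvPolynomial.totalDegree_mul _ _).trans ?_
    rw [MvPolynomial.totalDegree_C, zero_add]
    refine (MvPolynomial.totalDegree_pow _ _).trans ?_
    refine le_trans ?_ hj'
    rw [mul_comm]
    refine Nat.mul_le_mul_right j (MvPolynomial.totalDegree_finsetSum_le fun i _ => ?_)
    exact (MvPolynomial.totalDegree_pow _ _).trans (by simp)
  omega

/-- The odd Taylor coefficients of `f` of order less than `2M - 1` vanish. -/
def OddCoeffsVanish (f : ℝ → ℝ) (M : ℕ) : Prop :=
  ∀ j, 1 ≤ j → j < M → taylorCoeffAtZero f (2 * j - 1) = 0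

theorem sum_taylor_eq_even {f : ℝ → ℝ} {M : ℕ} (hM : 1 ≤ M) (hf : OddCoeffsVanish f M) (s : ℝ) :
    ∑ k ∈ Finset.range (2 * M - 1), taylorCoeffAtZero f k * s ^ k =
      ∑ j ∈ Finset.range M, taylorCoeffAtZero f (2 * j) * s ^ (2 * j) := by
  induction M, hM using Nat.le_induction with
  | base => simp
  | succ M hM ih =>
    rw [show 2 * (M + 1) - 1 = (2 * M - 1) + 1 + 1 by omega, Finset.sum_range_succ,
      Finset.sum_range_succ, ih fun j h1 h2 => hf j h1 (by omega), hf M hM (by omega),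
      Finset.sum_range_succ, show 2 * M - 1 + 1 = 2 * M by omega]
    ring

theorem hasJet_radial {f : ℝ → ℝ} (hf : AnalyticAt ℝ f 0) {M : ℕ} (hM : 1 ≤ M)
    (ho : OddCoeffsVanish f M) :
    HasJet ((2 * M - 1 : ℕ) : ℤ) (fun z : EuclideanSpace ℝ (Fin d) => f ‖z‖)
      (radialTaylor d f M) := by
  obtain ⟨h, hh, H⟩ := exists_taylor_remainder hf (2 * M - 1)
  have H' : ∀ z : EuclideanSpace ℝ (Fin d), f ‖z‖ =
      MvPolynomial.eval z.ofLp (radialTaylor d f M) + ‖z‖ ^ (2 * M - 1) * h ‖z‖ := fun z => by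
    rw [H, sum_taylor_eq_even hM ho, eval_radialTaylor]
  refine ⟨?_, _, .term 1 0 (MvPolynomial.isHomogeneous_one _ _) ((2 * M - 1 : ℕ) : ℤ) h hh
    (by simp), Eventually.of_forall fun z => ?_⟩
  · have : 2 * M - 1 ≠ 0 := by omega
    beta_reduce
    rw [H' 0]; simp [this]
  · beta_reduce
    rw [H' z, zpow_natCast]; simp

/-- The Wronskian entries of total order less than `K`. -/
def wronskianTrunc (d : ℕ) (f : ℝ → ℝ) (K : ℕ) (a b : MonLT d K) : ℝ :=
  if ∑ i, a.toFun i + ∑ i, b.toFun i < K then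
    wronskianEntry (stationaryKernel d f) a.toFun b.toFun else 0

theorem monomialEval_smul (a : Fin d → ℕ) (ε : ℝ) (x : EuclideanSpace ℝ (Fin d)) :
    monomialEval a (ε • x) = ε ^ (∑ i, a i) * monomialEval a x := by
  simp [monomialEval, mul_pow, Finset.prod_mul_distrib, Finset.prod_pow_eq_pow_sum]

/-- The cut-off in `wronskianTrunc` costs nothing, since the polynomial has degree at most `2M - 2`
and its coefficients beyond are zero. -/
theorem eval_radialTaylor_sub {f : ℝ → ℝ} (hf : AnalyticAt ℝ f 0) {M : ℕ} (hM : 1 ≤ M)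
    (ho : OddCoeffsVanish f M) (x y : EuclideanSpace ℝ (Fin d)) :
    MvPolynomial.eval (x - y).ofLp (radialTaylor d f M) =
      ∑ a : MonLT d (2 * M - 1), ∑ b : MonLT d (2 * M - 1),
        wronskianTrunc d f (2 * M - 1) a b * monomialEval a.toFun x * monomialEval b.toFun y := by
  rw [WithLp.ofLp_sub, eval_sub_eq_sum _ (totalDegree_radialTaylor_lt f hM)]
  refine Finset.sum_congr rfl fun a _ => Finset.sum_congr rfl fun b _ => ?_
  have hcoef : (-1) ^ (∑ i, b.toFun i) *
      (radialTaylor d f M).coeff (toFinsupp a.toFun + toFinsupp b.toFun) *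
        (∏ i, ((a.toFun i + b.toFun i).choose (b.toFun i) : ℝ)) =
      wronskianTrunc d f (2 * M - 1) a b := by
    unfold wronskianTrunc
    split_ifs with h
    · exact (wronskianEntry_eq (hasJet_radial hf hM ho) _ _ (by exact_mod_cast h)).symm
    · rw [MvPolynomial.coeff_eq_zero_of_totalDegree_lt]
      · simp
      · refine (totalDegree_radialTaylor_lt f hM).trans_le ?_
        have : ∑ i ∈ (toFinsupp a.toFun + toFinsupp b.toFun).support,
            (toFinsupp a.toFun + toFinsupp b.toFun) i =
            ∑ i, a.toFun i + ∑ i, b.toFun i := by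
          rw [← Finset.sum_add_distrib]
          refine Finset.sum_subset (Finset.subset_univ _) fun i _ hi => ?_
          simpa using hi
        rw [this]; omega
  rw [hcoef]; rfl

/-- Small-scale expansion of the kernel in monomials of both arguments. -/
theorem kernel_expansion {f : ℝ → ℝ} (hf : AnalyticAt ℝ f 0) {M : ℕ} (hM : 1 ≤ M)
    (ho : OddCoeffsVanish f M) (x y : EuclideanSpace ℝ (Fin d)) :
    (fun ε : ℝ => f (ε * ‖x - y‖) - (∑ a : MonLT d (2 * M - 1), ∑ b : MonLT d (2 * M - 1),
        ε ^ (∑ i, a.toFun i + ∑ i, b.toFun i) * (wronskianTrunc d f (2 * M - 1) a b *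
          monomialEval a.toFun x * monomialEval b.toFun y) +
        ε ^ (2 * M - 1) * (taylorCoeffAtZero f (2 * M - 1) * ‖x - y‖ ^ (2 * M - 1))))
      =O[𝓝[>] 0] fun ε => ε ^ (2 * M) := by
  obtain ⟨h, hh, H⟩ := exists_taylor_remainder hf (2 * M)
  have htend : Tendsto (fun ε : ℝ => ε * ‖x - y‖) (𝓝[>] 0) (𝓝 0) := by
    have : Continuous fun ε : ℝ => ε * ‖x - y‖ := by fun_prop
    simpa using (this.tendsto 0).mono_left nhdsWithin_le_nhds
  have h1 : (fun ε : ℝ => ‖x - y‖ ^ (2 * M) * h (ε * ‖x - y‖)) =O[𝓝[>] 0] fun _ => (1 : ℝ) :=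
    ((hh.continuousAt.tendsto.comp htend).isBigO_one ℝ).const_mul_left _
  have h2 := (Asymptotics.isBigO_refl (fun ε : ℝ => ε ^ (2 * M)) (𝓝[>] 0)).mul h1
  simp only [mul_one] at h2
  refine h2.congr' ?_ EventuallyEq.rfl
  filter_upwards [self_mem_nhdsWithin] with ε hε
  have hε' : 0 < ε := hε
  have h3 := eval_radialTaylor_sub hf hM ho (ε • x) (ε • y)
  rw [eval_radialTaylor, ← smul_sub, norm_smul, Real.norm_of_nonneg hε'.le] at h3
  -- Peeling off the last Taylor term separates the first odd power from the even, polynomial part.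
  rw [H, show 2 * M = 2 * M - 1 + 1 by omega, Finset.sum_range_succ,
    sum_taylor_eq_even hM ho, h3, show 2 * M - 1 + 1 = 2 * M by omega]
  simp only [monomialEval_smul]
  have h4 : ∀ a b : MonLT d (2 * M - 1),
      wronskianTrunc d f (2 * M - 1) a b * (ε ^ (∑ i, a.toFun i) * monomialEval a.toFun x) *
        (ε ^ (∑ i, b.toFun i) * monomialEval b.toFun y) =
      ε ^ (∑ i, a.toFun i + ∑ i, b.toFun i) * (wronskianTrunc d f (2 * M - 1) a b *
          monomialEval a.toFun x * monomialEval b.toFun y) := fun a b => by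
    rw [pow_add]; ring
  simp only [h4]
  ring

end Wronskian

/-! ### Quadratic forms of the kernel at small scale, and nonnegativity of the Wronskian. -/

section Forms
variable {d : ℕ}

theorem sum_monLT_eq {l K : ℕ} (hlK : l ≤ K) (g : (Fin d → ℕ) → ℝ)
    (hg : ∀ a, l ≤ ∑ i, a i → g a = 0) :
    ∑ a : MonLT d K, g a.toFun = ∑ a : MonLT d l, g a.toFun := by
  symm
  refine Finset.sum_of_injOn
    (fun a => (MonLT.exists_toFun_eq a.toFun (a.sum_lt.trans_le hlK)).choose)
    ?_ ?_ ?_ ?_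
  · intro a _ b _ h
    have ha := (MonLT.exists_toFun_eq a.toFun (a.sum_lt.trans_le hlK)).choose_spec
    have hb := (MonLT.exists_toFun_eq b.toFun (b.sum_lt.trans_le hlK)).choose_spec
    beta_reduce at h
    rw [h] at ha
    exact MonLT.toFun_injective (ha.symm.trans hb)
  · intro a _; simp
  · intro a _ ha
    refine hg _ (le_of_not_gt fun h => ha ?_)
    obtain ⟨b, hb⟩ := MonLT.exists_toFun_eq a.toFun h
    refine ⟨b, by simp, MonLT.toFun_injective ?_⟩
    rw [(MonLT.exists_toFun_eq b.toFun (b.sum_lt.trans_le hlK)).choose_spec, hb]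
  · intro a _
    rw [(MonLT.exists_toFun_eq a.toFun (a.sum_lt.trans_le hlK)).choose_spec]

/-- The moment of order `a` of the weights `c` at the points `y`. -/
def moment {ι : Type*} [Fintype ι] (y : ι → EuclideanSpace ℝ (Fin d)) (c : ι → ℝ)
    (a : Fin d → ℕ) : ℝ :=
  ∑ i, c i * monomialEval a (y i)

/-- The points of the grid `{1, …, K}^d`. -/
def gridPoint (d K : ℕ) (t : Fin d → Fin K) : EuclideanSpace ℝ (Fin d) :=
  WithLp.toLp 2 fun i => ((t i : ℕ) : ℝ) + 1

theorem gridPoint_ne_zero (hd : 0 < d) (K : ℕ) (t : Fin d → Fin K) : gridPoint d K t ≠ 0 := by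
  intro h
  have := congrArg (fun z : EuclideanSpace ℝ (Fin d) => z ⟨0, hd⟩) h
  simp only [gridPoint, PiLp.zero_apply] at this
  have h2 : (0 : ℝ) ≤ ((t ⟨0, hd⟩ : ℕ) : ℝ) := Nat.cast_nonneg _
  linarith

/-- A polynomial of degree below `K` in each variable that vanishes on a product of `d` sets of size
`K` is zero. -/
theorem eq_zero_of_sum_grid_eq_zero {K : ℕ} (v : MonLT d K → ℝ)
    (hv : ∀ t, ∑ a, v a * monomialEval a.toFun (gridPoint d K t) = 0) : v = 0 := by
  by_cases hK : K = 0
  · subst hK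
    exact funext fun a => absurd a.2 (Nat.not_lt_zero _)
  set P : MvPolynomial (Fin d) ℝ := ∑ a : MonLT d K, MvPolynomial.monomial (toFinsupp a.toFun) (v a)
    with hP
  have hcoef : ∀ a : MonLT d K, P.coeff (toFinsupp a.toFun) = v a := by
    intro a
    rw [hP, MvPolynomial.coeff_sum, Finset.sum_eq_single a]
    · simp
    · intro b _ hba
      rw [MvPolynomial.coeff_monomial, if_neg]
      intro h
      exact hba (MonLT.toFun_injective (Finsupp.equivFunOnFinite.symm.injective h))
    · simp
  have hinj : Function.Injective fun m : Fin K => ((m : ℕ) : ℝ) + 1 := fun m m' h => by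
    simpa [Fin.ext_iff] using h
  have : P = 0 := by
    refine MvPolynomial.eq_zero_of_eval_zero_at_prod_finset P
      (fun _ => Finset.univ.map ⟨_, hinj⟩) (fun i => ?_) fun x hx => ?_
    · simp only [Finset.card_map, Finset.card_univ, Fintype.card_fin]
      rw [MvPolynomial.degreeOf_lt_iff (Nat.pos_of_ne_zero hK)]
      intro m hm
      rw [MvPolynomial.mem_support_iff, hP, MvPolynomial.coeff_sum] at hm
      obtain ⟨a, _, ha⟩ := Finset.exists_ne_zero_of_sum_ne_zero hm
      rw [MvPolynomial.coeff_monomial] at ha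
      have : toFinsupp a.toFun = m := by
        by_contra h; simp [h] at ha
      rw [← this]
      exact (a.1 i).2
    · have hx' : ∀ i, ∃ m : Fin K, ((m : ℕ) : ℝ) + 1 = x i := by simpa using hx
      choose t ht using hx'
      rw [← hv t, hP, map_sum]
      refine Finset.sum_congr rfl fun a _ => ?_
      rw [MvPolynomial.eval_monomial, Finsupp.prod_fintype _ _ fun _ => pow_zero _]
      simp [monomialEval, gridPoint, ht]
  funext a
  rw [← hcoef a, this]; rfl

/-- Evaluation on the grid is injective on polynomials of degree below `K`. A left inverse supplies
weights with any prescribed moments up to that degree. -/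
theorem exists_dual_weights (d K : ℕ) : ∃ U : MonLT d K → (Fin d → Fin K) → ℝ,
    ∀ a b : MonLT d K, moment (gridPoint d K) (U a) b.toFun = if a = b then 1 else 0 := by
  let E : (MonLT d K → ℝ) →ₗ[ℝ] ((Fin d → Fin K) → ℝ) :=
    (Matrix.of fun t (a : MonLT d K) => monomialEval a.toFun (gridPoint d K t)).mulVecLin
  have hE : ∀ v t, E v t = ∑ a, monomialEval a.toFun (gridPoint d K t) * v a := fun v t => rfl
  have hker : LinearMap.ker E = ⊥ := by
    refine LinearMap.ker_eq_bot'.mpr fun v hv => eq_zero_of_sum_grid_eq_zero v fun t => ?_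
    refine Eq.trans ?_ (congrFun hv t)
    rw [hE]
    exact Finset.sum_congr rfl fun a _ => mul_comm _ _
  obtain ⟨g, hg⟩ := LinearMap.exists_leftInverse_of_injective E hker
  refine ⟨fun a t => g (Pi.single t 1) a, fun a b => ?_⟩
  have h1 : g (E (Pi.single b 1)) = Pi.single b 1 := LinearMap.congr_fun hg _
  have h2 : E (Pi.single b 1) =
      ∑ t, monomialEval b.toFun (gridPoint d K t) • (Pi.single t 1 : (Fin d → Fin K) → ℝ) := by
    funext t
    simp [hE, Pi.single_apply]
  rw [h2, map_sum] at h1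
  have h3 := congrFun h1 a
  simp only [map_smul, Finset.sum_apply, Pi.smul_apply, smul_eq_mul] at h3
  simp only [moment]
  rw [Finset.sum_congr rfl fun t _ => mul_comm _ _, h3, Pi.single_apply]

variable {ι : Type*} [Fintype ι]

theorem IsPositiveKernel.form_nonneg {f : ℝ → ℝ} (hκ : IsPositiveKernel (stationaryKernel d f))
    (y : ι → EuclideanSpace ℝ (Fin d)) (c : ι → ℝ) {ε : ℝ} (hε : 0 < ε) :
    0 ≤ ∑ i, ∑ j, c i * c j * f (ε * ‖y i - y j‖) := by
  let e := Fintype.equivFin ι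
  have h := (hκ _ fun i => ε • y (e.symm i)).dotProduct_mulVec_nonneg fun i => c (e.symm i)
  simp only [dotProduct, Matrix.mulVec, Matrix.of_apply, Finset.mul_sum, star_trivial,
    stationaryKernel, ← smul_sub, norm_smul, Real.norm_of_nonneg hε.le] at h
  rw [← e.symm.sum_comp]
  convert! h using 2 with i
  rw [← e.symm.sum_comp]
  exact Finset.sum_congr rfl fun j _ => by ring

/-- The polynomial part, of order less than `K`, of the expansion of the kernel. -/
def kernelPoly (d : ℕ) (f : ℝ → ℝ) (K : ℕ) (ε : ℝ) (x y : EuclideanSpace ℝ (Fin d)) : ℝ :=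
  ∑ a : MonLT d K, ∑ b : MonLT d K, ε ^ (∑ i, a.toFun i + ∑ i, b.toFun i) *
    (wronskianTrunc d f K a b * monomialEval a.toFun x * monomialEval b.toFun y)

theorem tendsto_kernel_remainder {f : ℝ → ℝ} (hf : AnalyticAt ℝ f 0) {M : ℕ} (hM : 1 ≤ M)
    (ho : OddCoeffsVanish f M) (x y : EuclideanSpace ℝ (Fin d)) :
    Tendsto (fun ε : ℝ => (f (ε * ‖x - y‖) - kernelPoly d f (2 * M - 1) ε x y) / ε ^ (2 * M - 1))
      (𝓝[>] 0) (𝓝 (taylorCoeffAtZero f (2 * M - 1) * ‖x - y‖ ^ (2 * M - 1))) := by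
  have h1 := kernel_expansion hf hM ho x y
  have h2 : Tendsto (fun ε : ℝ => (f (ε * ‖x - y‖) - (kernelPoly d f (2 * M - 1) ε x y +
      ε ^ (2 * M - 1) * (taylorCoeffAtZero f (2 * M - 1) * ‖x - y‖ ^ (2 * M - 1)))) /
        ε ^ (2 * M - 1)) (𝓝[>] 0) (𝓝 0) := by
    refine (h1.trans_isLittleO ?_).tendsto_div_nhds_zero
    refine Asymptotics.IsLittleO.mono ?_ nhdsWithin_le_nhds
    exact Asymptotics.isLittleO_pow_pow (by omega)
  have h3 := h2.add_const (taylorCoeffAtZero f (2 * M - 1) * ‖x - y‖ ^ (2 * M - 1))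
  rw [zero_add] at h3
  refine h3.congr' ?_
  filter_upwards [self_mem_nhdsWithin] with ε hε
  have : ε ≠ 0 := ne_of_gt hε
  field_simp
  ring

theorem sum_kernelPoly (f : ℝ → ℝ) (K : ℕ) (ε : ℝ)
    (y : ι → EuclideanSpace ℝ (Fin d)) (c : ι → ℝ) :
    ∑ i, ∑ j, c i * c j * kernelPoly d f K ε (y i) (y j) =
      ∑ a : MonLT d K, ∑ b : MonLT d K, ε ^ (∑ i, a.toFun i + ∑ i, b.toFun i) *
        (wronskianTrunc d f K a b * moment y c a.toFun * moment y c b.toFun) := by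
  simp only [kernelPoly, moment, Finset.mul_sum, Finset.sum_mul]
  rw [Finset.sum_congr rfl fun i _ => Finset.sum_comm, Finset.sum_comm]
  refine Finset.sum_congr rfl fun a _ => ?_
  rw [Finset.sum_congr rfl fun i _ => Finset.sum_comm, Finset.sum_comm]
  refine Finset.sum_congr rfl fun b _ => ?_
  rw [Finset.sum_comm]
  exact Finset.sum_congr rfl fun i _ => Finset.sum_congr rfl fun j _ => by ring

/-- The weights may move with `ε` as long as they converge. This freedom lets moments of different
degrees be balanced against powers of `ε`. -/
theorem tendsto_form_remainder {f : ℝ → ℝ} (hf : AnalyticAt ℝ f 0) {M : ℕ} (hM : 1 ≤ M)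
    (ho : OddCoeffsVanish f M) (y : ι → EuclideanSpace ℝ (Fin d)) {c : ℝ → ι → ℝ} {c₀ : ι → ℝ}
    (hc : Tendsto c (𝓝[>] 0) (𝓝 c₀)) :
    Tendsto (fun ε => (∑ i, ∑ j, c ε i * c ε j * f (ε * ‖y i - y j‖) -
      ∑ i, ∑ j, c ε i * c ε j * kernelPoly d f (2 * M - 1) ε (y i) (y j)) / ε ^ (2 * M - 1))
      (𝓝[>] 0) (𝓝 (taylorCoeffAtZero f (2 * M - 1) *
        ∑ i, ∑ j, c₀ i * c₀ j * ‖y i - y j‖ ^ (2 * M - 1))) := by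
  have hci := fun i => tendsto_pi_nhds.mp hc i
  have h := tendsto_finsetSum Finset.univ fun i _ => tendsto_finsetSum Finset.univ fun j _ =>
    ((hci i).mul (hci j)).mul (tendsto_kernel_remainder hf hM ho (y i) (y j))
  convert! h using 1
  · funext ε
    simp only [← Finset.sum_sub_distrib, Finset.sum_div]
    exact Finset.sum_congr rfl fun i _ => Finset.sum_congr rfl fun j _ => by ring
  · simp only [Finset.mul_sum]
    congr 1
    exact Finset.sum_congr rfl fun i _ => Finset.sum_congr rfl fun j _ => by ring

/-- If the polynomial part of the expansion does not contribute, the leading odd term is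
nonnegative. -/
theorem odd_form_nonneg {f : ℝ → ℝ} (hf : AnalyticAt ℝ f 0)
    (hκ : IsPositiveKernel (stationaryKernel d f)) {M : ℕ} (hM : 1 ≤ M)
    (ho : OddCoeffsVanish f M) (y : ι → EuclideanSpace ℝ (Fin d)) {c : ℝ → ι → ℝ} {c₀ : ι → ℝ}
    (hc : Tendsto c (𝓝[>] 0) (𝓝 c₀))
    (hpoly : ∀ ε, 0 < ε → ∑ i, ∑ j, c ε i * c ε j * kernelPoly d f (2 * M - 1) ε (y i) (y j) = 0) :
    0 ≤ taylorCoeffAtZero f (2 * M - 1) *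
        ∑ i, ∑ j, c₀ i * c₀ j * ‖y i - y j‖ ^ (2 * M - 1) := by
  refine ge_of_tendsto (tendsto_form_remainder hf hM ho y hc) ?_
  filter_upwards [self_mem_nhdsWithin] with ε hε
  have hε' : 0 < ε := hε
  rw [hpoly ε hε, sub_zero]
  exact div_nonneg (hκ.form_nonneg y (c ε) hε) (by positivity)

theorem moment_sum_smul {τ : Type*} [Fintype τ] (y : ι → EuclideanSpace ℝ (Fin d)) (v : τ → ℝ)
    (U : τ → ι → ℝ) (b : Fin d → ℕ) :
    moment y (fun i => ∑ a, v a * U a i) b = ∑ a, v a * moment y (U a) b := by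
  simp only [moment, Finset.mul_sum, Finset.sum_mul]
  rw [Finset.sum_comm]
  exact Finset.sum_congr rfl fun i _ => Finset.sum_congr rfl fun j _ => by ring

/-- With moments `ε^(l-1-|a|) v_a`, every term of the polynomial part scales like `ε^(2(l-1))`, so
that part is exactly this power times the Wronskian form. The remainder is one order smaller, and
dividing leaves the form as a limit of nonnegative numbers. -/
theorem wronskianLT_posSemidef {f : ℝ → ℝ} (hf : AnalyticAt ℝ f 0)
    (hκ : IsPositiveKernel (stationaryKernel d f)) {l : ℕ} (ho : OddCoeffsVanish f l) :
    ∀ v : MonLT d l → ℝ,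
      0 ≤ ∑ a, ∑ b, v a * v b * wronskianEntry (stationaryKernel d f) a.toFun b.toFun := by
  intro v
  rcases Nat.eq_zero_or_pos l with rfl | hl
  · have : IsEmpty (MonLT d 0) := ⟨fun a => absurd a.2 (Nat.not_lt_zero _)⟩
    simp
  obtain ⟨U, hU⟩ := exists_dual_weights d (2 * l - 1)
  set w : (Fin d → ℕ) → ℝ := Function.extend MonLT.toFun v (0 : (Fin d → ℕ) → ℝ) with hw
  have hwv : ∀ a, w (MonLT.toFun a) = v a := fun a => MonLT.toFun_injective.extend_apply v _ a
  have hw0 : ∀ a, l ≤ ∑ i, a i → w a = 0 := fun a ha =>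
    Function.extend_apply' v _ a fun ⟨b, hb⟩ => by
      have := b.sum_lt; rw [hb] at this; omega
  -- The natural subtraction truncates harmlessly, because `w` vanishes in degrees `≥ l`.
  let c : ℝ → (Fin d → Fin (2 * l - 1)) → ℝ := fun ε t =>
    ∑ a : MonLT d (2 * l - 1), (ε ^ (l - 1 - ∑ i, a.toFun i) * w a.toFun) * U a t
  have hmom : ∀ ε (b : MonLT d (2 * l - 1)), moment (gridPoint d (2 * l - 1)) (c ε) b.toFun =
      ε ^ (l - 1 - ∑ i, b.toFun i) * w b.toFun := by
    intro ε b
    rw [moment_sum_smul]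
    simp [hU]
  have hc : Tendsto c (𝓝[>] 0) (𝓝 (c 0)) := by
    have : Continuous c := by
      refine continuous_pi fun t => ?_
      fun_prop
    exact (this.tendsto 0).mono_left nhdsWithin_le_nhds
  set S := ∑ a : MonLT d l, ∑ b : MonLT d l,
    v a * v b * wronskianEntry (stationaryKernel d f) a.toFun b.toFun with hS
  have hpoly : ∀ ε : ℝ, ∑ i, ∑ j, c ε i * c ε j * kernelPoly d f (2 * l - 1) ε
      (gridPoint d _ i) (gridPoint d _ j) = ε ^ (2 * (l - 1)) * S := by
    intro ε
    rw [sum_kernelPoly, hS, Finset.mul_sum]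
    have h1 : ∀ a b : MonLT d (2 * l - 1), ε ^ (∑ i, a.toFun i + ∑ i, b.toFun i) *
        (wronskianTrunc d f (2 * l - 1) a b * moment (gridPoint d (2 * l - 1)) (c ε) a.toFun *
          moment (gridPoint d (2 * l - 1)) (c ε) b.toFun) =
        ε ^ (2 * (l - 1)) * (w a.toFun * w b.toFun *
          wronskianEntry (stationaryKernel d f) a.toFun b.toFun) := by
      intro a b
      rw [hmom, hmom]
      by_cases ha : l ≤ ∑ i, a.toFun i
      · simp [hw0 _ ha]
      by_cases hb : l ≤ ∑ i, b.toFun i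
      · simp [hw0 _ hb]
      have : ε ^ (2 * (l - 1)) = ε ^ (∑ i, a.toFun i + ∑ i, b.toFun i) *
          (ε ^ (l - 1 - ∑ i, a.toFun i) * ε ^ (l - 1 - ∑ i, b.toFun i)) := by
        rw [← pow_add, ← pow_add]; congr 1; omega
      rw [this, wronskianTrunc, if_pos (by omega)]
      ring
    simp only [h1]
    rw [sum_monLT_eq (l := l) (by omega) (fun a => ∑ b : MonLT d (2 * l - 1), ε ^ (2 * (l - 1)) *
      (w a * w b.toFun * wronskianEntry (stationaryKernel d f) a b.toFun))
      fun a ha => by simp [hw0 a ha]]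
    refine Finset.sum_congr rfl fun a _ => ?_
    rw [sum_monLT_eq (l := l) (by omega) (fun b => ε ^ (2 * (l - 1)) *
      (w a.toFun * w b * wronskianEntry (stationaryKernel d f) a.toFun b))
      fun b hb => by simp [hw0 b hb], Finset.mul_sum]
    simp only [hwv]
  have hlim := tendsto_form_remainder hf hl ho (gridPoint d (2 * l - 1)) hc
  have hlim2 : Tendsto (fun ε : ℝ => S + ε * ((∑ i, ∑ j, c ε i * c ε j *
      f (ε * ‖gridPoint d (2 * l - 1) i - gridPoint d (2 * l - 1) j‖) -
      ∑ i, ∑ j, c ε i * c ε j * kernelPoly d f (2 * l - 1) ε (gridPoint d _ i) (gridPoint d _ j)) /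
        ε ^ (2 * l - 1))) (𝓝[>] 0) (𝓝 S) := by
    have h0 : Tendsto (fun ε : ℝ => ε) (𝓝[>] 0) (𝓝 0) := nhdsWithin_le_nhds
    simpa using (h0.mul hlim).const_add S
  refine ge_of_tendsto hlim2 ?_
  filter_upwards [self_mem_nhdsWithin] with ε hε
  have hε' : 0 < ε := hε
  have hform := hκ.form_nonneg (gridPoint d (2 * l - 1)) (c ε) hε'
  rw [hpoly]
  have hexp : ε ^ (2 * l - 1) = ε ^ (2 * (l - 1)) * ε := by
    rw [← pow_succ]; congr 1; omega
  rw [hexp]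
  have : S + ε * ((∑ i, ∑ j, c ε i * c ε j *
      f (ε * ‖gridPoint d (2 * l - 1) i - gridPoint d (2 * l - 1) j‖) -
        ε ^ (2 * (l - 1)) * S) / (ε ^ (2 * (l - 1)) * ε)) =
      (∑ i, ∑ j, c ε i * c ε j *
        f (ε * ‖gridPoint d (2 * l - 1) i - gridPoint d (2 * l - 1) j‖)) / ε ^ (2 * (l - 1)) := by
    field_simp
    ring
  rw [this]
  positivity

end Forms

/-! ### Extrapolation functionals and strict conditional positivity of odd distance powers. -/

section StrictPositivity
variable {d : ℕ}

/-- Nodes of the extrapolation functional: `-1` and `1, …, K`. -/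
def extrapNode (K : ℕ) : Option (Fin K) → ℝ
  | none => -1
  | some j => ((j : ℕ) : ℝ) + 1

/-- Weights of the extrapolation functional `q ↦ q(-1) - ∑ ℓ_j(-1) q(j)`. -/
def extrapWeight (K : ℕ) : Option (Fin K) → ℝ
  | none => 1
  | some j => -(Lagrange.basis Finset.univ (fun j : Fin K => ((j : ℕ) : ℝ) + 1) j).eval (-1)

theorem extrapNode_ne_zero (K : ℕ) (o : Option (Fin K)) : extrapNode K o ≠ 0 := by
  cases o with
  | none => simp [extrapNode]
  | some j => exact Nat.cast_add_one_ne_zero _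

/-- The functional kills `t^k` for `k < K`. For `g` equal to `t^k` on the positive nodes, it
therefore sees only the discrepancy at `-1`. -/
theorem sum_extrapWeight_mul {K k : ℕ} (hk : k < K) (g : ℝ → ℝ) (hg : ∀ t, 0 < t → g t = t ^ k) :
    ∑ o, extrapWeight K o * g (extrapNode K o) = g (-1) - (-1) ^ k := by
  have hinj : Set.InjOn (fun j : Fin K => ((j : ℕ) : ℝ) + 1) (Finset.univ : Finset (Fin K)) :=
    fun j _ j' _ h => by simpa [Fin.ext_iff] using h
  have h1 := Lagrange.eq_interpolate (f := (Polynomial.X : Polynomial ℝ) ^ k) hinj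
    (by rw [Polynomial.degree_X_pow]; simpa using hk)
  have h2 := congrArg (Polynomial.eval (-1)) h1
  simp only [Lagrange.interpolate_apply, Polynomial.eval_finsetSum, Polynomial.eval_mul,
    Polynomial.eval_C, Polynomial.eval_pow, Polynomial.eval_X] at h2
  rw [Fintype.sum_option, h2]
  simp only [extrapWeight, extrapNode, one_mul]
  rw [sub_eq_add_neg, ← Finset.sum_neg_distrib]
  congr 1
  refine Finset.sum_congr rfl fun j _ => ?_
  rw [hg _ (by positivity)]
  ring

theorem sum_extrapWeight_mul_pow {K k : ℕ} (hk : k < K) :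
    ∑ o, extrapWeight K o * extrapNode K o ^ k = 0 := by
  rw [sum_extrapWeight_mul hk (fun t => t ^ k) fun _ _ => rfl, sub_self]

theorem sum_extrapWeight_mul_eval {K : ℕ} (q : Polynomial ℝ) (hq : q.natDegree < K) :
    ∑ o, extrapWeight K o * q.eval (extrapNode K o) = 0 := by
  simp only [Polynomial.eval_eq_sum_range, Finset.mul_sum]
  rw [Finset.sum_comm]
  refine Finset.sum_eq_zero fun k hk => ?_
  rw [Finset.sum_congr rfl fun o _ => mul_left_comm _ _ _, ← Finset.mul_sum,
    sum_extrapWeight_mul_pow (by have := Finset.mem_range.mp hk; omega), mul_zero]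

/-- Restricted to a line, a monomial of degree below `K` is a one-variable polynomial of degree
below `K`. -/
theorem moment_line_eq_zero {K : ℕ} (p u : EuclideanSpace ℝ (Fin d)) (a : Fin d → ℕ)
    (ha : ∑ i, a i < K) :
    moment (fun o => p + extrapNode K o • u) (extrapWeight K) a = 0 := by
  set q : Polynomial ℝ := ∏ i, (Polynomial.C (p i) + Polynomial.C (u i) * Polynomial.X) ^ a i
  have hq : q.natDegree < K := by
    refine ((Polynomial.natDegree_prod_le _ _).trans (Finset.sum_le_sum fun i _ => ?_)).trans_lt ha
    refine Polynomial.natDegree_pow_le.trans ?_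
    have : (Polynomial.C (p i) + Polynomial.C (u i) * Polynomial.X).natDegree ≤ 1 := by
      compute_degree
    nlinarith
  rw [← sum_extrapWeight_mul_eval q hq]
  refine Finset.sum_congr rfl fun o _ => ?_
  simp only [q, monomialEval, Polynomial.eval_prod, Polynomial.eval_pow, Polynomial.eval_add,
    Polynomial.eval_mul, Polynomial.eval_C, Polynomial.eval_X, PiLp.add_apply, PiLp.smul_apply,
    smul_eq_mul]
  congr 1
  exact Finset.prod_congr rfl fun i _ => by rw [mul_comm (u i)]

variable {ι κ : Type*} [Fintype ι] [Fintype κ]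

theorem moment_sumElim (y : ι → EuclideanSpace ℝ (Fin d)) (z : κ → EuclideanSpace ℝ (Fin d))
    (c : ι → ℝ) (w : κ → ℝ) (a : Fin d → ℕ) :
    moment (Sum.elim y z) (Sum.elim c w) a = moment y c a + moment z w a := by
  simp [moment, Fintype.sum_sum_type]

theorem moment_const_mul (y : ι → EuclideanSpace ℝ (Fin d)) (β : ℝ) (c : ι → ℝ) (a : Fin d → ℕ) :
    moment y (fun i => β * c i) a = β * moment y c a := by
  simp [moment, Finset.mul_sum, mul_assoc]

/-- Superposing `β` times a second configuration makes nonnegativity a quadratic inequality in `β`,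
from which the cross term can be read off. -/
theorem form_sumElim (y : ι → EuclideanSpace ℝ (Fin d)) (z : κ → EuclideanSpace ℝ (Fin d))
    (c : ι → ℝ) (w : κ → ℝ) (β : ℝ) (s : ℕ) :
    ∑ i, ∑ j, Sum.elim c (fun o => β * w o) i * Sum.elim c (fun o => β * w o) j *
        ‖Sum.elim y z i - Sum.elim y z j‖ ^ s =
      ∑ i, ∑ j, c i * c j * ‖y i - y j‖ ^ s + 2 * β * ∑ i, ∑ o, c i * w o * ‖y i - z o‖ ^ s +
        β ^ 2 * ∑ o, ∑ o', w o * w o' * ‖z o - z o'‖ ^ s := by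
  simp only [Fintype.sum_sum_type, Sum.elim_inl, Sum.elim_inr, Finset.sum_add_distrib]
  have h1 : ∑ i, ∑ o, c i * (β * w o) * ‖y i - z o‖ ^ s =
      β * ∑ i, ∑ o, c i * w o * ‖y i - z o‖ ^ s := by
    simp only [Finset.mul_sum]
    exact Finset.sum_congr rfl fun i _ => Finset.sum_congr rfl fun j _ => by ring
  have h2 : ∑ o, ∑ i, β * w o * c i * ‖z o - y i‖ ^ s =
      β * ∑ i, ∑ o, c i * w o * ‖y i - z o‖ ^ s := by
    rw [Finset.sum_comm, ← h1]
    exact Finset.sum_congr rfl fun i _ => Finset.sum_congr rfl fun j _ => by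
      rw [norm_sub_rev]; ring
  have h3 : ∑ o, ∑ o', β * w o * (β * w o') * ‖z o - z o'‖ ^ s =
      β ^ 2 * ∑ o, ∑ o', w o * w o' * ‖z o - z o'‖ ^ s := by
    simp only [Finset.mul_sum]
    exact Finset.sum_congr rfl fun i _ => Finset.sum_congr rfl fun j _ => by ring
  rw [h1, h2, h3]
  ring

theorem eq_zero_of_forall_nonneg {X Y : ℝ} (h : ∀ β : ℝ, 0 ≤ 2 * β * X + β ^ 2 * Y) : X = 0 := by
  have := discrim_le_zero (a := Y) (b := 2 * X) (c := 0) fun β => by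
    have := h β; nlinarith
  unfold discrim at this
  nlinarith

/-- The polynomial part of the expansion vanishes on weights with vanishing low moments. -/
theorem form_kernelPoly_eq_zero (f : ℝ → ℝ) {r : ℕ} (y : ι → EuclideanSpace ℝ (Fin d))
    (c : ι → ℝ) (hc : ∀ a : Fin d → ℕ, ∑ i, a i < r → moment y c a = 0) (ε : ℝ) :
    ∑ i, ∑ j, c i * c j * kernelPoly d f (2 * r - 1) ε (y i) (y j) = 0 := by
  rw [sum_kernelPoly]
  refine Finset.sum_eq_zero fun a _ => Finset.sum_eq_zero fun b _ => ?_
  by_cases ha : ∑ i, a.toFun i < r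
  · simp [hc _ ha]
  by_cases hb : ∑ i, b.toFun i < r
  · simp [hc _ hb]
  · rw [wronskianTrunc, if_neg (by omega)]; ring

theorem odd_form_nonneg_of_moments {f : ℝ → ℝ} (hf : AnalyticAt ℝ f 0)
    (hκ : IsPositiveKernel (stationaryKernel d f)) {r : ℕ} (hr : 1 ≤ r)
    (ho : OddCoeffsVanish f r) (y : ι → EuclideanSpace ℝ (Fin d)) (c : ι → ℝ)
    (hc : ∀ a : Fin d → ℕ, ∑ i, a i < r → moment y c a = 0) :
    0 ≤ taylorCoeffAtZero f (2 * r - 1) * ∑ i, ∑ j, c i * c j * ‖y i - y j‖ ^ (2 * r - 1) :=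
  odd_form_nonneg hf hκ hr ho y (tendsto_const_nhds (x := c)) fun ε _ =>
    form_kernelPoly_eq_zero f y c hc ε

/-- Cauchy–Schwarz for a semidefinite form: a null vector is orthogonal to every vector of the space
on which the form is nonnegative. -/
theorem sum_mul_norm_eq_zero {f : ℝ → ℝ} (hf : AnalyticAt ℝ f 0)
    (hκ : IsPositiveKernel (stationaryKernel d f)) {r : ℕ} (hr : 1 ≤ r)
    (ho : OddCoeffsVanish f r) (hfr : taylorCoeffAtZero f (2 * r - 1) ≠ 0)
    (y : ι → EuclideanSpace ℝ (Fin d)) (c : ι → ℝ)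
    (hc : ∀ a : Fin d → ℕ, ∑ i, a i < r → moment y c a = 0)
    (h0 : ∑ i, ∑ j, c i * c j * ‖y i - y j‖ ^ (2 * r - 1) = 0)
    (z : κ → EuclideanSpace ℝ (Fin d)) (w : κ → ℝ)
    (hw : ∀ a : Fin d → ℕ, ∑ i, a i < r → moment z w a = 0) :
    ∑ i, ∑ o, c i * w o * ‖y i - z o‖ ^ (2 * r - 1) = 0 := by
  have key := eq_zero_of_forall_nonneg
    (X := taylorCoeffAtZero f (2 * r - 1) * ∑ i, ∑ o, c i * w o * ‖y i - z o‖ ^ (2 * r - 1))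
    (Y := taylorCoeffAtZero f (2 * r - 1) *
      ∑ o, ∑ o', w o * w o' * ‖z o - z o'‖ ^ (2 * r - 1)) fun β => by
    have := odd_form_nonneg_of_moments hf hκ hr ho (Sum.elim y z)
      (Sum.elim c fun o => β * w o) fun a ha => by
        rw [moment_sumElim, moment_const_mul, hc a ha, hw a ha]; ring
    rw [form_sumElim, h0] at this
    linarith
  exact (mul_eq_zero.mp key).resolve_left hfr

theorem analyticAt_norm_sub_smul_pow {v : EuclideanSpace ℝ (Fin d)} (hv : v ≠ 0)
    (u : EuclideanSpace ℝ (Fin d)) (s : ℕ) : AnalyticAt ℝ (fun τ : ℝ => ‖v - τ • u‖ ^ s) 0 := by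
  have h1 : ContDiffAt ℝ ⊤ (fun τ : ℝ => v - τ • u) 0 := by fun_prop
  exact (ContDiffAt.analyticAt (h1.norm ℝ (by simpa using hv))).pow s

/-- The Taylor terms of `φ` of degree below `K` are annihilated. -/
theorem isBigO_extrap {K : ℕ} {φ : ℝ → ℝ} (hφ : AnalyticAt ℝ φ 0) :
    (fun t => ∑ o, extrapWeight K o * φ (t * extrapNode K o)) =O[𝓝[>] 0] fun t => t ^ K := by
  obtain ⟨h, hh, H⟩ := exists_taylor_remainder hφ K
  have h1 : ∀ t, ∑ o, extrapWeight K o * φ (t * extrapNode K o) =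
      ∑ o, t ^ K * (extrapWeight K o * extrapNode K o ^ K * h (t * extrapNode K o)) := by
    intro t
    simp only [H, mul_add, Finset.sum_add_distrib, Finset.mul_sum]
    rw [Finset.sum_comm, Finset.sum_eq_zero, zero_add]
    · exact Finset.sum_congr rfl fun o _ => by rw [mul_pow]; ring
    · intro k hk
      rw [← mul_zero (taylorCoeffAtZero φ k * t ^ k),
        ← sum_extrapWeight_mul_pow (Finset.mem_range.mp hk), Finset.mul_sum]
      exact Finset.sum_congr rfl fun o _ => by rw [mul_pow]; ring
  simp only [h1]
  refine Asymptotics.IsBigO.fun_sum fun o _ => ?_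
  have htend : Tendsto (fun t : ℝ => t * extrapNode K o) (𝓝[>] 0) (𝓝 0) := by
    have : Continuous fun t : ℝ => t * extrapNode K o := by fun_prop
    simpa using (this.tendsto 0).mono_left nhdsWithin_le_nhds
  have h2 : (fun t : ℝ => extrapWeight K o * extrapNode K o ^ K * h (t * extrapNode K o))
      =O[𝓝[>] 0] fun _ => (1 : ℝ) :=
    ((hh.continuousAt.tendsto.comp htend).isBigO_one ℝ).const_mul_left _
  simpa using (Asymptotics.isBigO_refl (fun t : ℝ => t ^ K) (𝓝[>] 0)).mul h2

/-- Strict conditional positive definiteness of `‖x - y‖^{2r-1}`. -/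
theorem eq_zero_of_odd_form_eq_zero (hd : 0 < d) {f : ℝ → ℝ} (hf : AnalyticAt ℝ f 0)
    (hκ : IsPositiveKernel (stationaryKernel d f)) {r : ℕ} (hr : 1 ≤ r)
    (ho : OddCoeffsVanish f r) (hfr : taylorCoeffAtZero f (2 * r - 1) ≠ 0)
    (y : ι → EuclideanSpace ℝ (Fin d)) (hy : Function.Injective y) (c : ι → ℝ)
    (hc : ∀ a : Fin d → ℕ, ∑ i, a i < r → moment y c a = 0)
    (h0 : ∑ i, ∑ j, c i * c j * ‖y i - y j‖ ^ (2 * r - 1) = 0) : c = 0 := by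
  classical
  funext i₀
  set u : EuclideanSpace ℝ (Fin d) := EuclideanSpace.single ⟨0, hd⟩ 1 with hu
  have hu1 : ‖u‖ = 1 := by simp [hu]
  -- The test configuration is the extrapolation functional on a line through `y i₀`, shrunk by `t`.
  -- It kills degrees below `2r`, more than the `r` required for orthogonality.
  have hX : ∀ t : ℝ, ∑ i, c i * ∑ o, extrapWeight (2 * r) o *
      ‖(y i - y i₀) - (t * extrapNode (2 * r) o) • u‖ ^ (2 * r - 1) = 0 := by
    intro t
    have := sum_mul_norm_eq_zero hf hκ hr ho hfr y c hc h0
      (fun o => y i₀ + extrapNode (2 * r) o • (t • u)) (extrapWeight (2 * r))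
      fun a ha => moment_line_eq_zero _ _ a (by omega)
    rw [← this]
    simp only [Finset.mul_sum]
    refine Finset.sum_congr rfl fun i _ => Finset.sum_congr rfl fun o _ => ?_
    rw [← mul_assoc, sub_add_eq_sub_sub, smul_smul, mul_comm t]
  -- At its centre, the functional sees `|t|^(2r-1)`, which differs from the odd power `t^(2r-1)`
  -- only at the node `-1`: hence the factor `1 - (-1) = 2`.
  have hself : ∀ t : ℝ, 0 < t → ∑ o, extrapWeight (2 * r) o *
      ‖(y i₀ - y i₀) - (t * extrapNode (2 * r) o) • u‖ ^ (2 * r - 1) = 2 * t ^ (2 * r - 1) := by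
    intro t ht
    have h1 := sum_extrapWeight_mul (K := 2 * r) (k := 2 * r - 1) (by omega)
      (fun t => |t| ^ (2 * r - 1)) fun t ht => by rw [abs_of_pos ht]
    have hodd : (-1 : ℝ) ^ (2 * r - 1) = -1 :=
      Odd.neg_one_pow (by rw [Nat.odd_iff]; omega)
    simp only [abs_neg, abs_one, one_pow, hodd] at h1
    rw [mul_comm (2 : ℝ), show (2 : ℝ) = 1 - -1 by norm_num, ← h1, Finset.mul_sum]
    refine Finset.sum_congr rfl fun o _ => ?_
    rw [sub_self, zero_sub, norm_neg, norm_smul, hu1, Real.norm_eq_abs, abs_mul, abs_of_pos ht]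
    ring
  -- Seen from every other point the distance power is analytic, so its contribution is one order
  -- smaller than the kink at `y i₀`.
  have hbig : (fun t : ℝ => c i₀ * (2 * t ^ (2 * r - 1))) =O[𝓝[>] 0] fun t => t ^ (2 * r) := by
    have h1 : (fun t : ℝ => -∑ i ∈ Finset.univ.erase i₀, c i * ∑ o, extrapWeight (2 * r) o *
        ‖(y i - y i₀) - (t * extrapNode (2 * r) o) • u‖ ^ (2 * r - 1))
        =O[𝓝[>] 0] fun t => t ^ (2 * r) := by
      refine (Asymptotics.IsBigO.fun_sum fun i hi => ?_).neg_left
      have hne : y i - y i₀ ≠ 0 := sub_ne_zero.mpr (hy.ne (Finset.ne_of_mem_erase hi))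
      exact (isBigO_extrap (analyticAt_norm_sub_smul_pow hne u (2 * r - 1))).const_mul_left _
    refine h1.congr' ?_ EventuallyEq.rfl
    filter_upwards [self_mem_nhdsWithin] with t ht
    have := hX t
    rw [← Finset.add_sum_erase _ _ (Finset.mem_univ i₀), hself t ht] at this
    linarith
  have hlim : Tendsto (fun t : ℝ => c i₀ * (2 * t ^ (2 * r - 1)) / t ^ (2 * r - 1))
      (𝓝[>] 0) (𝓝 0) := by
    refine (hbig.trans_isLittleO ?_).tendsto_div_nhds_zero
    exact (Asymptotics.isLittleO_pow_pow (by omega)).mono nhdsWithin_le_nhds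
  have hconst : Tendsto (fun t : ℝ => c i₀ * (2 * t ^ (2 * r - 1)) / t ^ (2 * r - 1))
      (𝓝[>] 0) (𝓝 (c i₀ * 2)) := by
    refine tendsto_const_nhds.congr' ?_
    filter_upwards [self_mem_nhdsWithin] with t ht
    have : t ≠ 0 := ne_of_gt ht
    field_simp
  have := tendsto_nhds_unique hlim hconst
  simp only [Pi.zero_apply]
  linarith

end StrictPositivity

/-! ### The polar limit of a shrinking configuration, and its positivity. -/

section WronskianPositivity
variable {d : ℕ}

theorem analyticAt_one_add_rpow (p : ℝ) : AnalyticAt ℝ (fun ξ : ℝ => (1 + ξ) ^ p) 0 := by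
  apply ContDiffAt.analyticAt
  have h1 : ContDiffAt ℝ ⊤ (fun ξ : ℝ => 1 + ξ) 0 := by fun_prop
  exact h1.rpow_const_of_ne (by norm_num)

/-- All factors of `p (p - 1) ⋯ (p - j + 1)` are positive. -/
theorem taylorCoeff_one_add_rpow_pos {p : ℝ} {j : ℕ} (h : (j : ℝ) - 1 < p) :
    0 < taylorCoeffAtZero (fun ξ : ℝ => (1 + ξ) ^ p) j := by
  have h1 : iteratedDeriv j (fun ξ : ℝ => (1 + ξ) ^ p) 0 = (descPochhammer ℝ j).eval p := by
    have := congrFun (iteratedDeriv_comp_const_add j (fun x : ℝ => x ^ p) 1) 0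
    rw [this, iteratedDeriv_eq_iterate, Real.iter_deriv_rpow_const]
    simp
  rw [taylorCoeffAtZero, h1]
  exact div_pos (descPochhammer_pos h) (by positivity)

variable {ι : Type*} [Fintype ι]

/-- The moment of `‖y‖^{2k} ⟪y, z⟫^q`. -/
def mixedMoment (y : ι → EuclideanSpace ℝ (Fin d)) (U : ι → ℝ) (z : EuclideanSpace ℝ (Fin d))
    (k q : ℕ) : ℝ :=
  ∑ i, U i * (‖y i‖ ^ (2 * k) * inner ℝ z (y i) ^ q)

theorem mixedMoment_smul (y : ι → EuclideanSpace ℝ (Fin d)) (U : ι → ℝ)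
    (z : EuclideanSpace ℝ (Fin d)) (ρ : ℝ) (k q : ℕ) :
    mixedMoment y U (ρ • z) k q = ρ ^ q * mixedMoment y U z k q := by
  simp only [mixedMoment, inner_smul_left, mul_pow, Finset.mul_sum]
  exact Finset.sum_congr rfl fun i _ => by simp; ring

theorem mixedMoment_eq_zero (y : ι → EuclideanSpace ℝ (Fin d)) (U : ι → ℝ) {K m : ℕ}
    (hU : ∀ a : Fin d → ℕ, ∑ i, a i < K → ∑ i, a i ≠ m → moment y U a = 0)
    (z : EuclideanSpace ℝ (Fin d)) {k q : ℕ} (h1 : 2 * k + q < K) (h2 : 2 * k + q ≠ m) :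
    mixedMoment y U z k q = 0 := by
  set P : MvPolynomial (Fin d) ℝ := (∑ i, MvPolynomial.X i ^ 2) ^ k *
    (∑ i, MvPolynomial.C (z i) * MvPolynomial.X i) ^ q with hP
  have hhom : P.IsHomogeneous (2 * k + q) := by
    have e1 : (∑ i : Fin d, (MvPolynomial.X i : MvPolynomial (Fin d) ℝ) ^ 2).IsHomogeneous 2 :=
      MvPolynomial.IsHomogeneous.sum _ _ _ fun i _ => by
        simpa using (MvPolynomial.isHomogeneous_X ℝ i).pow 2
    have e2 : (∑ i : Fin d, MvPolynomial.C (z i) * MvPolynomial.X i).IsHomogeneous 1 :=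
      MvPolynomial.IsHomogeneous.sum _ _ _ fun i _ => by
        simpa using (MvPolynomial.isHomogeneous_C (Fin d) (z i)).mul
          (MvPolynomial.isHomogeneous_X ℝ i)
    simpa using (e1.pow k).mul (e2.pow q)
  have heval : ∀ i, ‖y i‖ ^ (2 * k) * inner ℝ z (y i) ^ q = MvPolynomial.eval (y i).ofLp P := by
    intro i
    have e1 : (inner ℝ z (y i) : ℝ) = ∑ x, z x * y i x := by
      rw [PiLp.inner_apply]
      exact Finset.sum_congr rfl fun x _ => mul_comm _ _
    rw [hP, pow_mul, EuclideanSpace.real_norm_sq_eq, e1]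
    simp
  simp only [mixedMoment, heval, MvPolynomial.eval_eq', Finset.mul_sum]
  rw [Finset.sum_comm]
  refine Finset.sum_eq_zero fun c hc => ?_
  have hdeg : ∑ i, c i = 2 * k + q := by
    have := hhom (MvPolynomial.mem_support_iff.mp hc)
    rw [← this, Finsupp.weight_apply, Finsupp.sum_fintype] <;> simp
  rw [Finset.sum_congr rfl fun i _ => mul_left_comm _ _ _, ← Finset.mul_sum,
    show (∑ i, U i * ∏ x, (y i).ofLp x ^ c x) = 0 from
      hU (fun i => c i) (by rw [hdeg]; exact h1) (by rw [hdeg]; exact h2), mul_zero]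

/-- `⟪x, y⟫^q` is the inner product of the tensor powers `x^{⊗q}` and `y^{⊗q}`, indexed by words of
length `q`, so the double sum is a squared norm. -/
theorem sum_inner_pow_eq_sum_sq (y : ι → EuclideanSpace ℝ (Fin d)) (U : ι → ℝ) (k q : ℕ) :
    ∑ i, U i * (‖y i‖ ^ (2 * k) * mixedMoment y U (y i) k q) =
      ∑ w : Fin q → Fin d, (∑ i, U i * (‖y i‖ ^ (2 * k) * ∏ t, y i (w t))) ^ 2 := by
  have h1 : ∀ i j, inner ℝ (y i) (y j) ^ q =
      ∑ w : Fin q → Fin d, (∏ t, y i (w t)) * ∏ t, y j (w t) := by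
    intro i j
    rw [PiLp.inner_apply, Fintype.sum_pow]
    refine Finset.sum_congr rfl fun w _ => ?_
    rw [← Finset.prod_mul_distrib]
    exact Finset.prod_congr rfl fun t _ => by simp [mul_comm]
  simp only [mixedMoment, h1, sq, Finset.sum_mul, Finset.mul_sum]
  rw [Finset.sum_congr rfl fun i _ => Finset.sum_comm, Finset.sum_comm]
  refine Finset.sum_congr rfl fun w _ => ?_
  rw [Finset.sum_comm]
  exact Finset.sum_congr rfl fun i _ => Finset.sum_congr rfl fun j _ => by ring

theorem exists_word (a : Fin d → ℕ) : ∃ w : Fin (∑ i, a i) → Fin d,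
    ∀ x : EuclideanSpace ℝ (Fin d), ∏ t, x (w t) = monomialEval a x := by
  refine ⟨fun t => (finSigmaFinEquiv.symm t).1, fun x => ?_⟩
  rw [finSigmaFinEquiv.symm.prod_comp (fun s : (i : Fin d) × Fin (a i) => x s.1),
    Fintype.prod_sigma]
  simp [monomialEval]

/-- The limit of `θ^{-m} ∑ U_i ‖z - θ y_i‖^s` when `U` only sees the degree `m`. -/
def polarLimit (y : ι → EuclideanSpace ℝ (Fin d)) (U : ι → ℝ) (s m : ℕ)
    (z : EuclideanSpace ℝ (Fin d)) : ℝ :=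
  ∑ j ∈ Finset.range (m + 1), ∑ k ∈ Finset.range (j + 1), if j + k = m then
    taylorCoeffAtZero (fun ξ : ℝ => (1 + ξ) ^ ((s : ℝ) / 2)) j * (j.choose k : ℝ) *
      (-2) ^ (j - k) * (‖z‖ ^ (s - 2 * j) * mixedMoment y U z k (j - k)) else 0

/-- Expand `‖θ y - z‖^s` by the binomial series in powers of `θ`. The coefficient of `θ^(j+k)`
involves only moments of degree `j + k`, so the moment condition leaves just `j + k = m`. The bounds
`2m < K` and `2m ≤ s` keep these degrees in range and the exponents of `‖z‖` nonnegative. -/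
theorem tendsto_polarLimit (y : ι → EuclideanSpace ℝ (Fin d)) (U : ι → ℝ) {K m s : ℕ}
    (hU : ∀ a : Fin d → ℕ, ∑ i, a i < K → ∑ i, a i ≠ m → moment y U a = 0)
    (hmK : 2 * m < K) (hms : 2 * m ≤ s) {z : EuclideanSpace ℝ (Fin d)} (hz : z ≠ 0) :
    Tendsto (fun θ : ℝ => (∑ i, U i * ‖θ • y i - z‖ ^ s) / θ ^ m) (𝓝[>] 0)
      (𝓝 (polarLimit y U s m z)) := by
  obtain ⟨h, hh, H⟩ := exists_taylor_remainder (analyticAt_one_add_rpow ((s : ℝ) / 2)) (m + 1)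
  have hN : 0 < ‖z‖ := norm_pos_iff.mpr hz
  -- Defined by `‖θ y_i - z‖² = ‖z‖² (1 + θ ζ_i)`.
  let ζ : ι → ℝ → ℝ := fun i θ => (θ * ‖y i‖ ^ 2 - 2 * inner ℝ z (y i)) / ‖z‖ ^ 2
  have hnorm : ∀ i θ, ‖θ • y i - z‖ ^ s = ‖z‖ ^ s * (1 + θ * ζ i θ) ^ ((s : ℝ) / 2) := by
    intro i θ
    have e1 : ‖θ • y i - z‖ ^ 2 = ‖z‖ ^ 2 * (1 + θ * ζ i θ) := by
      rw [@norm_sub_sq ℝ, norm_smul, real_inner_comm, inner_smul_right]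
      simp only [ζ, Real.norm_eq_abs, mul_pow, sq_abs, RCLike.re_to_real]
      field_simp
      ring
    have e2 : ∀ t : ℝ, 0 ≤ t → t ^ s = (t ^ 2) ^ ((s : ℝ) / 2) := fun t ht => by
      rw [← Real.rpow_natCast t 2, ← Real.rpow_mul ht, ← Real.rpow_natCast]
      congr 1; push_cast; ring
    have e3 : 0 ≤ 1 + θ * ζ i θ := by
      have : 0 ≤ ‖z‖ ^ 2 * (1 + θ * ζ i θ) := e1 ▸ sq_nonneg _
      exact nonneg_of_mul_nonneg_right this (by positivity)
    rw [e2 _ (norm_nonneg _), e1, Real.mul_rpow (by positivity) e3, ← e2 _ hN.le]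
  have hζ : ∀ i, Tendsto (fun θ : ℝ => θ * ζ i θ) (𝓝[>] 0) (𝓝 0) := by
    intro i
    have : Continuous fun θ : ℝ => θ * ζ i θ := by simp only [ζ]; fun_prop
    simpa using (this.tendsto 0).mono_left nhdsWithin_le_nhds
  have hmain : ∀ θ : ℝ, ∑ i, U i * (‖z‖ ^ s * ∑ j ∈ Finset.range (m + 1),
      taylorCoeffAtZero (fun ξ : ℝ => (1 + ξ) ^ ((s : ℝ) / 2)) j * (θ * ζ i θ) ^ j) =
      θ ^ m * polarLimit y U s m z := by
    intro θ
    have e1 : ∀ i, ∀ j ∈ Finset.range (m + 1), ‖z‖ ^ s * (θ * ζ i θ) ^ j =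
        ∑ k ∈ Finset.range (j + 1), (j.choose k : ℝ) * (-2) ^ (j - k) * θ ^ (j + k) *
          ‖z‖ ^ (s - 2 * j) * (‖y i‖ ^ (2 * k) * inner ℝ z (y i) ^ (j - k)) := by
      intro i j hj
      have hj' : 2 * j ≤ s := by have := Finset.mem_range.mp hj; omega
      have e2 : ‖z‖ ^ s = ‖z‖ ^ (s - 2 * j) * (‖z‖ ^ 2) ^ j := by
        rw [← pow_mul, ← pow_add, Nat.sub_add_cancel hj']
      rw [e2, mul_pow]
      simp only [ζ]
      rw [div_pow, sub_eq_add_neg, add_pow]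
      have e3 : ‖z‖ ^ (s - 2 * j) * (‖z‖ ^ 2) ^ j * (θ ^ j * ((∑ k ∈ Finset.range (j + 1),
          (θ * ‖y i‖ ^ 2) ^ k * (-(2 * inner ℝ z (y i))) ^ (j - k) * (j.choose k : ℝ)) /
            (‖z‖ ^ 2) ^ j)) = ‖z‖ ^ (s - 2 * j) * θ ^ j * ∑ k ∈ Finset.range (j + 1),
          (θ * ‖y i‖ ^ 2) ^ k * (-(2 * inner ℝ z (y i))) ^ (j - k) * (j.choose k : ℝ) := by
        have : (‖z‖ ^ 2) ^ j ≠ 0 := by positivity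
        field_simp
      rw [e3, Finset.mul_sum]
      refine Finset.sum_congr rfl fun k _ => ?_
      rw [mul_pow, ← neg_mul, mul_pow, ← pow_mul, pow_add]
      ring
    have e4 : ∑ i, U i * (‖z‖ ^ s * ∑ j ∈ Finset.range (m + 1),
        taylorCoeffAtZero (fun ξ : ℝ => (1 + ξ) ^ ((s : ℝ) / 2)) j * (θ * ζ i θ) ^ j) =
        ∑ j ∈ Finset.range (m + 1), ∑ k ∈ Finset.range (j + 1),
          taylorCoeffAtZero (fun ξ : ℝ => (1 + ξ) ^ ((s : ℝ) / 2)) j *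
          ((j.choose k : ℝ) * (-2) ^ (j - k) * θ ^ (j + k) *
          ‖z‖ ^ (s - 2 * j)) * mixedMoment y U z k (j - k) := by
      simp only [mixedMoment, Finset.mul_sum]
      rw [Finset.sum_comm]
      refine Finset.sum_congr rfl fun j hj => ?_
      rw [Finset.sum_comm]
      refine Finset.sum_congr rfl fun i _ => ?_
      rw [mul_left_comm (‖z‖ ^ s), e1 i j hj, Finset.mul_sum, Finset.mul_sum]
      exact Finset.sum_congr rfl fun k _ => by ring
    rw [e4, polarLimit, Finset.mul_sum]
    refine Finset.sum_congr rfl fun j hj => ?_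
    rw [Finset.mul_sum]
    refine Finset.sum_congr rfl fun k hk => ?_
    have hj' := Finset.mem_range.mp hj
    have hk' := Finset.mem_range.mp hk
    split_ifs with hjk
    · rw [hjk]; ring
    · rw [mixedMoment_eq_zero y U hU z (by omega) (by omega)]; ring
  have hlim : Tendsto (fun θ : ℝ => polarLimit y U s m z + ∑ i, θ * (U i * (‖z‖ ^ s *
      (ζ i θ ^ (m + 1) * h (θ * ζ i θ))))) (𝓝[>] 0)
      (𝓝 (polarLimit y U s m z + ∑ i : ι, 0 * (U i * (‖z‖ ^ s * (ζ i 0 ^ (m + 1) * h 0))))) := by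
    refine tendsto_const_nhds.add (tendsto_finsetSum _ fun i _ => ?_)
    have e0 : Tendsto (fun θ : ℝ => θ) (𝓝[>] 0) (𝓝 0) := nhdsWithin_le_nhds
    have e1 : Tendsto (ζ i) (𝓝[>] 0) (𝓝 (ζ i 0)) := by
      have : Continuous (ζ i) := by simp only [ζ]; fun_prop
      exact (this.tendsto 0).mono_left nhdsWithin_le_nhds
    exact e0.mul ((((e1.pow _).mul (hh.continuousAt.tendsto.comp (hζ i))).const_mul _).const_mul _)
  simp only [zero_mul, Finset.sum_const_zero, add_zero] at hlim
  refine hlim.congr' ?_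
  filter_upwards [self_mem_nhdsWithin] with θ hθ
  have hθ0 : θ ≠ 0 := ne_of_gt hθ
  have hsplit : ∀ i, U i * ‖θ • y i - z‖ ^ s = U i * (‖z‖ ^ s * ∑ j ∈ Finset.range (m + 1),
      taylorCoeffAtZero (fun ξ : ℝ => (1 + ξ) ^ ((s : ℝ) / 2)) j * (θ * ζ i θ) ^ j) +
      U i * (‖z‖ ^ s * ((θ * ζ i θ) ^ (m + 1) * h (θ * ζ i θ))) := fun i => by
    rw [hnorm, ← mul_add, ← mul_add]
    exact congrArg (fun t => U i * (‖z‖ ^ s * t)) (H (θ * ζ i θ))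
  simp only [hsplit, Finset.sum_add_distrib]
  rw [hmain, add_div, mul_div_cancel_left₀ _ (pow_ne_zero _ hθ0), Finset.sum_div]
  congr 1
  refine Finset.sum_congr rfl fun i _ => ?_
  rw [mul_pow, pow_succ θ m]
  field_simp

/-- On a line through `0`, each term is `|τ|^(s-2j) τ^(j-k)`, equal to `τ^(s-m)` for `τ > 0`. At
`-1` the two differ in sign because `s` is odd, which leaves twice the value. -/
theorem sum_extrap_polarLimit (y : ι → EuclideanSpace ℝ (Fin d)) (U : ι → ℝ) {K m s : ℕ}
    (hs : Odd s) (hms : 2 * m ≤ s) (hsK : s < K) (z : EuclideanSpace ℝ (Fin d)) :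
    ∑ o, extrapWeight K o * polarLimit y U s m (extrapNode K o • z) =
      2 * (-1) ^ m * polarLimit y U s m z := by
  simp only [polarLimit, Finset.mul_sum]
  rw [Finset.sum_comm]
  refine Finset.sum_congr rfl fun j hj => ?_
  rw [Finset.sum_comm]
  refine Finset.sum_congr rfl fun k hk => ?_
  have hj' := Finset.mem_range.mp hj
  have hk' := Finset.mem_range.mp hk
  split_ifs with hjk
  · have h1 := sum_extrapWeight_mul (K := K) (k := s - m) (by omega)
      (fun t => |t| ^ (s - 2 * j) * t ^ (j - k)) fun t ht => by
        rw [abs_of_pos ht, ← pow_add]; congr 1; omega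
    have h2 : (-1 : ℝ) ^ (s - m) = -(-1) ^ m := by
      have h3 : (-1 : ℝ) ^ s = -1 := hs.neg_one_pow
      have h4 : (-1 : ℝ) ^ (s - m) * (-1) ^ m = -1 := by
        rw [← pow_add, Nat.sub_add_cancel (by omega), h3]
      rcases neg_one_pow_eq_or ℝ m with h | h <;> rw [h] at h4 ⊢ <;> linarith
    have h5 : (-1 : ℝ) ^ (j - k) = (-1) ^ m := by
      rw [show m = (j - k) + 2 * k by omega, pow_add, pow_mul]; simp
    simp only [abs_neg, abs_one, one_pow, h2, h5] at h1
    rw [show (2 : ℝ) * (-1) ^ m = 1 * (-1) ^ m - -(-1) ^ m by ring, ← h1, Finset.sum_mul]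
    refine Finset.sum_congr rfl fun o _ => ?_
    rw [mixedMoment_smul, norm_smul, Real.norm_eq_abs, mul_pow]
    ring
  · simp

/-- Evaluating the polar form at the points themselves, dividing by `(-1)^m ‖y_i‖^(s-2m)` and
summing against `U` gives a combination of sums of squares. Its coefficients are nonnegative, since
the binomial coefficients of `s/2` are positive up to index `m`. -/
theorem moment_eq_zero_of_polarLimit_eq_zero (y : ι → EuclideanSpace ℝ (Fin d))
    (hy : ∀ i, y i ≠ 0) (U : ι → ℝ) {m s : ℕ} (hms : 2 * m ≤ s)
    (h : ∀ z, z ≠ 0 → polarLimit y U s m z = 0) (a : Fin d → ℕ) (ha : ∑ i, a i = m) :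
    moment y U a = 0 := by
  set b := taylorCoeffAtZero (fun ξ : ℝ => (1 + ξ) ^ ((s : ℝ) / 2)) with hb
  have hbpos : ∀ j, j ≤ m → 0 < b j := fun j hj => taylorCoeff_one_add_rpow_pos (by
    have : (2 * (j : ℝ)) ≤ s := by exact_mod_cast (by omega : 2 * j ≤ s)
    linarith)
  set S : ℕ → ℕ → ℝ := fun k q => ∑ w : Fin q → Fin d,
    (∑ i, U i * (‖y i‖ ^ (2 * k) * ∏ t, y i (w t))) ^ 2 with hS
  have hS0 : ∀ k q, 0 ≤ S k q := fun k q => Finset.sum_nonneg fun w _ => sq_nonneg _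
  have key : ∑ j ∈ Finset.range (m + 1), ∑ k ∈ Finset.range (j + 1), (if j + k = m then
      b j * (j.choose k : ℝ) * 2 ^ (j - k) * S k (j - k) else 0) = 0 := by
    have h1 : ∀ i, ∑ j ∈ Finset.range (m + 1), ∑ k ∈ Finset.range (j + 1), (if j + k = m then
        b j * (j.choose k : ℝ) * 2 ^ (j - k) *
          (‖y i‖ ^ (2 * k) * mixedMoment y U (y i) k (j - k)) else 0) = 0 := by
      intro i
      have h2 := h (y i) (hy i)
      have hN : ‖y i‖ ≠ 0 := norm_ne_zero_iff.mpr (hy i)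
      have h3 : polarLimit y U s m (y i) = ((-1) ^ m * ‖y i‖ ^ (s - 2 * m)) *
          ∑ j ∈ Finset.range (m + 1), ∑ k ∈ Finset.range (j + 1), (if j + k = m then
          b j * (j.choose k : ℝ) * 2 ^ (j - k) *
            (‖y i‖ ^ (2 * k) * mixedMoment y U (y i) k (j - k)) else 0) := by
        simp only [polarLimit, Finset.mul_sum]
        refine Finset.sum_congr rfl fun j _ => Finset.sum_congr rfl fun k hk => ?_
        have hk' := Finset.mem_range.mp hk
        split_ifs with hjk
        · have e1 : (-2 : ℝ) ^ (j - k) = (-1) ^ m * 2 ^ (j - k) := by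
            rw [show m = (j - k) + 2 * k by omega, pow_add, pow_mul, neg_one_sq, one_pow, mul_one,
              ← mul_pow]
            norm_num
          have e2 : ‖y i‖ ^ (s - 2 * j) = ‖y i‖ ^ (s - 2 * m) * ‖y i‖ ^ (2 * k) := by
            rw [← pow_add]; congr 1; omega
          rw [e1, e2]
          ring
        · simp
      rw [h3] at h2
      -- The division uses that no point is the origin, which is why the grid starts at `1`.
      exact (mul_eq_zero.mp h2).resolve_left (by positivity)
    refine Eq.trans ?_ (Finset.sum_eq_zero (s := Finset.univ) fun i _ =>
      (congrArg (U i * ·) (h1 i)).trans (mul_zero (U i)))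
    simp only [Finset.mul_sum]
    rw [Finset.sum_comm]
    refine Finset.sum_congr rfl fun j _ => ?_
    rw [Finset.sum_comm]
    refine Finset.sum_congr rfl fun k _ => ?_
    split_ifs with hjk
    · simp only [hS]
      rw [← sum_inner_pow_eq_sum_sq, Finset.mul_sum]
      exact Finset.sum_congr rfl fun i _ => by ring
    · simp
  have hnn : ∀ j ∈ Finset.range (m + 1), ∀ k ∈ Finset.range (j + 1), 0 ≤ (if j + k = m then
      b j * (j.choose k : ℝ) * 2 ^ (j - k) * S k (j - k) else 0) := by
    intro j hj k _
    have := hbpos j (Nat.lt_succ_iff.mp (Finset.mem_range.mp hj))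
    have := hS0 k (j - k)
    split_ifs <;> positivity
  -- The term `j = m`, `k = 0` is the one carrying the squares of all moments of degree `m`.
  have h1 := (Finset.sum_eq_zero_iff_of_nonneg fun j hj =>
    Finset.sum_nonneg (hnn j hj)).mp key m (by simp)
  have h2 := (Finset.sum_eq_zero_iff_of_nonneg (hnn m (by simp))).mp h1 0 (by simp)
  simp only [add_zero, if_true, Nat.choose_zero_right, Nat.cast_one, mul_one, Nat.sub_zero] at h2
  have hSm : S 0 m = 0 := (mul_eq_zero.mp h2).resolve_left
    (mul_ne_zero (hbpos m le_rfl).ne' (by positivity))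
  subst ha
  obtain ⟨w, hw⟩ := exists_word a
  have h3 := (Finset.sum_eq_zero_iff_of_nonneg fun w _ => sq_nonneg _).mp hSm w (Finset.mem_univ _)
  simpa [moment, hw] using h3

end WronskianPositivity

/-! ### Definiteness of the Wronskian matrix for finite smoothness order. -/

section WronskianDefinite
variable {d : ℕ}

/-- The factors `ε^(m-|a|)` in the moments compensate `ε^|a|` in the expansion, making all surviving
terms of the same order. -/
theorem sum_kernelPoly_eq_of_moments (f : ℝ → ℝ) {ι : Type*} [Fintype ι] {r m : ℕ} (hm : m < r)
    (w : (Fin d → ℕ) → ℝ) (hw : ∀ a, m < ∑ i, a i → w a = 0)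
    (y : ι → EuclideanSpace ℝ (Fin d)) (c : ι → ℝ) (ε : ℝ)
    (hc : ∀ a : Fin d → ℕ, ∑ i, a i < 2 * r - 1 → moment y c a = ε ^ (m - ∑ i, a i) * w a) :
    ∑ i, ∑ j, c i * c j * kernelPoly d f (2 * r - 1) ε (y i) (y j) =
      ε ^ (2 * m) * ∑ a : MonLT d r, ∑ b : MonLT d r,
        w a.toFun * w b.toFun * wronskianEntry (stationaryKernel d f) a.toFun b.toFun := by
  rw [sum_kernelPoly, Finset.mul_sum]
  have h1 : ∀ a b : MonLT d (2 * r - 1), ε ^ (∑ i, a.toFun i + ∑ i, b.toFun i) *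
      (wronskianTrunc d f (2 * r - 1) a b * moment y c a.toFun * moment y c b.toFun) =
      ε ^ (2 * m) * (w a.toFun * w b.toFun *
        wronskianEntry (stationaryKernel d f) a.toFun b.toFun) := by
    intro a b
    rw [hc _ a.sum_lt, hc _ b.sum_lt]
    by_cases ha : m < ∑ i, a.toFun i
    · simp [hw _ ha]
    by_cases hb : m < ∑ i, b.toFun i
    · simp [hw _ hb]
    have : ε ^ (2 * m) = ε ^ (∑ i, a.toFun i + ∑ i, b.toFun i) *
        (ε ^ (m - ∑ i, a.toFun i) * ε ^ (m - ∑ i, b.toFun i)) := by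
      rw [← pow_add, ← pow_add]; congr 1; omega
    rw [this, wronskianTrunc, if_pos (by omega)]
    ring
  simp only [h1]
  rw [sum_monLT_eq (l := r) (by omega) (fun a => ∑ b : MonLT d (2 * r - 1), ε ^ (2 * m) *
    (w a * w b.toFun * wronskianEntry (stationaryKernel d f) a b.toFun))
    fun a ha => by simp [hw a (by omega)]]
  refine Finset.sum_congr rfl fun a _ => ?_
  rw [sum_monLT_eq (l := r) (by omega) (fun b => ε ^ (2 * m) *
    (w a.toFun * w b * wronskianEntry (stationaryKernel d f) a.toFun b))
    fun b hb => by simp [hw b (by omega)], Finset.mul_sum]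

theorem moment_smul_points {ι : Type*} [Fintype ι] (y : ι → EuclideanSpace ℝ (Fin d)) (c : ι → ℝ)
    (θ : ℝ) (a : Fin d → ℕ) :
    moment (fun i => θ • y i) c a = θ ^ (∑ i, a i) * moment y c a := by
  simp only [moment, monomialEval_smul, Finset.mul_sum]
  exact Finset.sum_congr rfl fun i _ => by ring

/-- A null vector of the Wronskian form has no component of top degree. -/
theorem wronskian_null_top (hd : 0 < d) {f : ℝ → ℝ} (hf : AnalyticAt ℝ f 0)
    (hκ : IsPositiveKernel (stationaryKernel d f)) {r : ℕ}
    (ho : OddCoeffsVanish f r) (hfr : taylorCoeffAtZero f (2 * r - 1) ≠ 0)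
    {m : ℕ} (hm : m < r) (w : (Fin d → ℕ) → ℝ) (hw : ∀ a, m < ∑ i, a i → w a = 0)
    (h0 : ∑ a : MonLT d r, ∑ b : MonLT d r,
      w a.toFun * w b.toFun * wronskianEntry (stationaryKernel d f) a.toFun b.toFun = 0) :
    ∀ a, ∑ i, a i = m → w a = 0 := by
  obtain ⟨U, hU⟩ := exists_dual_weights d (2 * r)
  set y := gridPoint d (2 * r) with hy
  set s := 2 * r - 1 with hs
  have hmomU : ∀ (g : MonLT d (2 * r) → ℝ) (b : MonLT d (2 * r)),
      moment y (fun i => ∑ a, g a * U a i) b.toFun = g b := by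
    intro g b
    rw [moment_sum_smul]
    simp [hU]
  -- Weights reproducing only the degree `m` part of `w`, with all other moments below degree `2r`
  -- equal to zero.
  set U₀ : (Fin d → Fin (2 * r)) → ℝ := fun i =>
    ∑ a : MonLT d (2 * r), (if ∑ i, a.toFun i = m then w a.toFun else 0) * U a i with hU₀
  have hmom : ∀ b : Fin d → ℕ, ∑ i, b i < 2 * r →
      moment y U₀ b = if ∑ i, b i = m then w b else 0 := by
    intro b hb
    obtain ⟨b', rfl⟩ := MonLT.exists_toFun_eq b hb
    exact hmomU _ b'
  have hmomne : ∀ b : Fin d → ℕ, ∑ i, b i < 2 * r → ∑ i, b i ≠ m → moment y U₀ b = 0 :=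
    fun b hb hne => by rw [hmom b hb, if_neg hne]
  set A := ∑ i, ∑ j, U₀ i * U₀ j * ‖y i - y j‖ ^ s with hA
  set fr := taylorCoeffAtZero f s with hfr'
  have hpolar : ∀ z : EuclideanSpace ℝ (Fin d), z ≠ 0 → polarLimit y U₀ s m z = 0 := by
    intro z hz
    set zz : Option (Fin (2 * r)) → EuclideanSpace ℝ (Fin d) := fun o => extrapNode (2 * r) o • z
    have hzz : ∀ a : Fin d → ℕ, ∑ i, a i < 2 * r → moment zz (extrapWeight (2 * r)) a = 0 :=
      fun a ha => by simpa using moment_line_eq_zero 0 z a ha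
    set Y := ∑ o, ∑ o', extrapWeight (2 * r) o * extrapWeight (2 * r) o' * ‖zz o - zz o'‖ ^ s
    let X : ℝ → ℝ := fun θ => ∑ o, extrapWeight (2 * r) o *
      ((∑ i, U₀ i * ‖θ • y i - zz o‖ ^ s) / θ ^ m)
    have hX : Tendsto X (𝓝[>] 0) (𝓝 (2 * (-1) ^ m * polarLimit y U₀ s m z)) := by
      rw [← sum_extrap_polarLimit (K := 2 * r) y U₀
        (by rw [Nat.odd_iff]; omega) (by omega) (by omega) z]
      refine tendsto_finsetSum _ fun o _ => Tendsto.const_mul _ ?_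
      exact tendsto_polarLimit y U₀ hmomne (by omega) (by omega)
        (smul_ne_zero (extrapNode_ne_zero _ o) hz)
    have hineq : ∀ θ : ℝ, 0 < θ → ∀ β : ℝ,
        0 ≤ fr * (θ ^ (s - 2 * m) * A + 2 * β * X θ + β ^ 2 * Y) := by
      intro θ hθ β
      -- On the grid shrunk by `θ`, these weights have moments `ε^(m-|a|) w_a`, so the null form
      -- `h0` cancels the polynomial part for every `ε`. At `ε = 0` only degree `m` remains, giving
      -- `θ^(-m) U₀`.
      let cl : ℝ → (Fin d → Fin (2 * r)) → ℝ := fun ε i => ∑ a : MonLT d (2 * r),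
        ((θ⁻¹) ^ (∑ i, a.toFun i) * (ε ^ (m - ∑ i, a.toFun i) * w a.toFun)) * U a i
      have hcl0 : cl 0 = fun i => (θ⁻¹) ^ m * U₀ i := by
        funext i
        simp only [cl, hU₀, Finset.mul_sum]
        refine Finset.sum_congr rfl fun a _ => ?_
        rcases lt_trichotomy (∑ i, a.toFun i) m with h | h | h
        · rw [zero_pow (by omega), if_neg (by omega)]; ring
        · rw [h, if_pos rfl]; simp; ring
        · rw [hw _ h]; simp
      have hcl : Continuous cl := continuous_pi fun i => by fun_prop
      have htend : Tendsto (fun ε => Sum.elim (cl ε) fun o => β * extrapWeight (2 * r) o) (𝓝[>] 0)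
          (𝓝 (Sum.elim (cl 0) fun o => β * extrapWeight (2 * r) o)) := by
        rw [tendsto_pi_nhds]
        rintro (i | o)
        · exact (((continuous_apply i).comp hcl).tendsto 0).mono_left nhdsWithin_le_nhds
        · exact tendsto_const_nhds
      have hclmom : ∀ ε (b : Fin d → ℕ), ∑ i, b i < 2 * r →
          moment (fun i => θ • y i) (cl ε) b = ε ^ (m - ∑ i, b i) * w b := by
        intro ε b hb
        obtain ⟨b', rfl⟩ := MonLT.exists_toFun_eq b hb
        rw [moment_smul_points, hmomU, ← mul_assoc, ← mul_pow, mul_inv_cancel₀ hθ.ne', one_pow,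
          one_mul]
      have h1 := odd_form_nonneg hf hκ (by omega : 1 ≤ r) ho (Sum.elim (fun i => θ • y i) zz) htend
        fun ε _ => by
          rw [sum_kernelPoly_eq_of_moments f hm w hw _ _ ε, h0, mul_zero]
          intro a ha
          rw [moment_sumElim, moment_const_mul, hzz a (by omega), hclmom ε a (by omega)]
          ring
      rw [form_sumElim, hcl0] at h1
      have e1 : ∑ i, ∑ j, (θ⁻¹) ^ m * U₀ i * ((θ⁻¹) ^ m * U₀ j) *
          ‖θ • y i - θ • y j‖ ^ (2 * r - 1) = θ ^ (s - 2 * m) * A := by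
        have e3 : θ ^ (2 * r - 1) = θ ^ (s - 2 * m) * (θ ^ m * θ ^ m) := by
          rw [← pow_add, ← pow_add]; congr 1; omega
        simp only [hA, Finset.mul_sum]
        refine Finset.sum_congr rfl fun i _ => Finset.sum_congr rfl fun j _ => ?_
        rw [← smul_sub, norm_smul, Real.norm_of_nonneg hθ.le, mul_pow, e3, inv_pow]
        field_simp
        rfl
      have e2 : ∑ i, ∑ o, (θ⁻¹) ^ m * U₀ i * extrapWeight (2 * r) o *
          ‖θ • y i - zz o‖ ^ (2 * r - 1) = X θ := by
        rw [Finset.sum_comm]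
        refine Finset.sum_congr rfl fun o _ => ?_
        simp only [Finset.sum_div, Finset.mul_sum]
        refine Finset.sum_congr rfl fun i _ => ?_
        rw [inv_pow]
        field_simp
        rfl
      rw [e1, e2] at h1
      exact h1
    have hlim : ∀ β : ℝ, 0 ≤ 2 * β * (fr * (2 * (-1) ^ m * polarLimit y U₀ s m z)) +
        β ^ 2 * (fr * Y) := by
      intro β
      -- As `m < r`, the exponent `2r - 1 - 2m` is positive: the self-energy of the shrinking grid
      -- disappears while its interaction with the line survives.
      have e0 : Tendsto (fun θ : ℝ => θ ^ (s - 2 * m) * A) (𝓝[>] 0) (𝓝 0) := by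
        have : Continuous fun θ : ℝ => θ ^ (s - 2 * m) * A := by fun_prop
        have h2 := (this.tendsto 0).mono_left (nhdsWithin_le_nhds (s := Set.Ioi 0))
        rwa [zero_pow (by omega), zero_mul] at h2
      have e1 := ((e0.add (hX.const_mul (2 * β))).add_const (β ^ 2 * Y)).const_mul fr
      have e2 := ge_of_tendsto e1 (by
        filter_upwards [self_mem_nhdsWithin] with θ hθ using hineq θ hθ β)
      linarith
    have h2 := eq_zero_of_forall_nonneg hlim
    have h3 : (2 : ℝ) * (-1) ^ m ≠ 0 := mul_ne_zero two_ne_zero (by simp)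
    exact (mul_eq_zero.mp ((mul_eq_zero.mp h2).resolve_left hfr)).resolve_left h3
  intro a ha
  have h1 := moment_eq_zero_of_polarLimit_eq_zero y (gridPoint_ne_zero hd _) U₀ (by omega)
    hpolar a ha
  rwa [hmom a (by omega), if_pos ha] at h1

theorem wronskianLT_form_eq_zero (hd : 0 < d) {f : ℝ → ℝ} (hf : AnalyticAt ℝ f 0)
    (hκ : IsPositiveKernel (stationaryKernel d f)) {r : ℕ}
    (ho : OddCoeffsVanish f r) (hfr : taylorCoeffAtZero f (2 * r - 1) ≠ 0) {l : ℕ} (hl : l ≤ r)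
    (v : MonLT d l → ℝ)
    (h0 : ∑ a, ∑ b, v a * v b * wronskianEntry (stationaryKernel d f) a.toFun b.toFun = 0) :
    v = 0 := by
  set w : (Fin d → ℕ) → ℝ := Function.extend MonLT.toFun v (0 : (Fin d → ℕ) → ℝ) with hw
  have hwv : ∀ a, w (MonLT.toFun a) = v a := fun a => MonLT.toFun_injective.extend_apply v _ a
  have hw0 : ∀ a, l ≤ ∑ i, a i → w a = 0 := fun a ha =>
    Function.extend_apply' v _ a fun ⟨b, hb⟩ => by
      have := b.sum_lt; rw [hb] at this; omega
  have hsum : ∑ a : MonLT d r, ∑ b : MonLT d r,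
      w a.toFun * w b.toFun * wronskianEntry (stationaryKernel d f) a.toFun b.toFun = 0 := by
    rw [← h0, sum_monLT_eq hl (fun a => ∑ b : MonLT d r,
      w a * w b.toFun * wronskianEntry (stationaryKernel d f) a b.toFun)
      fun a ha => by simp [hw0 a ha]]
    refine Finset.sum_congr rfl fun a _ => ?_
    rw [sum_monLT_eq hl (fun b => w a.toFun * w b *
      wronskianEntry (stationaryKernel d f) a.toFun b) fun b hb => by simp [hw0 b hb]]
    simp only [hwv]
  -- Descending induction on degree: once the top part of `w` vanishes, `wronskian_null_top` applies
  -- to the next degree.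
  have key : ∀ n, n ≤ l → ∀ a, l - n ≤ ∑ i, a i → w a = 0 := by
    intro n
    induction n with
    | zero => intro _ a ha; exact hw0 a (by omega)
    | succ n ih =>
      intro hn a ha
      by_cases h : l - n ≤ ∑ i, a i
      · exact ih (by omega) a h
      · exact wronskian_null_top hd hf hκ ho hfr (m := l - (n + 1)) (by omega) w
          (fun b hb => ih (by omega) b (by omega)) hsum a (by omega)
  funext a
  rw [← hwv a]
  exact key l le_rfl _ (by omega)

end WronskianDefinite

/-! ### Matrices that blow up along a subspace. -/

section LinearAlgebra
open Matrix
variable {ι τ : Type*} [Fintype ι] [Fintype τ]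

/-- The quotient `g c / (c ⬝ᵥ c)` is homogeneous of degree zero, so its minimum over the compact
unit sphere bounds it everywhere. -/
theorem exists_coercive_of_pos {g : (ι → ℝ) → ℝ} (hg : Continuous g)
    (hom : ∀ (t : ℝ) c, g (t • c) = t ^ 2 * g c) (hpos : ∀ c, c ≠ 0 → 0 < g c) :
    ∃ δ > 0, ∀ c, δ * (c ⬝ᵥ c) ≤ g c := by
  have hdot : ∀ c : ι → ℝ, c ≠ 0 → 0 < c ⬝ᵥ c := fun c hc => by
    simpa using dotProduct_star_self_pos_iff.mpr hc
  have h0 : g 0 = 0 := by simpa using hom 0 0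
  rcases (Metric.sphere (0 : ι → ℝ) 1).eq_empty_or_nonempty with he | hne
  · refine ⟨1, one_pos, fun c => ?_⟩
    have hc : c = 0 := by
      by_contra hc
      have : (‖c‖⁻¹ • c) ∈ Metric.sphere (0 : ι → ℝ) 1 := by
        simp [norm_smul, norm_ne_zero_iff.mpr hc]
      rw [he] at this
      exact this
    subst hc; simp [h0]
  have hcont : Continuous fun c : ι → ℝ => c ⬝ᵥ c := by unfold dotProduct; fun_prop
  have hsph : ∀ c ∈ Metric.sphere (0 : ι → ℝ) 1, c ≠ 0 := fun c hc =>
    ne_zero_of_mem_unit_sphere (⟨c, hc⟩ : Metric.sphere (0 : ι → ℝ) 1)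
  obtain ⟨c₀, hc₀, hmin⟩ := (isCompact_sphere (0 : ι → ℝ) 1).exists_isMinOn hne
    (f := fun c => g c / (c ⬝ᵥ c)) (hg.continuousOn.div hcont.continuousOn
      fun c hc => (hdot c (hsph c hc)).ne')
  refine ⟨g c₀ / (c₀ ⬝ᵥ c₀), div_pos (hpos _ (hsph _ hc₀)) (hdot _ (hsph _ hc₀)), fun c => ?_⟩
  by_cases hc : c = 0
  · subst hc; simp [h0]
  have hn : ‖c‖ ≠ 0 := norm_ne_zero_iff.mpr hc
  have hmem : (‖c‖⁻¹ • c) ∈ Metric.sphere (0 : ι → ℝ) 1 := by simp [norm_smul, hn]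
  have h1 : g c₀ / (c₀ ⬝ᵥ c₀) ≤ g (‖c‖⁻¹ • c) / ((‖c‖⁻¹ • c) ⬝ᵥ (‖c‖⁻¹ • c)) := hmin hmem
  rw [hom, smul_dotProduct, dotProduct_smul, smul_eq_mul, smul_eq_mul, ← mul_assoc, ← sq,
    mul_div_mul_left _ _ (by positivity), le_div_iff₀ (hdot c hc)] at h1
  exact h1

theorem continuous_form (B : Matrix ι ι ℝ) : Continuous fun c : ι → ℝ => c ⬝ᵥ B *ᵥ c := by
  unfold dotProduct mulVec dotProduct; fun_prop

theorem form_smul (B : Matrix ι ι ℝ) (t : ℝ) (c : ι → ℝ) :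
    (t • c) ⬝ᵥ B *ᵥ (t • c) = t ^ 2 * (c ⬝ᵥ B *ᵥ c) := by
  rw [mulVec_smul, smul_dotProduct, dotProduct_smul, smul_eq_mul, smul_eq_mul]; ring

/-- Finsler's lemma. -/
theorem exists_finsler (B : Matrix ι ι ℝ) (V : Matrix ι τ ℝ)
    (hB : ∀ c, c ≠ 0 → Vᵀ *ᵥ c = 0 → 0 < c ⬝ᵥ B *ᵥ c) :
    ∃ M : ℝ, 0 ≤ M ∧ ∃ δ > 0, ∀ c, δ * (c ⬝ᵥ c) ≤ c ⬝ᵥ B *ᵥ c + M * ((Vᵀ *ᵥ c) ⬝ᵥ (Vᵀ *ᵥ c)) := by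
  have hcontV : Continuous fun c : ι → ℝ => (Vᵀ *ᵥ c) ⬝ᵥ (Vᵀ *ᵥ c) := by
    unfold dotProduct mulVec dotProduct; fun_prop
  let g : ℕ → (ι → ℝ) → ℝ := fun k c => c ⬝ᵥ B *ᵥ c + k * ((Vᵀ *ᵥ c) ⬝ᵥ (Vᵀ *ᵥ c))
  have hg : ∀ k, Continuous (g k) := fun k =>
    (continuous_form B).add (continuous_const.mul hcontV)
  have hnn : ∀ c : ι → ℝ, 0 ≤ (Vᵀ *ᵥ c) ⬝ᵥ (Vᵀ *ᵥ c) := fun c => by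
    simpa using dotProduct_star_self_nonneg (Vᵀ *ᵥ c)
  have hsph : ∀ c ∈ Metric.sphere (0 : ι → ℝ) 1, c ≠ 0 := fun c hc =>
    ne_zero_of_mem_unit_sphere (⟨c, hc⟩ : Metric.sphere (0 : ι → ℝ) 1)
  -- The open sets where `g k` is positive increase with the penalty `k` and cover the sphere, so a
  -- single penalty works on all of it.
  obtain ⟨k, hk⟩ := (isCompact_sphere (0 : ι → ℝ) 1).elim_directed_cover
    (fun k => {c | 0 < g k c}) (fun k => isOpen_lt continuous_const (hg k)) (by
      intro c hc
      rw [Set.mem_iUnion]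
      by_cases h : Vᵀ *ᵥ c = 0
      · exact ⟨0, by simpa [g] using hB c (hsph c hc) h⟩
      · have hpos : 0 < (Vᵀ *ᵥ c) ⬝ᵥ (Vᵀ *ᵥ c) := by
          simpa using dotProduct_star_self_pos_iff.mpr h
        obtain ⟨k, hk⟩ := exists_nat_gt (-(c ⬝ᵥ B *ᵥ c) / ((Vᵀ *ᵥ c) ⬝ᵥ (Vᵀ *ᵥ c)))
        rw [div_lt_iff₀ hpos] at hk
        exact ⟨k, by simp only [g, Set.mem_ofPred_eq]; linarith⟩) (by
      refine directed_of_isDirected_le fun i j hij c hc => ?_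
      have : (i : ℝ) ≤ j := by exact_mod_cast hij
      have := mul_le_mul_of_nonneg_right this (hnn c)
      simp only [g, Set.mem_ofPred_eq] at hc ⊢
      linarith)
  refine ⟨k, Nat.cast_nonneg k, exists_coercive_of_pos (hg k) (fun t c => ?_) fun c hc => ?_⟩
  · simp only [form_smul]
    rw [mulVec_smul, smul_dotProduct, dotProduct_smul, smul_eq_mul, smul_eq_mul]; ring
  · have hn : 0 < ‖c‖ := norm_pos_iff.mpr hc
    have hmem : (‖c‖⁻¹ • c) ∈ Metric.sphere (0 : ι → ℝ) 1 := by simp [norm_smul, hn.ne']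
    have h1 : 0 < g k (‖c‖⁻¹ • c) := hk hmem
    have h2 : g k (‖c‖⁻¹ • c) = ‖c‖⁻¹ ^ 2 * g k c := by
      simp only [g, form_smul]
      rw [mulVec_smul, smul_dotProduct, dotProduct_smul, smul_eq_mul, smul_eq_mul]; ring
    rw [h2] at h1
    exact pos_of_mul_pos_right h1 (by positivity)

theorem abs_form_le (E : Matrix ι ι ℝ) (c : ι → ℝ) :
    |c ⬝ᵥ E *ᵥ c| ≤ (∑ i, ∑ j, |E i j|) * (c ⬝ᵥ c) := by
  have hi : ∀ i, c i ^ 2 ≤ c ⬝ᵥ c := fun i => by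
    simp only [dotProduct, ← sq]
    exact Finset.single_le_sum (f := fun i => c i ^ 2) (fun j _ => sq_nonneg _) (Finset.mem_univ i)
  have hform : c ⬝ᵥ E *ᵥ c = ∑ i, ∑ j, c i * (E i j * c j) := by
    simp only [dotProduct, mulVec, Finset.mul_sum]
  rw [hform]
  generalize c ⬝ᵥ c = S at hi ⊢
  simp only [Finset.sum_mul]
  refine (Finset.abs_sum_le_sum_abs _ _).trans (Finset.sum_le_sum fun i _ => ?_)
  refine (Finset.abs_sum_le_sum_abs _ _).trans (Finset.sum_le_sum fun j _ => ?_)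
  rw [abs_mul, abs_mul, mul_left_comm]
  refine mul_le_mul_of_nonneg_left ?_ (abs_nonneg _)
  have h1 := hi i
  have h2 := hi j
  have h3 := two_mul_le_add_sq |c i| |c j|
  rw [sq_abs, sq_abs] at h3
  linarith

theorem eventually_form_close {E : ℝ → Matrix ι ι ℝ} {E₀ : Matrix ι ι ℝ} {F : Filter ℝ}
    (hE : Tendsto E F (𝓝 E₀)) {η : ℝ} (hη : 0 < η) :
    ∀ᶠ ε in F, ∀ c, |c ⬝ᵥ E ε *ᵥ c - c ⬝ᵥ E₀ *ᵥ c| ≤ η * (c ⬝ᵥ c) := by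
  have h1 : Tendsto (fun ε => ∑ i, ∑ j, |(E ε - E₀) i j|) F (𝓝 (∑ i, ∑ j, |(E₀ - E₀) i j|)) := by
    have hij : ∀ i j, Tendsto (fun ε => E ε i j) F (𝓝 (E₀ i j)) := fun i j =>
      tendsto_pi_nhds.mp (tendsto_pi_nhds.mp hE i) j
    exact tendsto_finsetSum _ fun i _ => tendsto_finsetSum _ fun j _ =>
      ((hij i j).sub_const _).abs
  simp only [sub_self, Matrix.zero_apply, abs_zero, Finset.sum_const_zero] at h1
  filter_upwards [h1.eventually (gt_mem_nhds hη)] with ε hε c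
  rw [← dotProduct_sub, ← sub_mulVec]
  refine (abs_form_le _ c).trans (mul_le_mul_of_nonneg_right hε.le ?_)
  simpa using dotProduct_star_self_nonneg c

/-- The quadratic form of `A ε` eventually dominates every multiple of the identity. -/
def TendsToInfty (A : ℝ → Matrix ι ι ℝ) : Prop :=
  ∀ M : ℝ, ∀ᶠ ε in 𝓝[>] (0 : ℝ), ∀ u : ι → ℝ, M * (u ⬝ᵥ u) ≤ u ⬝ᵥ A ε *ᵥ u

theorem TendsToInfty.isUnit_det [DecidableEq ι] {A : ℝ → Matrix ι ι ℝ} (hA : TendsToInfty A) :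
    ∀ᶠ ε in 𝓝[>] (0 : ℝ), IsUnit (A ε).det := by
  filter_upwards [hA 1] with ε hε
  rw [isUnit_iff_ne_zero]
  intro h
  obtain ⟨v, hv, hv0⟩ := exists_mulVec_eq_zero_iff.mpr h
  have := hε v
  rw [hv0, dotProduct_zero] at this
  have h2 : 0 < v ⬝ᵥ v := by simpa using dotProduct_star_self_pos_iff.mpr hv
  linarith

/-- A column `v` of the inverse satisfies `M (v ⬝ᵥ v) ≤ v_j`, so its entries have size at most
`1/M`. The choice `M = 2/η` keeps the bound strictly below `η`. -/
theorem TendsToInfty.tendsto_inv [DecidableEq ι] {A : ℝ → Matrix ι ι ℝ} (hA : TendsToInfty A) :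
    Tendsto (fun ε => (A ε)⁻¹) (𝓝[>] 0) (𝓝 0) := by
  refine tendsto_pi_nhds.mpr fun i => tendsto_pi_nhds.mpr fun j => ?_
  rw [Metric.tendsto_nhds]
  intro η hη
  filter_upwards [hA (2 / η), hA.isUnit_det] with ε h hu
  set v : ι → ℝ := (A ε)⁻¹ *ᵥ Pi.single j 1 with hv
  have h1 : A ε *ᵥ v = Pi.single j 1 := by
    rw [hv, mulVec_mulVec, mul_nonsing_inv _ hu, one_mulVec]
  have h2 := h v
  rw [h1, dotProduct_single, mul_one] at h2
  have hvi : ∀ i, v i ^ 2 ≤ v ⬝ᵥ v := fun i => by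
    simp only [dotProduct, ← sq]
    exact Finset.single_le_sum (f := fun i => v i ^ 2) (fun j _ => sq_nonneg _) (Finset.mem_univ i)
  have hij : (A ε)⁻¹ i j = v i := by rw [hv]; simp
  rw [Matrix.zero_apply, Real.dist_eq, sub_zero, hij]
  have h3 : 2 / η * (v ⬝ᵥ v) ≤ v j := h2
  have hvv : 0 ≤ v ⬝ᵥ v := (sq_nonneg _).trans (hvi i)
  rw [div_mul_eq_mul_div, div_le_iff₀ hη] at h3
  have h4 := hvi j
  have h5 := hvi i
  by_contra hcon
  rw [not_lt] at hcon
  have h6 : η ^ 2 ≤ v i ^ 2 := by rw [← sq_abs (v i)]; exact pow_le_pow_left₀ hη.le hcon 2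
  have h7 : 2 * v j ≤ η := by
    have : v j * (2 * v j) ≤ v j * η := by nlinarith
    by_cases hvj : 0 < v j
    · exact le_of_mul_le_mul_left this hvj
    · linarith
  nlinarith

/-- A family of matrices which is the sum of a convergent part `B` and of a part that blows up on
the column space of `V`. -/
def SingularDecomposition (L : ℝ → Matrix ι ι ℝ) (V : Matrix ι τ ℝ) (B : Matrix ι ι ℝ)
    (A : ℝ → Matrix τ τ ℝ) : Prop :=
  TendsToInfty A ∧ (∀ ε, (A ε).IsSymm) ∧ ∃ (V' : ℝ → Matrix ι τ ℝ) (B' : ℝ → Matrix ι ι ℝ),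
    Tendsto V' (𝓝[>] 0) (𝓝 V) ∧ Tendsto B' (𝓝[>] 0) (𝓝 B) ∧
    ∀ᶠ ε in 𝓝[>] 0, L ε = B' ε + V' ε * A ε * (V' ε)ᵀ

theorem form_mul_mul_transpose (V : Matrix ι τ ℝ) (A : Matrix τ τ ℝ) (c : ι → ℝ) :
    c ⬝ᵥ (V * A * Vᵀ) *ᵥ c = (Vᵀ *ᵥ c) ⬝ᵥ A *ᵥ (Vᵀ *ᵥ c) := by
  rw [← mulVec_mulVec, ← mulVec_mulVec, dotProduct_mulVec, mulVec_transpose]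

/-- The blowing-up part dominates any fixed penalty `M ‖V'ᵀ c‖²`. Finsler's lemma makes the
penalised limit coercive, and half of its constant absorbs the error. -/
theorem SingularDecomposition.exists_coercive {L : ℝ → Matrix ι ι ℝ} {V : Matrix ι τ ℝ}
    {B : Matrix ι ι ℝ} {A : ℝ → Matrix τ τ ℝ} (h : SingularDecomposition L V B A)
    (hB : ∀ c, c ≠ 0 → Vᵀ *ᵥ c = 0 → 0 < c ⬝ᵥ B *ᵥ c) :
    ∃ δ > 0, ∀ᶠ ε in 𝓝[>] (0 : ℝ), ∀ c, δ * (c ⬝ᵥ c) ≤ c ⬝ᵥ L ε *ᵥ c := by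
  obtain ⟨hA, -, V', B', hV', hB', hL⟩ := h
  obtain ⟨M, hM, δ, hδ, H⟩ := exists_finsler B V hB
  refine ⟨δ / 2, half_pos hδ, ?_⟩
  have hE : Tendsto (fun ε => B' ε + M • (V' ε * (V' ε)ᵀ)) (𝓝[>] 0) (𝓝 (B + M • (V * Vᵀ))) := by
    have hc : Continuous fun X : Matrix ι τ ℝ => M • (X * Xᵀ) := by fun_prop
    exact hB'.add ((hc.tendsto V).comp hV')
  have hform : ∀ (B : Matrix ι ι ℝ) (V : Matrix ι τ ℝ) (c : ι → ℝ),
      c ⬝ᵥ (B + M • (V * Vᵀ)) *ᵥ c = c ⬝ᵥ B *ᵥ c + M * ((Vᵀ *ᵥ c) ⬝ᵥ (Vᵀ *ᵥ c)) := by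
    intro B V c
    rw [add_mulVec, dotProduct_add, smul_mulVec, dotProduct_smul, ← mulVec_mulVec,
      dotProduct_mulVec c V, ← mulVec_transpose, smul_eq_mul]
  filter_upwards [hL, hA M, eventually_form_close hE (half_pos hδ)] with ε h1 h2 h3 c
  have h4 := h3 c
  rw [hform, hform, abs_le] at h4
  have h5 := H c
  have h6 := h2 ((V' ε)ᵀ *ᵥ c)
  rw [h1, add_mulVec, dotProduct_add, form_mul_mul_transpose]
  linarith [h4.1]

/-- Subtracting `M • 1` only changes the convergent part. The positivity condition on the kernel of
`Vᵀ` is vacuous, so coercivity holds for every `M`. -/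
theorem SingularDecomposition.tendsToInfty {L : ℝ → Matrix ι ι ℝ} {V : Matrix ι τ ℝ}
    {B : Matrix ι ι ℝ} {A : ℝ → Matrix τ τ ℝ} (h : SingularDecomposition L V B A)
    (hV : ∀ c, Vᵀ *ᵥ c = 0 → c = 0) : TendsToInfty L := by
  classical
  intro M
  have h' : SingularDecomposition (fun ε => L ε - M • (1 : Matrix ι ι ℝ)) V
      (B - M • (1 : Matrix ι ι ℝ)) A := by
    obtain ⟨hA, hs, V', B', hV', hB', hL⟩ := h
    refine ⟨hA, hs, V', fun ε => B' ε - M • 1, hV', hB'.sub_const _, ?_⟩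
    filter_upwards [hL] with ε hε
    rw [hε]; abel
  obtain ⟨δ, hδ, H⟩ := h'.exists_coercive fun c hc hc' => absurd (hV c hc') hc
  filter_upwards [H] with ε hε c
  have h1 := hε c
  rw [sub_mulVec, dotProduct_sub, smul_mulVec, one_mulVec, dotProduct_smul, smul_eq_mul] at h1
  have h2 : 0 ≤ c ⬝ᵥ c := by simpa using dotProduct_star_self_nonneg c
  nlinarith

end LinearAlgebra

/-! ### Limits of minors and convergence of the random subsets. -/

section Laws
open Matrix

theorem mulVec_injective_of_rank_eq {ι τ : Type*} [Fintype ι] [Fintype τ] (V : Matrix ι τ ℝ)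
    (h : V.rank = Fintype.card τ) (u : τ → ℝ) (hu : V *ᵥ u = 0) : u = 0 := by
  have h1 := LinearMap.finrank_range_add_finrank_ker V.mulVecLin
  rw [show Module.finrank ℝ (LinearMap.range V.mulVecLin) = V.rank from rfl, h,
    Module.finrank_fintype_fun_eq_card] at h1
  have h2 : LinearMap.ker V.mulVecLin = ⊥ := Submodule.finrank_eq_zero.mp (by omega)
  exact LinearMap.ker_eq_bot'.mp h2 u hu

variable {n : ℕ} {τ : Type*} [Fintype τ] [DecidableEq τ]

theorem sum_principalMinor (L : Matrix (Fin n) (Fin n) ℝ) :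
    ∑ X, principalMinor L X = (1 + L).det := by
  have h := (detRowAlternating : (Fin n → ℝ) [⋀^Fin n]→ₗ[ℝ] ℝ).map_add_univ
    (fun i => L i) (fun i => (1 : Matrix (Fin n) (Fin n) ℝ) i)
  rw [add_comm]
  refine Eq.trans ?_ h.symm
  exact Finset.sum_congr rfl fun X _ => (det_piecewise_one_eq_submatrix_det L X).symm

theorem principalMinor_univ (L : Matrix (Fin n) (Fin n) ℝ) :
    principalMinor L Finset.univ = L.det := by
  unfold principalMinor
  convert! det_submatrix_equiv_self (Equiv.subtypeUnivEquiv fun i => Finset.mem_univ i) L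

theorem PMF.sum_toReal_eq_one (ν : PMF (Finset (Fin n))) : ∑ X, (ν X).toReal = 1 := by
  have h := ν.tsum_coe
  rw [tsum_fintype] at h
  rw [← ENNReal.toReal_sum fun X _ => ν.apply_ne_top X, h, ENNReal.toReal_one]

theorem IsLEnsemble.toReal_eq {L : Matrix (Fin n) (Fin n) ℝ} {ν : PMF (Finset (Fin n))}
    (h : IsLEnsemble L ν) (X : Finset (Fin n)) :
    (ν X).toReal = principalMinor L X / ∑ Y, principalMinor L Y := by
  obtain ⟨-, Z, hZ, hX⟩ := h
  have h1 := PMF.sum_toReal_eq_one ν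
  simp only [hX, ← Finset.sum_div] at h1
  rw [div_eq_one_iff_eq hZ.ne'] at h1
  rw [hX, h1]

/-- The full set has probability `det L / det(1 + L) = 1 / det(1 + L⁻¹)`, which tends to `1`. -/
theorem convergesInLaw_univ {L : ℝ → Matrix (Fin n) (Fin n) ℝ} (hL : TendsToInfty L)
    {μ : ℝ → PMF (Finset (Fin n))} (hμ : ∀ ε, 0 < ε → IsLEnsemble (L ε) (μ ε)) :
    ConvergesInLaw μ (PMF.pure Finset.univ) := by
  have h1 : Tendsto (fun ε => (μ ε Finset.univ).toReal) (𝓝[>] 0) (𝓝 1) := by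
    have hc : Continuous fun A : Matrix (Fin n) (Fin n) ℝ => (1 + A).det := by fun_prop
    have h2 : Tendsto (fun ε => ((1 + (L ε)⁻¹).det)⁻¹) (𝓝[>] 0) (𝓝 1) := by
      have h3 := (hc.tendsto 0).comp hL.tendsto_inv
      rw [add_zero, det_one] at h3
      simpa using h3.inv₀ one_ne_zero
    refine h2.congr' ?_
    filter_upwards [hL.isUnit_det, self_mem_nhdsWithin] with ε hu hε
    rw [(hμ ε hε).toReal_eq, sum_principalMinor, principalMinor_univ]
    have h4 : 1 + L ε = L ε * (1 + (L ε)⁻¹) := by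
      rw [mul_add, mul_one, mul_nonsing_inv _ hu, add_comm]
    rw [h4, det_mul, ← div_div, div_self hu.ne_zero, one_div]
  intro X
  by_cases hX : X = Finset.univ
  · subst hX; simpa using h1
  · rw [PMF.pure_apply, if_neg hX, ENNReal.toReal_zero]
    have h5 := h1.const_sub 1
    rw [sub_self] at h5
    refine squeeze_zero (fun _ => ENNReal.toReal_nonneg) (fun ε => ?_) h5
    have h6 := PMF.sum_toReal_eq_one (μ ε)
    have h7 : (μ ε X).toReal + (μ ε Finset.univ).toReal ≤ ∑ Y, (μ ε Y).toReal := by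
      rw [← Finset.sum_pair (f := fun Y => (μ ε Y).toReal) hX]
      exact Finset.sum_le_sum_of_subset_of_nonneg (Finset.subset_univ _)
        fun _ _ _ => ENNReal.toReal_nonneg
    linarith

theorem det_fromBlocks_neg_transpose {ι : Type*} [Fintype ι] [DecidableEq ι] (B : Matrix ι ι ℝ)
    (V : Matrix ι τ ℝ) (C : Matrix τ ι ℝ) :
    (fromBlocks B V (-C) 0).det = (-1) ^ Fintype.card τ * (fromBlocks B V C 0).det := by
  have : fromBlocks B V (-C) (0 : Matrix τ τ ℝ) =
      fromBlocks 1 0 0 (-1 : Matrix τ τ ℝ) * fromBlocks B V C 0 := by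
    rw [fromBlocks_multiply]; simp
  rw [this, det_mul, det_fromBlocks_zero₁₂, det_one, one_mul, det_neg, det_one, mul_one]

theorem det_fromBlocks_inv {ι : Type*} [Fintype ι] [DecidableEq ι] (B : Matrix ι ι ℝ)
    (V : Matrix ι τ ℝ) (A : Matrix τ τ ℝ) (hA : IsUnit A.det) :
    (fromBlocks B V (-Vᵀ) A⁻¹).det = (A.det)⁻¹ * (B + V * A * Vᵀ).det := by
  have : Invertible A := invertibleOfIsUnitDet A hA
  have : Invertible A⁻¹ := invertibleOfIsUnitDet _ (A.isUnit_nonsing_inv_det hA)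
  rw [det_fromBlocks₂₂, det_nonsing_inv, Ring.inverse_eq_inv', invOf_eq_nonsing_inv,
    nonsing_inv_nonsing_inv _ hA, Matrix.mul_neg, sub_neg_eq_add]

theorem principalMinor_add_mul_mul (B : Matrix (Fin n) (Fin n) ℝ) (V : Matrix (Fin n) τ ℝ)
    (A : Matrix τ τ ℝ) (hA : IsUnit A.det) (X : Finset (Fin n)) :
    (A.det)⁻¹ * principalMinor (B + V * A * Vᵀ) X =
      (fromBlocks (B.submatrix (fun i : X => (i : Fin n)) (fun i : X => (i : Fin n)))
        (V.submatrix (fun i : X => (i : Fin n)) id)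
        (-(V.submatrix (fun i : X => (i : Fin n)) id)ᵀ) A⁻¹).det := by
  rw [det_fromBlocks_inv _ _ _ hA]
  rfl

/-- Dividing by `det A` trades the diverging block `A` for `A⁻¹`, which tends to `0`; the rest is
continuity of the determinant. -/
theorem SingularDecomposition.tendsto_principalMinor {L : ℝ → Matrix (Fin n) (Fin n) ℝ}
    {V : Matrix (Fin n) τ ℝ} {B : Matrix (Fin n) (Fin n) ℝ} {A : ℝ → Matrix τ τ ℝ}
    (h : SingularDecomposition L V B A) (X : Finset (Fin n)) :
    Tendsto (fun ε => ((A ε).det)⁻¹ * principalMinor (L ε) X) (𝓝[>] 0)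
      (𝓝 ((-1) ^ Fintype.card τ * borderedMinor B V X)) := by
  obtain ⟨hA, -, V', B', hV', hB', hL⟩ := h
  unfold borderedMinor
  rw [← det_fromBlocks_neg_transpose]
  have hc : Continuous fun p : Matrix (Fin n) (Fin n) ℝ × Matrix (Fin n) τ ℝ × Matrix τ τ ℝ =>
      (fromBlocks (p.1.submatrix (fun i : X => (i : Fin n)) (fun i : X => (i : Fin n)))
        (p.2.1.submatrix (fun i : X => (i : Fin n)) id)
        (-(p.2.1.submatrix (fun i : X => (i : Fin n)) id)ᵀ) p.2.2).det := by
    refine Continuous.matrix_det (Continuous.matrix_fromBlocks ?_ ?_ ?_ ?_)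
    · exact continuous_fst.matrix_submatrix _ _
    · exact continuous_snd.fst.matrix_submatrix _ _
    · exact (continuous_snd.fst.matrix_submatrix _ _).matrix_transpose.neg
    · exact continuous_snd.snd
  refine ((hc.tendsto (B, V, 0)).comp
    (hB'.prodMk_nhds (hV'.prodMk_nhds hA.tendsto_inv))).congr' ?_
  filter_upwards [hL, hA.isUnit_det] with ε h1 h2
  rw [h1, principalMinor_add_mul_mul _ _ _ h2]
  rfl

/-- Take for `X` rows of `V` forming a basis of its row space. A null vector `(c, u)` of the
bordered matrix has `c = 0` by independence of these rows, then `V u = 0` because they span all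
rows. -/
theorem exists_borderedMinor_ne_zero (B : Matrix (Fin n) (Fin n) ℝ) (V : Matrix (Fin n) τ ℝ)
    (hV : ∀ u, V *ᵥ u = 0 → u = 0) : ∃ X, borderedMinor B V X ≠ 0 := by
  classical
  obtain ⟨κ, a, ha, hspan, hli⟩ := exists_linearIndependent' ℝ (fun i => V i)
  set X : Finset (Fin n) := Finset.univ.filter fun i => i ∈ Set.range a with hX
  have hmem : ∀ k, a k ∈ X := fun k => by simp [hX]
  have hch : ∀ i : X, ∃ k, a k = i := fun i => by
    have := i.2
    simpa [hX] using this
  choose g hg using hch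
  refine ⟨X, fun h0 => ?_⟩
  obtain ⟨v, hv, hv0⟩ := exists_mulVec_eq_zero_iff.mpr h0
  rw [fromBlocks_mulVec] at hv0
  have e1 := congrArg (fun w => w ∘ Sum.inl) hv0
  have e2 := congrArg (fun w => w ∘ Sum.inr) hv0
  simp only [Sum.elim_comp_inl, Sum.elim_comp_inr, zero_mulVec, add_zero] at e1 e2
  have hli' : LinearIndependent ℝ fun i : X => V i := by
    have h2 : Function.Injective g := fun i j hij => Subtype.ext (by rw [← hg i, ← hg j, hij])
    have h3 := hli.comp g h2
    convert! h3 using 1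
    funext i
    simp [hg]
  have hc : v ∘ Sum.inl = 0 := by
    rw [Fintype.linearIndependent_iff] at hli'
    refine funext (hli' (v ∘ Sum.inl) ?_)
    funext t
    have := congrFun e2 t
    simp only [mulVec, dotProduct, transpose_apply, submatrix_apply, id, Function.comp_apply,
      Pi.zero_apply] at this
    rw [Finset.sum_apply]
    simpa [mul_comm] using this
  rw [hc, mulVec_zero, zero_add] at e1
  have hu : v ∘ Sum.inr = 0 := by
    apply hV
    have hle : Submodule.span ℝ (Set.range fun i => V i) ≤
        LinearMap.ker (dotProductBilin ℝ ℝ |>.flip (v ∘ Sum.inr)) := by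
      rw [← hspan, Submodule.span_le]
      rintro _ ⟨k, rfl⟩
      have := congrFun e1 ⟨a k, hmem k⟩
      simpa [mulVec] using this
    funext i
    have := hle (Submodule.subset_span ⟨i, rfl⟩)
    simpa [mulVec] using this
  apply hv
  funext i
  cases i with
  | inl i => exact congrFun hc i
  | inr i => exact congrFun hu i

/-- The factor `a ε` cancels on normalisation, and the limits are nonnegative because the minors
are. -/
theorem exists_limit_law {L : ℝ → Matrix (Fin n) (Fin n) ℝ} {a : ℝ → ℝ} {c : Finset (Fin n) → ℝ}
    (ha : ∀ᶠ ε in 𝓝[>] 0, 0 < a ε)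
    (hc : ∀ X, Tendsto (fun ε => a ε * principalMinor (L ε) X) (𝓝[>] 0) (𝓝 (c X)))
    (hne : ∃ X, c X ≠ 0) {μ : ℝ → PMF (Finset (Fin n))}
    (hμ : ∀ ε, 0 < ε → IsLEnsemble (L ε) (μ ε)) :
    ∃ ν : PMF (Finset (Fin n)), (∃ Z : ℝ, 0 < Z ∧ ∀ X, (ν X).toReal = c X / Z) ∧
      ConvergesInLaw μ ν := by
  have hc0 : ∀ X, 0 ≤ c X := by
    intro X
    refine ge_of_tendsto (hc X) ?_
    filter_upwards [ha, self_mem_nhdsWithin] with ε h1 hε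
    exact mul_nonneg h1.le ((hμ ε hε).1.submatrix _).det_nonneg
  set Z := ∑ X, c X with hZ
  have hZpos : 0 < Z := by
    obtain ⟨X, hX⟩ := hne
    exact Finset.sum_pos' (fun X _ => hc0 X) ⟨X, Finset.mem_univ _, (hc0 X).lt_of_ne' hX⟩
  have hsum : ∑ X, ENNReal.ofReal (c X / Z) = 1 := by
    rw [← ENNReal.ofReal_sum_of_nonneg fun X _ => div_nonneg (hc0 X) hZpos.le, ← Finset.sum_div,
      div_self hZpos.ne', ENNReal.ofReal_one]
  have hν : ∀ X, ((PMF.ofFintype (fun X => ENNReal.ofReal (c X / Z)) hsum) X).toReal = c X / Z :=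
    fun X => by rw [PMF.ofFintype_apply, ENNReal.toReal_ofReal (div_nonneg (hc0 X) hZpos.le)]
  refine ⟨PMF.ofFintype _ hsum, ⟨Z, hZpos, hν⟩, fun X => ?_⟩
  rw [hν]
  refine ((hc X).div (tendsto_finsetSum Finset.univ fun Y _ => hc Y) hZpos.ne').congr' ?_
  filter_upwards [ha, self_mem_nhdsWithin] with ε h1 hε
  simp only [Pi.div_apply]
  rw [(hμ ε hε).toReal_eq, ← Finset.mul_sum, mul_div_mul_left _ _ h1.ne']

theorem TendsToInfty.eventually_det_pos {A : ℝ → Matrix τ τ ℝ} (hA : TendsToInfty A)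
    (hs : ∀ ε, (A ε).IsSymm) : ∀ᶠ ε in 𝓝[>] 0, 0 < (A ε).det := by
  filter_upwards [hA 1] with ε hε
  apply PosDef.det_pos
  refine PosDef.of_dotProduct_mulVec_pos ?_ fun u hu => ?_
  · rw [IsHermitian, conjTranspose_eq_transpose_of_trivial]
    exact hs ε
  · have h1 := hε u
    have h2 : 0 < u ⬝ᵥ u := by simpa using dotProduct_star_self_pos_iff.mpr hu
    simp only [star_trivial]
    linarith

theorem SingularDecomposition.exists_limit_law {L : ℝ → Matrix (Fin n) (Fin n) ℝ}
    {V : Matrix (Fin n) τ ℝ} {B : Matrix (Fin n) (Fin n) ℝ} {A : ℝ → Matrix τ τ ℝ}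
    (h : SingularDecomposition L V B A) (hV : ∀ u, V *ᵥ u = 0 → u = 0)
    {μ : ℝ → PMF (Finset (Fin n))} (hμ : ∀ ε, 0 < ε → IsLEnsemble (L ε) (μ ε)) :
    ∃ ν : PMF (Finset (Fin n)), (∃ Z : ℝ, 0 < Z ∧
      ∀ X, (ν X).toReal = (-1) ^ Fintype.card τ * borderedMinor B V X / Z) ∧
      ConvergesInLaw μ ν := by
  refine _root_.exists_limit_law (a := fun ε => ((A ε).det)⁻¹) ?_
    (fun X => h.tendsto_principalMinor X) ?_ hμ
  · filter_upwards [h.1.eventually_det_pos h.2.1] with ε hε using inv_pos.mpr hε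
  · obtain ⟨X, hX⟩ := exists_borderedMinor_ne_zero B V hV
    exact ⟨X, mul_ne_zero (by simp) hX⟩

theorem isUnit_det_transpose_mul_self {ι : Type*} [Fintype ι] (V : Matrix ι τ ℝ)
    (hV : ∀ u, V *ᵥ u = 0 → u = 0) : (Vᵀ * V).det ≠ 0 := by
  intro h0
  obtain ⟨v, hv, hv0⟩ := exists_mulVec_eq_zero_iff.mpr h0
  apply hv
  apply hV
  have h1 : (V *ᵥ v) ⬝ᵥ (V *ᵥ v) = 0 := by
    rw [dotProduct_mulVec, ← mulVec_transpose, mulVec_mulVec, hv0, zero_dotProduct]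
  simpa using h1

/-- On the kernel of `V'ᵀ` the diverging part is invisible, so `B'` inherits the sign of `L`. It
remains to approximate a kernel vector of `Vᵀ` by kernel vectors of `V'ᵀ`. -/
theorem SingularDecomposition.form_nonneg {L : ℝ → Matrix (Fin n) (Fin n) ℝ}
    {V : Matrix (Fin n) τ ℝ} {B : Matrix (Fin n) (Fin n) ℝ} {A : ℝ → Matrix τ τ ℝ}
    (h : SingularDecomposition L V B A) (hV : ∀ u, V *ᵥ u = 0 → u = 0)
    (hL : ∀ ε, 0 < ε → (L ε).PosSemidef) (c : Fin n → ℝ) (hc : Vᵀ *ᵥ c = 0) :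
    0 ≤ c ⬝ᵥ B *ᵥ c := by
  obtain ⟨-, -, V', B', hV', hB', hdec⟩ := h
  have hdet : Tendsto (fun ε => ((V' ε)ᵀ * V).det) (𝓝[>] 0) (𝓝 (Vᵀ * V).det) := by
    have : Continuous fun X : Matrix (Fin n) τ ℝ => (Xᵀ * V).det := by fun_prop
    exact (this.tendsto V).comp hV'
  have hne := isUnit_det_transpose_mul_self V hV
  -- Oblique projection onto the kernel of `V'ᵀ` along the range of `V`. The inverse is written with
  -- the adjugate, so that continuity is immediate.
  let cc : ℝ → Fin n → ℝ := fun ε =>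
    c - V *ᵥ ((((V' ε)ᵀ * V).det)⁻¹ • (((V' ε)ᵀ * V).adjugate *ᵥ ((V' ε)ᵀ *ᵥ c)))
  have hcc : Tendsto cc (𝓝[>] 0) (𝓝 c) := by
    have h1 : Continuous fun X : Matrix (Fin n) τ ℝ => (Xᵀ * V).adjugate *ᵥ (Xᵀ *ᵥ c) := by
      fun_prop
    have h2 := (hdet.inv₀ hne).smul ((h1.tendsto V).comp hV')
    have h3 : Continuous fun u : τ → ℝ => c - V *ᵥ u := by fun_prop
    have h4 := (h3.tendsto _).comp h2
    rw [hc, mulVec_zero, smul_zero, mulVec_zero, sub_zero] at h4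
    exact h4
  have hlim : Tendsto (fun ε => cc ε ⬝ᵥ B' ε *ᵥ cc ε) (𝓝[>] 0) (𝓝 (c ⬝ᵥ B *ᵥ c)) := by
    have h1 : Continuous fun p : (Fin n → ℝ) × Matrix (Fin n) (Fin n) ℝ => p.1 ⬝ᵥ p.2 *ᵥ p.1 := by
      fun_prop
    exact (h1.tendsto (c, B)).comp (hcc.prodMk_nhds hB')
  refine ge_of_tendsto hlim ?_
  filter_upwards [hdec, hdet.eventually_ne hne, self_mem_nhdsWithin] with ε h1 h2 hε
  have hker : (V' ε)ᵀ *ᵥ cc ε = 0 := by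
    simp only [cc]
    rw [mulVec_sub, mulVec_mulVec, mulVec_smul, mulVec_mulVec, mul_adjugate, smul_mulVec,
      one_mulVec, smul_smul, inv_mul_cancel₀ h2, one_smul, sub_self]
  have h3 := (hL ε hε).dotProduct_mulVec_nonneg (cc ε)
  rw [h1, star_trivial, add_mulVec, dotProduct_add, form_mul_mul_transpose, hker, mulVec_zero,
    dotProduct_zero, add_zero] at h3
  exact h3

/-- The extended L-ensemble `DPP(0; V)` is the fixed-size L-ensemble of `V Vᵀ`. -/
theorem borderedMinor_zero (V : Matrix (Fin n) τ ℝ) (X : Finset (Fin n)) :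
    (-1) ^ Fintype.card τ * borderedMinor 0 V X =
      if X.card = Fintype.card τ then principalMinor (V * Vᵀ) X else 0 := by
  set S := V.submatrix (fun i : X => (i : Fin n)) id with hS
  have hpm : principalMinor (V * Vᵀ) X = (S * Sᵀ).det := rfl
  -- Regularise the zero corner by `t • 1`. The Schur complement then relates both determinants
  -- through `t^|X|` and `t^q`, with `q` the number of columns, and comparing powers as `t → 0`
  -- separates the three cases.
  have hlim : Tendsto (fun t : ℝ => (fromBlocks (0 : Matrix X X ℝ) S (-Sᵀ)
      (t • (1 : Matrix τ τ ℝ))).det) (𝓝[>] 0)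
      (𝓝 ((-1) ^ Fintype.card τ * borderedMinor 0 V X)) := by
    unfold borderedMinor
    rw [← det_fromBlocks_neg_transpose]
    have hc : Continuous fun t : ℝ => (fromBlocks (0 : Matrix X X ℝ) S (-Sᵀ)
        (t • (1 : Matrix τ τ ℝ))).det :=
      Continuous.matrix_det (Continuous.matrix_fromBlocks continuous_const continuous_const
        continuous_const (continuous_id.smul continuous_const))
    have := (hc.tendsto 0).mono_left (nhdsWithin_le_nhds (s := Set.Ioi 0))
    rw [zero_smul] at this
    exact this
  have hval : ∀ t : ℝ, 0 < t → t ^ X.card * (fromBlocks (0 : Matrix X X ℝ) S (-Sᵀ)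
      (t • (1 : Matrix τ τ ℝ))).det = t ^ Fintype.card τ * (S * Sᵀ).det := by
    intro t ht
    have h1 := det_fromBlocks_inv (0 : Matrix X X ℝ) S (t⁻¹ • (1 : Matrix τ τ ℝ))
      (by rw [det_smul, det_one, mul_one]; exact (pow_ne_zero _ (inv_ne_zero ht.ne')).isUnit)
    have h2 : (t⁻¹ • (1 : Matrix τ τ ℝ))⁻¹ = t • 1 := by
      apply inv_eq_left_inv
      rw [smul_mul_smul_comm, mul_inv_cancel₀ ht.ne', one_mul, one_smul]
    rw [h2, zero_add, Matrix.mul_smul, Matrix.mul_one, Matrix.smul_mul, det_smul, det_smul,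
      det_one, Fintype.card_coe] at h1
    rw [h1]
    simp only [inv_pow, mul_one, inv_inv]
    field_simp
  rcases lt_trichotomy X.card (Fintype.card τ) with h | h | h
  · rw [if_neg h.ne]
    refine tendsto_nhds_unique hlim ?_
    have hc : Continuous fun t : ℝ => t ^ (Fintype.card τ - X.card) * (S * Sᵀ).det := by fun_prop
    have h3 := (hc.tendsto 0).mono_left (nhdsWithin_le_nhds (s := Set.Ioi 0))
    rw [zero_pow (by omega), zero_mul] at h3
    refine h3.congr' ?_
    filter_upwards [self_mem_nhdsWithin] with t ht
    have ht' : 0 < t := ht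
    have h4 := hval t ht
    rw [show Fintype.card τ = X.card + (Fintype.card τ - X.card) by omega, pow_add, mul_assoc] at h4
    exact (mul_left_cancel₀ (pow_ne_zero _ ht'.ne') h4).symm
  · rw [if_pos h, hpm]
    refine tendsto_nhds_unique hlim (tendsto_const_nhds.congr' ?_)
    filter_upwards [self_mem_nhdsWithin] with t ht
    have ht' : 0 < t := ht
    have h4 := hval t ht
    rw [h] at h4
    exact (mul_left_cancel₀ (pow_ne_zero _ ht'.ne') h4).symm
  · rw [if_neg h.ne']
    refine tendsto_nhds_unique hlim (tendsto_const_nhds.congr' ?_)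
    filter_upwards [self_mem_nhdsWithin] with t ht
    have ht' : 0 < t := ht
    have h4 := hval t ht
    have h5 : (S * Sᵀ).det = 0 := by
      by_contra hne
      have h6 := rank_of_isUnit (S * Sᵀ)
        ((isUnit_iff_isUnit_det _).mpr (isUnit_iff_ne_zero.mpr hne))
      have h7 := (rank_mul_le_left S Sᵀ).trans S.rank_le_card_width
      rw [h6, Fintype.card_coe] at h7
      omega
    rw [h5, mul_zero] at h4
    exact ((mul_eq_zero.mp h4).resolve_left (pow_ne_zero _ ht'.ne')).symm

end Laws

/-! ### Completing the square in the small-scale expansion. -/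

section Expansion
open Matrix
variable {ι τ : Type*} [Fintype τ] [DecidableEq τ]

/-- The diagonal matrix with entries `ε ^ deg a`. -/
def powDiagonal (deg : τ → ℕ) (ε : ℝ) : Matrix τ τ ℝ := diagonal fun a => ε ^ deg a

theorem tendsToInfty_powDiagonal {l p : ℕ} (hlp : 2 * l ≤ p + 1) (deg : τ → ℕ)
    (hdeg : ∀ a, deg a < l) {α : ℝ} (hα : 0 < α) {W : Matrix τ τ ℝ} (hW : W.PosDef) :
    TendsToInfty fun ε => (α * (ε ^ p)⁻¹) • (powDiagonal deg ε * W * powDiagonal deg ε) := by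
  obtain ⟨w, hw, H⟩ := exists_coercive_of_pos (continuous_form W) (form_smul W)
    fun c hc => by simpa using hW.dotProduct_mulVec_pos hc
  intro M
  have h1 : Tendsto (fun ε : ℝ => α * w * ε⁻¹) (𝓝[>] 0) atTop :=
    tendsto_inv_nhdsGT_zero.const_mul_atTop (mul_pos hα hw)
  filter_upwards [h1.eventually_ge_atTop M, self_mem_nhdsWithin,
    mem_nhdsWithin_of_mem_nhds (Iio_mem_nhds one_pos)] with ε hM hε hε1 u
  have hε : 0 < ε := hε
  have hε1 : ε < 1 := hε1
  have hsymm : (powDiagonal deg ε)ᵀ = powDiagonal deg ε := diagonal_transpose _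
  have hform := form_mul_mul_transpose (powDiagonal deg ε) W u
  rw [hsymm] at hform
  rw [smul_mulVec, dotProduct_smul, hform, smul_eq_mul]
  have hu : 0 ≤ u ⬝ᵥ u := by simpa using dotProduct_star_self_nonneg u
  calc M * (u ⬝ᵥ u) ≤ α * w * ε⁻¹ * (u ⬝ᵥ u) := mul_le_mul_of_nonneg_right hM hu
    _ = ∑ a, α * w * ε⁻¹ * (u a * u a) := by rw [dotProduct, Finset.mul_sum]
    _ ≤ ∑ a, α * (ε ^ p)⁻¹ * w * ((ε ^ deg a * u a) * (ε ^ deg a * u a)) := by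
      refine Finset.sum_le_sum fun a _ => ?_
      -- From `deg a ≤ l - 1` and `2l ≤ p + 1`, it follows that `2 deg a + 1 ≤ p`: every direction
      -- grows at least like `1/ε`.
      have hd : ε⁻¹ ≤ (ε ^ p)⁻¹ * ε ^ (2 * deg a) := by
        have h2 : ε ^ p ≤ ε ^ (2 * deg a + 1) :=
          pow_le_pow_of_le_one hε.le hε1.le (by have := hdeg a; omega)
        rw [inv_mul_eq_div, le_div_iff₀ (pow_pos hε _), inv_mul_le_iff₀ hε, ← pow_succ']
        exact h2
      calc α * w * ε⁻¹ * (u a * u a)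
          ≤ α * w * ((ε ^ p)⁻¹ * ε ^ (2 * deg a)) * (u a * u a) :=
            mul_le_mul_of_nonneg_right (mul_le_mul_of_nonneg_left hd (mul_pos hα hw).le)
              (mul_self_nonneg _)
        _ = _ := by rw [two_mul, pow_add]; ring
    _ = α * (ε ^ p)⁻¹ * (w * ((powDiagonal deg ε *ᵥ u) ⬝ᵥ (powDiagonal deg ε *ᵥ u))) := by
      simp only [powDiagonal, mulVec_diagonal, dotProduct, Finset.mul_sum]
      exact Finset.sum_congr rfl fun a _ => by ring
    _ ≤ _ := mul_le_mul_of_nonneg_left (H _) (mul_pos hα (inv_pos.mpr (pow_pos hε _))).le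

/-- Completing the square in an expansion of a matrix in powers of `ε`. -/
theorem SingularDecomposition.of_expansion {l p : ℕ} (hpl : p ≤ 2 * l) (hlp : 2 * l ≤ p + 1)
    (deg : τ → ℕ) (hdeg : ∀ a, deg a < l) {α : ℝ} (hα : 0 < α) {W : Matrix τ τ ℝ}
    (hW : W.PosDef) {L : ℝ → Matrix ι ι ℝ} {V : Matrix ι τ ℝ} {C : ℝ → Matrix τ ι ℝ}
    {C₀ : Matrix τ ι ℝ} {R : ℝ → Matrix ι ι ℝ} {R₀ : Matrix ι ι ℝ}
    (hC : Tendsto C (𝓝[>] 0) (𝓝 C₀)) (hR : Tendsto R (𝓝[>] 0) (𝓝 R₀))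
    (hL : ∀ ε, 0 < ε → L ε = V * powDiagonal deg ε * W * powDiagonal deg ε * Vᵀ +
      ε ^ l • (V * powDiagonal deg ε * C ε + (C ε)ᵀ * powDiagonal deg ε * Vᵀ) + ε ^ p • R ε) :
    SingularDecomposition (fun ε => (α * (ε ^ p)⁻¹) • L ε) V
      (α • (R₀ - (0 : ℝ) ^ (2 * l - p) • (C₀ᵀ * W⁻¹ * C₀)))
      (fun ε => (α * (ε ^ p)⁻¹) • (powDiagonal deg ε * W * powDiagonal deg ε)) := by
  have hWs : Wᵀ = W := by
    have := hW.isHermitian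
    rwa [IsHermitian, conjTranspose_eq_transpose_of_trivial] at this
  have hWu : IsUnit W.det := hW.det_pos.ne'.isUnit
  have hWi : (W⁻¹)ᵀ = W⁻¹ := by rw [transpose_nonsing_inv, hWs]
  have hε0 : Tendsto (fun ε : ℝ => ε) (𝓝[>] 0) (𝓝 0) := nhdsWithin_le_nhds
  -- With `G = diag(ε^(l - deg))`, one has `G D = ε^l`, so shifting `V` by `Cᵀ W⁻¹ G` produces the
  -- cross terms. The excess `ε^(2l) Cᵀ W⁻¹ C` survives division by `ε^p` only if `2l = p`, recorded
  -- by the factor `0^(2l-p)`.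
  refine ⟨tendsToInfty_powDiagonal hlp deg hdeg hα hW, fun ε => ?_,
    fun ε => V + (C ε)ᵀ * W⁻¹ * diagonal fun a => ε ^ (l - deg a),
    fun ε => α • (R ε - ε ^ (2 * l - p) • ((C ε)ᵀ * W⁻¹ * C ε)), ?_, ?_, ?_⟩
  · rw [IsSymm, transpose_smul, transpose_mul, transpose_mul, hWs, powDiagonal,
      diagonal_transpose, ← Matrix.mul_assoc, ← powDiagonal]
  · have hc : Continuous fun q : Matrix τ ι ℝ × ℝ =>
        V + q.1ᵀ * W⁻¹ * diagonal fun a => q.2 ^ (l - deg a) := by fun_prop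
    have h := (hc.tendsto (C₀, 0)).comp (hC.prodMk_nhds hε0)
    have h0 : (fun a => (0 : ℝ) ^ (l - deg a)) = 0 :=
      funext fun a => zero_pow (by have := hdeg a; omega)
    simp only [h0] at h
    convert! h using 2
    simp
  · have hc : Continuous fun q : Matrix ι ι ℝ × Matrix τ ι ℝ × ℝ =>
        α • (q.1 - q.2.2 ^ (2 * l - p) • (q.2.1ᵀ * W⁻¹ * q.2.1)) := by fun_prop
    exact (hc.tendsto (R₀, C₀, 0)).comp (hR.prodMk_nhds (hC.prodMk_nhds hε0))
  · filter_upwards [self_mem_nhdsWithin] with ε hε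
    have hε : 0 < ε := hε
    set D := powDiagonal deg ε with hD
    set G : Matrix τ τ ℝ := diagonal fun a => ε ^ (l - deg a) with hG
    have hDs : Dᵀ = D := diagonal_transpose _
    have hGs : Gᵀ = G := diagonal_transpose _
    have hGD : G * D = ε ^ l • (1 : Matrix τ τ ℝ) := by
      rw [hG, hD, powDiagonal, diagonal_mul_diagonal, smul_one_eq_diagonal]
      congr 1
      funext a
      rw [← pow_add, Nat.sub_add_cancel (hdeg a).le]
    have hDG : D * G = ε ^ l • (1 : Matrix τ τ ℝ) := by
      rw [hG, hD, powDiagonal, diagonal_mul_diagonal, smul_one_eq_diagonal]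
      congr 1
      funext a
      rw [← pow_add, Nat.add_sub_cancel' (hdeg a).le]
    have hsq : (V + (C ε)ᵀ * W⁻¹ * G) * (D * W * D) * (V + (C ε)ᵀ * W⁻¹ * G)ᵀ =
        V * D * W * D * Vᵀ + ε ^ l • (V * D * C ε + (C ε)ᵀ * D * Vᵀ) +
          ε ^ (2 * l) • ((C ε)ᵀ * W⁻¹ * C ε) := by
      have e1 : (V + (C ε)ᵀ * W⁻¹ * G) * D = V * D + ε ^ l • ((C ε)ᵀ * W⁻¹) := by
        rw [Matrix.add_mul, Matrix.mul_assoc _ G, hGD, Matrix.mul_smul, Matrix.mul_one]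
      have e2 : D * (V + (C ε)ᵀ * W⁻¹ * G)ᵀ = D * Vᵀ + ε ^ l • (W⁻¹ * C ε) := by
        rw [← hDs, ← transpose_mul, hDs, e1]
        simp [transpose_mul, hDs, hWi]
      have e3 : (V + (C ε)ᵀ * W⁻¹ * G) * (D * W * D) * (V + (C ε)ᵀ * W⁻¹ * G)ᵀ =
          ((V + (C ε)ᵀ * W⁻¹ * G) * D) * W * (D * (V + (C ε)ᵀ * W⁻¹ * G)ᵀ) := by
        simp only [Matrix.mul_assoc]
      rw [e3, e1, e2]
      have e4 : (V * D + ε ^ l • ((C ε)ᵀ * W⁻¹)) * W = V * D * W + ε ^ l • (C ε)ᵀ := by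
        rw [Matrix.add_mul, Matrix.smul_mul, nonsing_inv_mul_cancel_right _ _ hWu]
      rw [e4, Matrix.add_mul, Matrix.mul_add, Matrix.mul_add, Matrix.mul_smul, Matrix.smul_mul,
        Matrix.smul_mul, Matrix.mul_smul, smul_smul, ← pow_add, ← two_mul]
      have e5 : V * D * W * (W⁻¹ * C ε) = V * D * C ε := by
        rw [← Matrix.mul_assoc, mul_nonsing_inv_cancel_right _ _ hWu]
      rw [e5, smul_add]
      simp only [Matrix.mul_assoc]
      abel
    rw [hL ε hε, Matrix.mul_smul, Matrix.smul_mul, hsq]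
    have e6 : (ε ^ p)⁻¹ * ε ^ (2 * l) = ε ^ (2 * l - p) := by
      rw [inv_mul_eq_iff_eq_mul₀ (pow_pos hε _).ne', ← pow_add, Nat.add_sub_cancel' hpl]
    have e7 : (ε ^ p)⁻¹ * ε ^ p = 1 := inv_mul_cancel₀ (pow_pos hε _).ne'
    simp only [smul_add, smul_sub, smul_smul, mul_assoc α, e6, e7, mul_one]
    abel

end Expansion

/-! ### Singular decompositions of the kernel matrix for odd and even `p`. -/

section KernelDecomposition
open Matrix
variable {d : ℕ}

theorem isHomogeneous_radial (j : ℕ) :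
    MvPolynomial.IsHomogeneous ((∑ i, MvPolynomial.X i ^ 2 : MvPolynomial (Fin d) ℝ) ^ j)
      (2 * j) :=
  (MvPolynomial.IsHomogeneous.sum _ _ _ fun i _ => MvPolynomial.isHomogeneous_X_pow i 2).pow j

theorem coeff_radialTaylor_of_odd (f : ℝ → ℝ) (M : ℕ) (c : Fin d →₀ ℕ) (hc : Odd c.degree) :
    (radialTaylor d f M).coeff c = 0 := by
  rw [radialTaylor, MvPolynomial.coeff_sum]
  refine Finset.sum_eq_zero fun j _ => ?_
  rw [MvPolynomial.coeff_C_mul, (isHomogeneous_radial j).coeff_eq_zero, mul_zero]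
  rintro h
  rw [h] at hc
  exact Nat.not_odd_iff_even.mpr (even_two_mul j) hc

theorem degree_toFinsupp (a : Fin d → ℕ) : (toFinsupp a).degree = ∑ i, a i := by
  rw [Finsupp.degree_eq_sum]
  rfl

/-- The radial polynomial has only even degrees: for `|a| + |b|` odd both entries vanish, otherwise
the signs `(-1)^|a|` and `(-1)^|b|` agree. -/
theorem wronskianEntry_comm {f : ℝ → ℝ} (hf : AnalyticAt ℝ f 0) {M : ℕ} (hM : 1 ≤ M)
    (ho : OddCoeffsVanish f M) (a b : Fin d → ℕ) (h : ∑ i, a i + ∑ i, b i + 1 ≤ 2 * M - 1) :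
    wronskianEntry (stationaryKernel d f) a b = wronskianEntry (stationaryKernel d f) b a := by
  rw [wronskianEntry_eq (hasJet_radial hf hM ho) a b (by exact_mod_cast h),
    wronskianEntry_eq (hasJet_radial hf hM ho) b a (by
      rw [add_comm (Nat.cast _) (Nat.cast _)]; exact_mod_cast h),
    add_comm (toFinsupp b)]
  have h1 : ∏ i, ((b i + a i).choose (a i) : ℝ) = ∏ i, ((a i + b i).choose (b i) : ℝ) :=
    Finset.prod_congr rfl fun i _ => by rw [add_comm (b i), Nat.choose_symm_add]
  rw [h1]
  by_cases he : Even (∑ i, a i + ∑ i, b i)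
  · rw [neg_one_pow_congr (Nat.even_add.mp he)]
  · rw [coeff_radialTaylor_of_odd]
    · ring
    · rw [map_add, degree_toFinsupp, degree_toFinsupp]
      exact Nat.not_even_iff_odd.mp he

theorem MonEq.toFun_injective {l : ℕ} : Function.Injective (MonEq.toFun : MonEq d l → Fin d → ℕ) :=
  fun _ _ h => Subtype.ext (funext fun i => Fin.ext (congrFun h i))

theorem MonEq.sum_eq {l : ℕ} (a : MonEq d l) : ∑ i, a.toFun i = l := a.2

/-- The total degree of a multi-index. -/
def MonLT.degree {l : ℕ} (a : MonLT d l) : ℕ := ∑ i, a.toFun i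

theorem ite_sum_zero {σ : Type*} (s : Finset σ) (P : Prop) [Decidable P] (X : σ → ℝ) :
    (if P then ∑ b ∈ s, X b else 0) = ∑ b ∈ s, if P then X b else 0 := by
  split_ifs <;> simp

theorem sum_monLT_ite_lt {l K : ℕ} (hlK : l ≤ K) (g : (Fin d → ℕ) → ℝ) :
    (∑ a : MonLT d K, if ∑ i, a.toFun i < l then g a.toFun else 0) =
      ∑ a : MonLT d l, g a.toFun := by
  rw [sum_monLT_eq hlK (fun a => if ∑ i, a i < l then g a else 0)
    fun a ha => if_neg (not_lt.mpr ha)]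
  exact Finset.sum_congr rfl fun a _ => if_pos a.sum_lt

theorem sum_monLT_eq_monEq {l K : ℕ} (hlK : l < K) (g : (Fin d → ℕ) → ℝ)
    (hg : ∀ a, ∑ i, a i < K → ∑ i, a i ≠ l → g a = 0) :
    ∑ a : MonLT d K, g a.toFun = ∑ a : MonEq d l, g a.toFun := by
  symm
  have hex : ∀ a : MonEq d l, ∃ b : MonLT d K, b.toFun = a.toFun := fun a =>
    MonLT.exists_toFun_eq a.toFun (by rw [a.sum_eq]; exact hlK)
  choose φ hφ using hex
  refine Finset.sum_of_injOn φ ?_ (fun _ _ => by simp) ?_ ?_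
  · intro a _ b _ h
    exact MonEq.toFun_injective (by rw [← hφ a, h, hφ b])
  · intro a _ ha
    refine hg _ a.sum_lt fun h => ha ?_
    refine ⟨⟨fun i => ⟨a.toFun i, ?_⟩, h⟩, by simp, MonLT.toFun_injective ?_⟩
    · exact Nat.lt_succ_of_le
        ((Finset.single_le_sum (fun j _ => Nat.zero_le (a.toFun j)) (Finset.mem_univ i)).trans h.le)
    · rw [hφ]; rfl
  · intro a _
    rw [hφ]

/-- The Wronskian entry of the multi-indices `a`, `b`, cut off at total degree `K`. -/
def wronskianCut (d : ℕ) (f : ℝ → ℝ) (K : ℕ) (a b : Fin d → ℕ) : ℝ :=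
  if ∑ i, a i + ∑ i, b i < K then wronskianEntry (stationaryKernel d f) a b else 0

theorem wronskianCut_comm {f : ℝ → ℝ} (hf : AnalyticAt ℝ f 0) {M : ℕ} (hM : 1 ≤ M)
    (ho : OddCoeffsVanish f M) (a b : Fin d → ℕ) :
    wronskianCut d f (2 * M - 1) a b = wronskianCut d f (2 * M - 1) b a := by
  unfold wronskianCut
  rw [add_comm (∑ i, b i)]
  split_ifs with h
  · exact wronskianEntry_comm hf hM ho a b h
  · rfl

/-- The terms of the kernel expansion of degree `≥ l` in the second variable, divided by `ε ^ l`. -/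
def crossTerm (d : ℕ) (f : ℝ → ℝ) (l K : ℕ) (ε : ℝ) (a : Fin d → ℕ)
    (y : EuclideanSpace ℝ (Fin d)) : ℝ :=
  ∑ b : MonLT d K, if ∑ i, b.toFun i < l then 0 else
    ε ^ (∑ i, b.toFun i - l) * (wronskianCut d f K a b.toFun * monomialEval b.toFun y)

/-- The terms of the kernel expansion of degree `≥ l` in both variables. -/
def tailTerm (d : ℕ) (f : ℝ → ℝ) (l K : ℕ) (ε : ℝ) (x y : EuclideanSpace ℝ (Fin d)) : ℝ :=
  ∑ a : MonLT d K, ∑ b : MonLT d K, if ∑ i, a.toFun i < l then 0 else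
    if ∑ i, b.toFun i < l then 0 else ε ^ (∑ i, a.toFun i + ∑ i, b.toFun i) *
    (wronskianCut d f K a.toFun b.toFun * monomialEval a.toFun x * monomialEval b.toFun y)

/-- Split each pair of degrees at `l`. Mixed terms carry a factor `ε^l`, and symmetry of the entries
makes the two mixed blocks transposes of each other. -/
theorem kernelPoly_eq_block_sum {f : ℝ → ℝ} (hf : AnalyticAt ℝ f 0) {M l : ℕ} (hM : 1 ≤ M)
    (ho : OddCoeffsVanish f M) (hl : l ≤ M) (ε : ℝ) (x y : EuclideanSpace ℝ (Fin d)) :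
    kernelPoly d f (2 * M - 1) ε x y =
      (∑ a : MonLT d l, ∑ b : MonLT d l, monomialEval a.toFun x * ε ^ (∑ i, a.toFun i) *
        wronskianEntry (stationaryKernel d f) a.toFun b.toFun * ε ^ (∑ i, b.toFun i) *
        monomialEval b.toFun y) +
      ε ^ l * ((∑ a : MonLT d l, monomialEval a.toFun x * ε ^ (∑ i, a.toFun i) *
          crossTerm d f l (2 * M - 1) ε a.toFun y) +
        ∑ a : MonLT d l, crossTerm d f l (2 * M - 1) ε a.toFun x * ε ^ (∑ i, a.toFun i) *
          monomialEval a.toFun y) +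
      tailTerm d f l (2 * M - 1) ε x y := by
  set K := 2 * M - 1 with hK
  have hlK : l ≤ K := by omega
  let g : (Fin d → ℕ) → (Fin d → ℕ) → ℝ := fun a b => ε ^ (∑ i, a i + ∑ i, b i) *
    (wronskianCut d f K a b * monomialEval a x * monomialEval b y)
  have hsplit : kernelPoly d f K ε x y =
      (∑ a : MonLT d K, if ∑ i, a.toFun i < l then
        (∑ b : MonLT d K, if ∑ i, b.toFun i < l then g a.toFun b.toFun else 0) else 0) +
      ((∑ a : MonLT d K, if ∑ i, a.toFun i < l then
        (∑ b : MonLT d K, if ∑ i, b.toFun i < l then 0 else g a.toFun b.toFun) else 0) +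
      (∑ b : MonLT d K, if ∑ i, b.toFun i < l then
        (∑ a : MonLT d K, if ∑ i, a.toFun i < l then 0 else g a.toFun b.toFun) else 0)) +
      tailTerm d f l K ε x y := by
    simp only [ite_sum_zero]
    rw [Finset.sum_comm (f := fun (b a : MonLT d K) => if ∑ i, b.toFun i < l then
      (if ∑ i, a.toFun i < l then 0 else g a.toFun b.toFun) else 0)]
    simp only [tailTerm, kernelPoly, ← Finset.sum_add_distrib]
    refine Finset.sum_congr rfl fun a _ => Finset.sum_congr rfl fun b _ => ?_
    have hcases : ∀ (P Q : Prop) [Decidable P] [Decidable Q] (G : ℝ), G =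
        (if P then if Q then G else 0 else 0) + ((if P then if Q then 0 else G else 0) +
          if Q then if P then 0 else G else 0) + if P then 0 else if Q then 0 else G := by
      intro P Q _ _ G
      split_ifs <;> simp
    change _ * (wronskianCut d f K a.toFun b.toFun * _ * _) = _
    simpa only [g, Finset.sum_add_distrib] using hcases (∑ i, a.toFun i < l) (∑ i, b.toFun i < l)
      (g a.toFun b.toFun)
  rw [hsplit]
  rw [sum_monLT_ite_lt hlK (fun a => ∑ b : MonLT d K, if ∑ i, b.toFun i < l then
      g a b.toFun else 0),
    sum_monLT_ite_lt hlK (fun a => ∑ b : MonLT d K, if ∑ i, b.toFun i < l then 0 else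
      g a b.toFun),
    sum_monLT_ite_lt hlK (fun b => ∑ a : MonLT d K, if ∑ i, a.toFun i < l then 0 else
      g a.toFun b)]
  congr 1
  congr 1
  · refine Finset.sum_congr rfl fun a _ => ?_
    rw [sum_monLT_ite_lt hlK (fun b => g a.toFun b)]
    refine Finset.sum_congr rfl fun b _ => ?_
    have h1 : ∑ i, a.toFun i + ∑ i, b.toFun i < K := by
      have := a.sum_lt; have := b.sum_lt; omega
    simp only [g, wronskianCut, if_pos h1, pow_add]
    ring
  · rw [mul_add]
    congr 1
    · rw [Finset.mul_sum]
      refine Finset.sum_congr rfl fun a _ => ?_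
      simp only [crossTerm, Finset.mul_sum]
      refine Finset.sum_congr rfl fun b _ => ?_
      split_ifs with h
      · simp
      · simp only [g]
        rw [show ∑ i, a.toFun i + ∑ i, b.toFun i =
          l + ∑ i, a.toFun i + (∑ i, b.toFun i - l) by omega, pow_add, pow_add]
        ring
    · rw [Finset.mul_sum]
      refine Finset.sum_congr rfl fun b _ => ?_
      simp only [crossTerm, Finset.mul_sum, Finset.sum_mul]
      refine Finset.sum_congr rfl fun a _ => ?_
      split_ifs with h
      · simp
      · simp only [g]
        rw [show ∑ i, a.toFun i + ∑ i, b.toFun i =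
          l + ∑ i, b.toFun i + (∑ i, a.toFun i - l) by omega, pow_add, pow_add,
          wronskianCut_comm hf hM ho a.toFun]
        ring

theorem tailTerm_eq_zero (f : ℝ → ℝ) {l K : ℕ} (h : K ≤ 2 * l) (ε : ℝ)
    (x y : EuclideanSpace ℝ (Fin d)) : tailTerm d f l K ε x y = 0 := by
  refine Finset.sum_eq_zero fun a _ => Finset.sum_eq_zero fun b _ => ?_
  split_ifs with h1 h2
  · rfl
  · rfl
  · rw [wronskianCut, if_neg (by omega)]; simp

theorem tailTerm_succ (f : ℝ → ℝ) (l : ℕ) (ε : ℝ) (x y : EuclideanSpace ℝ (Fin d)) :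
    tailTerm d f l (2 * l + 1) ε x y = ε ^ (2 * l) * ∑ a : MonEq d l, ∑ b : MonEq d l,
      monomialEval a.toFun x * wronskianEntry (stationaryKernel d f) a.toFun b.toFun *
        monomialEval b.toFun y := by
  unfold tailTerm
  rw [sum_monLT_eq_monEq (l := l) (by omega) (fun a => ∑ b : MonLT d (2 * l + 1),
    if ∑ i, a i < l then 0 else if ∑ i, b.toFun i < l then 0 else
      ε ^ (∑ i, a i + ∑ i, b.toFun i) * (wronskianCut d f (2 * l + 1) a b.toFun *
        monomialEval a x * monomialEval b.toFun y)), Finset.mul_sum]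
  · refine Finset.sum_congr rfl fun a _ => ?_
    rw [sum_monLT_eq_monEq (l := l) (by omega) (fun b =>
      if ∑ i, a.toFun i < l then 0 else if ∑ i, b i < l then 0 else
        ε ^ (∑ i, a.toFun i + ∑ i, b i) * (wronskianCut d f (2 * l + 1) a.toFun b *
          monomialEval a.toFun x * monomialEval b y)), Finset.mul_sum]
    · refine Finset.sum_congr rfl fun b _ => ?_
      simp only [a.sum_eq, b.sum_eq, lt_irrefl, if_false, wronskianCut]
      rw [if_pos (by omega), two_mul]
      ring
    · intro b _ hb
      rw [a.sum_eq, if_neg (lt_irrefl l)]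
      split_ifs with h
      · rfl
      · rw [wronskianCut, a.sum_eq, if_neg (by omega)]; simp
  · intro a _ ha
    refine Finset.sum_eq_zero fun b _ => ?_
    split_ifs with h1 h2
    · rfl
    · rfl
    · rw [wronskianCut, if_neg (by omega)]; simp

theorem tendsto_crossTerm (f : ℝ → ℝ) (l K : ℕ) (a : Fin d → ℕ) (y : EuclideanSpace ℝ (Fin d)) :
    Tendsto (fun ε => crossTerm d f l K ε a y) (𝓝[>] 0) (𝓝 (crossTerm d f l K 0 a y)) := by
  have : Continuous fun ε => crossTerm d f l K ε a y := by
    unfold crossTerm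
    refine continuous_finsetSum _ fun b _ => ?_
    split_ifs
    · exact continuous_const
    · fun_prop
  exact (this.tendsto 0).mono_left nhdsWithin_le_nhds

theorem crossTerm_succ_zero (f : ℝ → ℝ) (l : ℕ) (a : Fin d → ℕ) (ha : ∑ i, a i < l)
    (y : EuclideanSpace ℝ (Fin d)) :
    crossTerm d f l (2 * l + 1) 0 a y = ∑ b : MonEq d l,
      wronskianEntry (stationaryKernel d f) a b.toFun * monomialEval b.toFun y := by
  unfold crossTerm
  rw [sum_monLT_eq_monEq (l := l) (by omega) (fun b => if ∑ i, b i < l then 0 else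
    (0 : ℝ) ^ (∑ i, b i - l) * (wronskianCut d f (2 * l + 1) a b * monomialEval b y))]
  · refine Finset.sum_congr rfl fun b _ => ?_
    simp only [b.sum_eq, lt_irrefl, if_false, Nat.sub_self, pow_zero, one_mul, wronskianCut]
    rw [if_pos (by omega)]
  · intro b _ hb
    split_ifs with h
    · rfl
    · rw [zero_pow (by omega), zero_mul]

variable {n : ℕ}

/-- The matrix of the cross terms of the kernel expansion at the points `x`. -/
def crossMatrix (f : ℝ → ℝ) (l K : ℕ) (x : Fin n → EuclideanSpace ℝ (Fin d)) (ε : ℝ) :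
    Matrix (MonLT d l) (Fin n) ℝ :=
  Matrix.of fun a j => crossTerm d f l K ε a.toFun (x j)

theorem kernelPoly_matrix_eq {f : ℝ → ℝ} (hf : AnalyticAt ℝ f 0) {M l : ℕ} (hM : 1 ≤ M)
    (ho : OddCoeffsVanish f M) (hl : l ≤ M) (x : Fin n → EuclideanSpace ℝ (Fin d)) (ε : ℝ) :
    (Matrix.of fun i j => kernelPoly d f (2 * M - 1) ε (x i) (x j)) =
      vandermondeLT x l * powDiagonal (MonLT.degree (d := d) (l := l)) ε *
        wronskianLT (stationaryKernel d f) l * powDiagonal (MonLT.degree (d := d) (l := l)) ε *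
        (vandermondeLT x l)ᵀ +
      ε ^ l • (vandermondeLT x l * powDiagonal (MonLT.degree (d := d) (l := l)) ε *
          crossMatrix f l (2 * M - 1) x ε +
        (crossMatrix f l (2 * M - 1) x ε)ᵀ * powDiagonal (MonLT.degree (d := d) (l := l)) ε *
          (vandermondeLT x l)ᵀ) +
      Matrix.of fun i j => tailTerm d f l (2 * M - 1) ε (x i) (x j) := by
  ext i j
  rw [of_apply, kernelPoly_eq_block_sum hf hM ho hl]
  set D := powDiagonal (MonLT.degree (d := d) (l := l)) ε with hD
  have hmul : ∀ (Q : Matrix (Fin n) (MonLT d l) ℝ) a, (Q * D) i a = Q i a * ε ^ ∑ k, a.toFun k :=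
    fun Q a => mul_diagonal _ _ _ _
  rw [Matrix.add_apply, Matrix.add_apply, Matrix.smul_apply, Matrix.add_apply, mul_apply,
    mul_apply, mul_apply]
  simp only [hmul]
  simp only [mul_apply (M := vandermondeLT x l * D), hmul]
  simp only [transpose_apply, vandermondeLT, crossMatrix, wronskianLT, of_apply, smul_eq_mul,
    Finset.sum_mul]
  rw [Finset.sum_comm]

theorem tendsto_scaledKernel_remainder {f : ℝ → ℝ} (hf : AnalyticAt ℝ f 0) {M : ℕ} (hM : 1 ≤ M)
    (ho : OddCoeffsVanish f M) (x : Fin n → EuclideanSpace ℝ (Fin d)) :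
    Tendsto (fun ε : ℝ => (ε ^ (2 * M - 1))⁻¹ • (scaledKernelMatrix f ε x -
      Matrix.of fun i j => kernelPoly d f (2 * M - 1) ε (x i) (x j))) (𝓝[>] 0)
      (𝓝 (taylorCoeffAtZero f (2 * M - 1) • distancePowerMatrix (2 * M - 1) x)) := by
  refine tendsto_pi_nhds.mpr fun i => tendsto_pi_nhds.mpr fun j => ?_
  have h := tendsto_kernel_remainder hf hM ho (x i) (x j)
  simp only [div_eq_inv_mul] at h
  exact h

/-- With total degree below `2l - 1`, no term has both degrees at least `l`, so the remainder is the
odd distance power alone. Since `2l - p = 1`, the excess of the square vanishes in the limit. -/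
theorem singularDecomposition_odd {f : ℝ → ℝ} (hf : AnalyticAt ℝ f 0) {l : ℕ} (hl : 1 ≤ l)
    (ho : OddCoeffsVanish f l) (hW : (wronskianLT (stationaryKernel d f) l).PosDef)
    (x : Fin n → EuclideanSpace ℝ (Fin d)) {α : ℝ} (hα : 0 < α) {p : ℕ} (hp : p = 2 * l - 1) :
    ∃ A, SingularDecomposition (fun ε => (α * (ε ^ p)⁻¹) • scaledKernelMatrix f ε x)
      (vandermondeLT x l)
      ((α * taylorCoeffAtZero f (2 * l - 1)) • distancePowerMatrix (2 * l - 1) x) A := by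
  have hC : Tendsto (crossMatrix f l (2 * l - 1) x) (𝓝[>] 0)
      (𝓝 (crossMatrix f l (2 * l - 1) x 0)) :=
    tendsto_pi_nhds.mpr fun a => tendsto_pi_nhds.mpr fun j => tendsto_crossTerm f l _ _ _
  have h := SingularDecomposition.of_expansion (p := p) (l := l) (by omega) (by omega)
    MonLT.degree (fun a => a.sum_lt) hα hW
    (V := vandermondeLT x l) (L := fun ε => scaledKernelMatrix f ε x) hC
    (tendsto_scaledKernel_remainder hf hl ho x) (fun ε hε => by
      have h1 := kernelPoly_matrix_eq hf hl ho le_rfl x ε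
      have h2 : (Matrix.of fun i j => tailTerm d f l (2 * l - 1) ε (x i) (x j)) = 0 :=
        Matrix.ext fun i j => tailTerm_eq_zero f (by omega) ε _ _
      rw [h2, add_zero] at h1
      rw [hp, smul_smul, mul_inv_cancel₀ (pow_pos hε _).ne', one_smul, ← h1]
      abel)
  rw [zero_pow (by omega), zero_smul, sub_zero, smul_smul] at h
  exact ⟨_, h⟩

/-- The expansion is pushed to order `2l + 1`, where the tail is the block with both degrees equal
to `l`. The odd distance term is one order too small to survive, while `2l - p = 0` retains the
excess, which forms the Schur complement. -/
theorem singularDecomposition_even {f : ℝ → ℝ} (hf : AnalyticAt ℝ f 0) {l : ℕ}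
    (ho : OddCoeffsVanish f (l + 1)) (hW : (wronskianLT (stationaryKernel d f) l).PosDef)
    (x : Fin n → EuclideanSpace ℝ (Fin d)) {α : ℝ} (hα : 0 < α) {p : ℕ} (hp : p = 2 * l) :
    ∃ A, SingularDecomposition (fun ε => (α * (ε ^ p)⁻¹) • scaledKernelMatrix f ε x)
      (vandermondeLT x l)
      (α • (vandermondeEq x l * wronskianSchur (stationaryKernel d f) l * (vandermondeEq x l)ᵀ))
      A := by
  have hC : Tendsto (crossMatrix f l (2 * l + 1) x) (𝓝[>] 0)
      (𝓝 (crossMatrix f l (2 * l + 1) x 0)) :=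
    tendsto_pi_nhds.mpr fun a => tendsto_pi_nhds.mpr fun j => tendsto_crossTerm f l _ _ _
  set lowerRight : Matrix (MonEq d l) (MonEq d l) ℝ := Matrix.of fun a b =>
    wronskianEntry (stationaryKernel d f) a.toFun b.toFun with hlr
  set upperRight : Matrix (MonLT d l) (MonEq d l) ℝ := Matrix.of fun a b =>
    wronskianEntry (stationaryKernel d f) a.toFun b.toFun with hur
  set lowerLeft : Matrix (MonEq d l) (MonLT d l) ℝ := Matrix.of fun a b =>
    wronskianEntry (stationaryKernel d f) a.toFun b.toFun with hll
  set V₂ := vandermondeEq x l with hV₂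
  have hurT : upperRightᵀ = lowerLeft := Matrix.ext fun a b =>
    wronskianEntry_comm hf (Nat.succ_le_succ (Nat.zero_le l)) ho _ _ (by
      have := b.sum_lt; rw [a.sum_eq]; omega)
  have hC0 : crossMatrix f l (2 * l + 1) x 0 = upperRight * V₂ᵀ := Matrix.ext fun a j =>
    crossTerm_succ_zero f l a.toFun a.sum_lt (x j)
  have hR : Tendsto (fun ε : ℝ => ε • ((ε ^ (2 * l + 1))⁻¹ • (scaledKernelMatrix f ε x -
      Matrix.of fun i j => kernelPoly d f (2 * l + 1) ε (x i) (x j))) + V₂ * lowerRight * V₂ᵀ)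
      (𝓝[>] 0) (𝓝 (V₂ * lowerRight * V₂ᵀ)) := by
    have h0 : Tendsto (fun ε : ℝ => ε) (𝓝[>] 0) (𝓝 0) := nhdsWithin_le_nhds
    have h1 := h0.smul (tendsto_scaledKernel_remainder hf (Nat.succ_le_succ (Nat.zero_le l)) ho x)
    rw [zero_smul] at h1
    have h2 := h1.add_const (V₂ * lowerRight * V₂ᵀ)
    rw [zero_add] at h2
    exact h2
  have h := SingularDecomposition.of_expansion (p := p) (l := l) (by omega) (by omega)
    MonLT.degree (fun a => a.sum_lt) hα hW
    (V := vandermondeLT x l) (L := fun ε => scaledKernelMatrix f ε x) hC hR (fun ε hε => by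
      have h1 := kernelPoly_matrix_eq hf (Nat.succ_le_succ (Nat.zero_le l)) ho (Nat.le_succ l) x ε
      have h2 : (Matrix.of fun i j => tailTerm d f l (2 * l + 1) ε (x i) (x j)) =
          ε ^ p • (V₂ * lowerRight * V₂ᵀ) := by
        ext i j
        rw [of_apply, tailTerm_succ, hp]
        simp only [Matrix.smul_apply, mul_apply, transpose_apply, hV₂, hlr, vandermondeEq, of_apply,
          smul_eq_mul, Finset.sum_mul]
        rw [Finset.sum_comm]
      change _ = _ + _ + (Matrix.of fun i j => tailTerm d f l (2 * l + 1) ε (x i) (x j)) at h1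
      rw [h2] at h1
      have h3 : ε ^ p * (ε * (ε ^ (2 * l + 1))⁻¹) = 1 := by
        rw [hp, ← mul_assoc, ← pow_succ, mul_inv_cancel₀ (pow_pos hε _).ne']
      rw [smul_add (ε ^ p), smul_smul ε, smul_smul (ε ^ p), h3, one_smul]
      have h4 := congrArg (fun Q => scaledKernelMatrix f ε x - (Matrix.of fun i j =>
        kernelPoly d f (2 * l + 1) ε (x i) (x j)) + Q) h1
      simp only [Nat.succ_eq_add_one] at h4
      rw [show 2 * (l + 1) - 1 = 2 * l + 1 from rfl] at h4
      rw [sub_add_cancel] at h4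
      refine h4.trans ?_
      abel)
  have h5 : V₂ * lowerRight * V₂ᵀ - (0 : ℝ) ^ (2 * l - p) • ((crossMatrix f l (2 * l + 1) x 0)ᵀ *
      (wronskianLT (stationaryKernel d f) l)⁻¹ * crossMatrix f l (2 * l + 1) x 0) =
      V₂ * wronskianSchur (stationaryKernel d f) l * V₂ᵀ := by
    rw [hp, Nat.sub_self, pow_zero, one_smul, hC0, transpose_mul, transpose_transpose, hurT]
    simp only [wronskianSchur]
    rw [Matrix.mul_sub, Matrix.sub_mul]
    simp only [Matrix.mul_assoc]
    rfl
  rw [h5] at h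
  exact ⟨_, h⟩

end KernelDecomposition

/-! ### Consequences of the smoothness order. -/

section SmoothnessOrder
open Matrix
variable {d : ℕ}

theorem card_monLT (d l : ℕ) : Fintype.card (MonLT d l) = numMonomialsLT d l := by
  cases l with
  | zero =>
    have : IsEmpty (MonLT d 0) := ⟨fun a => absurd a.2 (Nat.not_lt_zero _)⟩
    simp [numMonomialsLT]
  | succ k =>
    have h := Finset.card_finsuppAntidiag_nat_eq_choose
      (s := (Finset.univ : Finset (Fin (d + 1)))) k
    rw [Finset.card_univ, Fintype.card_fin, show d + 1 + k - 1 = k + d by omega,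
      Nat.choose_symm_add] at h
    rw [numMonomialsLT, ← h, ← Finset.card_univ]
    -- A slack coordinate `k - |a|` turns degree at most `k` in `d` variables into degree exactly
    -- `k` in `d + 1`.
    refine Finset.card_bij (fun a _ => Finsupp.equivFunOnFinite.symm
      (Fin.cons (k - ∑ i, a.toFun i) a.toFun : Fin (d + 1) → ℕ)) ?_ ?_ ?_
    · intro a _
      have := a.sum_lt
      rw [Finset.mem_finsuppAntidiag]
      refine ⟨?_, Finset.subset_univ _⟩
      simp only [Finsupp.equivFunOnFinite_symm_apply_apply, Fin.sum_univ_succ, Fin.cons_zero,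
        Fin.cons_succ]
      omega
    · intro a _ b _ hab
      have h1 := Finsupp.equivFunOnFinite.symm.injective hab
      exact MonLT.toFun_injective (Fin.cons_inj.mp h1).2
    · intro F hF
      rw [Finset.mem_finsuppAntidiag] at hF
      have h1 := hF.1
      rw [Fin.sum_univ_succ] at h1
      obtain ⟨a, ha⟩ := MonLT.exists_toFun_eq (K := k + 1) (fun i : Fin d => F i.succ) (by omega)
      refine ⟨a, Finset.mem_univ _, ?_⟩
      ext i
      rw [Finsupp.equivFunOnFinite_symm_apply_apply, ha]
      refine Fin.cases ?_ (fun i => ?_) i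
      · rw [Fin.cons_zero]
        change k - ∑ i : Fin d, F i.succ = F 0
        omega
      · rw [Fin.cons_succ]

theorem taylorCoeff_eq_zero_of_lt {f : ℝ → ℝ} {j : ℕ} (hj : 1 ≤ j)
    (h : (j : ℕ∞) < smoothnessOrder f) : taylorCoeffAtZero f (2 * j - 1) = 0 := by
  by_contra hne
  exact absurd h (not_lt.mpr (sInf_le ⟨j, hj, hne, rfl⟩))

theorem oddCoeffsVanish_of_le {f : ℝ → ℝ} {M : ℕ} (h : (M : ℕ∞) ≤ smoothnessOrder f) :
    OddCoeffsVanish f M := fun _ hj hjM =>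
  taylorCoeff_eq_zero_of_lt hj ((Nat.cast_lt.mpr hjM).trans_le h)

theorem smoothnessOrder_eq_coe {f : ℝ → ℝ} {k : ℕ} (h : smoothnessOrder f = k) :
    1 ≤ k ∧ taylorCoeffAtZero f (2 * k - 1) ≠ 0 := by
  have hne : {r : ℕ∞ | ∃ k : ℕ, 1 ≤ k ∧ taylorCoeffAtZero f (2 * k - 1) ≠ 0 ∧
      r = (k : ℕ∞)}.Nonempty := by
    by_contra he
    rw [smoothnessOrder, Set.not_nonempty_iff_eq_empty.mp he, sInf_empty] at h
    exact ENat.top_ne_natCast k h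
  obtain ⟨j, hj, hj', hjk⟩ := csInf_mem hne
  have : k = j := by exact_mod_cast h.symm.trans hjk
  subst this
  exact ⟨hj, hj'⟩

theorem wronskianLT_form_eq (κ : EuclideanSpace ℝ (Fin d) → EuclideanSpace ℝ (Fin d) → ℝ) (l : ℕ)
    (v : MonLT d l → ℝ) : v ⬝ᵥ wronskianLT κ l *ᵥ v =
      ∑ a, ∑ b, v a * v b * wronskianEntry κ a.toFun b.toFun := by
  simp only [dotProduct, mulVec, wronskianLT, of_apply, Finset.mul_sum]
  exact Finset.sum_congr rfl fun a _ => Finset.sum_congr rfl fun b _ => by ring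

/-- Semidefiniteness always holds. Definiteness comes from the determinant assumption if the order
is infinite, and from the null-vector argument if it is finite. -/
theorem wronskianLT_posDef (hd : 0 < d) {f : ℝ → ℝ} (hf : AnalyticAt ℝ f 0)
    (hκ : IsPositiveKernel (stationaryKernel d f)) {l : ℕ} (hl : (l : ℕ∞) ≤ smoothnessOrder f)
    (hW : smoothnessOrder f = ⊤ → (wronskianLT (stationaryKernel d f) l).det ≠ 0) :
    (wronskianLT (stationaryKernel d f) l).PosDef := by
  have ho := oddCoeffsVanish_of_le hl
  have hsymm : (wronskianLT (stationaryKernel d f) l).IsHermitian := by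
    rw [IsHermitian, conjTranspose_eq_transpose_of_trivial]
    ext a b
    have := a.sum_lt
    have := b.sum_lt
    exact wronskianEntry_comm hf (M := l) (by omega) ho _ _ (by omega)
  have hpsd : (wronskianLT (stationaryKernel d f) l).PosSemidef := by
    refine PosSemidef.of_dotProduct_mulVec_nonneg hsymm fun v => ?_
    rw [star_trivial, wronskianLT_form_eq]
    exact wronskianLT_posSemidef hf hκ ho v
  refine PosDef.of_dotProduct_mulVec_pos hsymm fun v hv => ?_
  refine (hpsd.dotProduct_mulVec_nonneg v).lt_of_ne' fun h0 => hv ?_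
  by_cases htop : smoothnessOrder f = ⊤
  · rw [hpsd.dotProduct_mulVec_zero_iff] at h0
    by_contra hv
    exact hW htop (exists_mulVec_eq_zero_iff.mp ⟨v, hv, h0⟩)
  · obtain ⟨k, hk⟩ := ENat.ne_top_iff_exists.mp htop
    rw [← hk] at hl
    rw [star_trivial, wronskianLT_form_eq] at h0
    exact wronskianLT_form_eq_zero hd hf hκ (oddCoeffsVanish_of_le hk.le)
      (smoothnessOrder_eq_coe hk.symm).2 (Nat.cast_le.mp hl) v h0

variable {n : ℕ}

theorem vandermondeLT_transpose_mulVec (x : Fin n → EuclideanSpace ℝ (Fin d)) (l : ℕ)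
    (c : Fin n → ℝ) (a : MonLT d l) : ((vandermondeLT x l)ᵀ *ᵥ c) a = moment x c a.toFun := by
  simp only [mulVec, dotProduct, transpose_apply, vandermondeLT, of_apply, moment]
  exact Finset.sum_congr rfl fun i _ => mul_comm _ _

/-- `f_{2r-1} D^{(2r-1)}` is positive definite on the orthogonal complement of `V_{≤ r-1}`. -/
theorem distancePowerMatrix_form_pos (hd : 0 < d) {f : ℝ → ℝ} (hf : AnalyticAt ℝ f 0)
    (hκ : IsPositiveKernel (stationaryKernel d f)) {k : ℕ} (hk : smoothnessOrder f = k)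
    (x : Fin n → EuclideanSpace ℝ (Fin d)) (hx : Function.Injective x) {α : ℝ} (hα : 0 < α)
    (c : Fin n → ℝ) (hc : c ≠ 0) (hVc : (vandermondeLT x k)ᵀ *ᵥ c = 0) :
    0 < c ⬝ᵥ ((α * taylorCoeffAtZero f (2 * k - 1)) • distancePowerMatrix (2 * k - 1) x) *ᵥ c := by
  obtain ⟨hk1, hfk⟩ := smoothnessOrder_eq_coe hk
  have ho := oddCoeffsVanish_of_le hk.ge
  have hm : ∀ a : Fin d → ℕ, ∑ i, a i < k → moment x c a = 0 := fun a ha => by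
    obtain ⟨b, rfl⟩ := MonLT.exists_toFun_eq a ha
    rw [← vandermondeLT_transpose_mulVec, hVc, Pi.zero_apply]
  have hform : c ⬝ᵥ distancePowerMatrix (2 * k - 1) x *ᵥ c =
      ∑ i, ∑ j, c i * c j * ‖x i - x j‖ ^ (2 * k - 1) := by
    simp only [dotProduct, mulVec, distancePowerMatrix, of_apply, Finset.mul_sum]
    exact Finset.sum_congr rfl fun i _ => Finset.sum_congr rfl fun j _ => by ring
  rw [smul_mulVec, dotProduct_smul, smul_eq_mul, mul_assoc, hform]
  refine mul_pos hα ((odd_form_nonneg_of_moments hf hκ hk1 ho x c hm).lt_of_ne' fun h0 => hc ?_)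
  exact eq_zero_of_odd_form_eq_zero hd hf hκ hk1 ho hfk x hx c hm
    ((mul_eq_zero.mp h0).resolve_left hfk)

/-- At the exponent `2k - 1` matched to the smoothness order, the matrix is uniformly coercive
without any rank condition on the points. The surplus power of `1/ε` then sends it to infinity. -/
theorem tendsToInfty_of_smoothnessOrder_lt (hd : 0 < d) {f : ℝ → ℝ} (hf : AnalyticAt ℝ f 0)
    (hκ : IsPositiveKernel (stationaryKernel d f)) {k p : ℕ} (hk : smoothnessOrder f = k)
    (hkp : 2 * k ≤ p) (x : Fin n → EuclideanSpace ℝ (Fin d)) (hx : Function.Injective x) {α : ℝ}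
    (hα : 0 < α) : TendsToInfty fun ε => (α * (ε ^ p)⁻¹) • scaledKernelMatrix f ε x := by
  obtain ⟨hk1, -⟩ := smoothnessOrder_eq_coe hk
  obtain ⟨A, hA⟩ := singularDecomposition_odd hf hk1 (oddCoeffsVanish_of_le hk.ge)
    (wronskianLT_posDef hd hf hκ hk.ge fun h => absurd (hk.symm.trans h) (ENat.natCast_ne_top k))
    x hα rfl
  obtain ⟨δ, hδ, H⟩ := hA.exists_coercive fun c hc hVc =>
    distancePowerMatrix_form_pos hd hf hκ hk x hx hα c hc hVc
  intro M
  have h1 : Tendsto (fun ε : ℝ => δ * ε⁻¹) (𝓝[>] 0) atTop :=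
    tendsto_inv_nhdsGT_zero.const_mul_atTop hδ
  filter_upwards [H, h1.eventually_ge_atTop M, self_mem_nhdsWithin,
    mem_nhdsWithin_of_mem_nhds (Iio_mem_nhds one_pos)] with ε hH hM hε hε1 u
  have hε : 0 < ε := hε
  have hε1 : ε < 1 := hε1
  have hu : 0 ≤ u ⬝ᵥ u := by simpa using dotProduct_star_self_nonneg u
  set q := p - (2 * k - 1) with hq
  have hsplit : (α * (ε ^ p)⁻¹) • scaledKernelMatrix f ε x =
      (ε ^ q)⁻¹ • ((α * (ε ^ (2 * k - 1))⁻¹) • scaledKernelMatrix f ε x) := by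
    rw [smul_smul, show p = q + (2 * k - 1) by omega, pow_add, mul_inv]
    congr 1
    ring
  have hinv : ε⁻¹ ≤ (ε ^ q)⁻¹ := by
    refine inv_anti₀ (pow_pos hε _) ?_
    simpa using pow_le_pow_of_le_one hε.le hε1.le (show 1 ≤ q by omega)
  rw [hsplit, smul_mulVec, dotProduct_smul, smul_eq_mul]
  calc M * (u ⬝ᵥ u) ≤ δ * ε⁻¹ * (u ⬝ᵥ u) := mul_le_mul_of_nonneg_right hM hu
    _ = ε⁻¹ * (δ * (u ⬝ᵥ u)) := by ring
    _ ≤ (ε ^ q)⁻¹ * (δ * (u ⬝ᵥ u)) := mul_le_mul_of_nonneg_right hinv (mul_nonneg hδ.le hu)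
    _ ≤ _ := mul_le_mul_of_nonneg_left (hH u) (inv_nonneg.mpr (pow_pos hε _).le)

theorem SingularDecomposition.isSymm {τ : Type*} [Fintype τ] [DecidableEq τ]
    {L : ℝ → Matrix (Fin n) (Fin n) ℝ}
    {V : Matrix (Fin n) τ ℝ} {B : Matrix (Fin n) (Fin n) ℝ} {A : ℝ → Matrix τ τ ℝ}
    (h : SingularDecomposition L V B A) (hL : ∀ ε, 0 < ε → (L ε).IsSymm) : B.IsSymm := by
  obtain ⟨-, hA, V', B', hV', hB', hdec⟩ := h
  have hT : Tendsto (fun ε => (B' ε)ᵀ) (𝓝[>] 0) (𝓝 Bᵀ) :=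
    ((continuous_id.matrix_transpose).tendsto B).comp hB'
  refine tendsto_nhds_unique hT (hB'.congr' ?_)
  filter_upwards [hdec, self_mem_nhdsWithin] with ε h1 hε
  have h2 := hL ε hε
  have h3 : B' ε = L ε - V' ε * A ε * (V' ε)ᵀ := by rw [h1]; abel
  rw [h3, transpose_sub, transpose_mul, transpose_mul, transpose_transpose, h2.eq, (hA ε).eq,
    Matrix.mul_assoc]

theorem SingularDecomposition.exists_isExtendedLEnsemble {τ : Type*} [Fintype τ] [DecidableEq τ]
    {L : ℝ → Matrix (Fin n) (Fin n) ℝ}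
    {V : Matrix (Fin n) τ ℝ} {B : Matrix (Fin n) (Fin n) ℝ} {A : ℝ → Matrix τ τ ℝ}
    (h : SingularDecomposition L V B A) (hV : V.rank = Fintype.card τ)
    {μ : ℝ → PMF (Finset (Fin n))} (hμ : ∀ ε, 0 < ε → IsLEnsemble (L ε) (μ ε)) :
    ∃ ν : PMF (Finset (Fin n)), IsExtendedLEnsemble B V ν ∧ ConvergesInLaw μ ν := by
  have hinj := mulVec_injective_of_rank_eq V hV
  obtain ⟨ν, hν, hlim⟩ := h.exists_limit_law hinj hμ
  refine ⟨ν, ⟨⟨h.isSymm fun ε hε => ?_, hV, h.form_nonneg hinj fun ε hε => (hμ ε hε).1⟩, hν⟩, hlim⟩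
  have := (hμ ε hε).1.isHermitian
  rwa [IsHermitian, conjTranspose_eq_transpose_of_trivial] at this

end SmoothnessOrder

end

/-! ### Assembly of the limiting laws. -/

theorem mainTheorem3 (d n p l : ℕ) (hd : 0 < d) (hl : 2 * l = p ∨ 2 * l = p + 1)
    (α : ℝ) (hα : 0 < α)
    (x : Fin n → EuclideanSpace ℝ (Fin d)) (hx : Function.Injective x)
    (f : ℝ → ℝ) (hf : AnalyticAt ℝ f 0) (hκ : IsPositiveKernel (stationaryKernel d f))
    (r : ℕ∞) (hr : r = smoothnessOrder f)
    (hV : (p : ℕ∞) + 1 ≤ 2 * r → (vandermondeLT x l).rank = min n (numMonomialsLT d l))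
    (hW : r = ⊤ → (wronskianLT (stationaryKernel d f) l).det ≠ 0)
    (μ : ℝ → PMF (Finset (Fin n)))
    (hμ : ∀ ε : ℝ, 0 < ε → IsLEnsemble ((α * (ε ^ p)⁻¹) • scaledKernelMatrix f ε x) (μ ε)) :
    (n ≤ numMonomialsLT d l → ConvergesInLaw μ (PMF.pure Finset.univ)) ∧
    (2 * r < (p : ℕ∞) + 1 → ConvergesInLaw μ (PMF.pure Finset.univ)) ∧
    (numMonomialsLT d l < n → (p : ℕ∞) + 1 < 2 * r → Odd p →
      ∃ ν : PMF (Finset (Fin n)),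
        IsFixedSizeLEnsemble (numMonomialsLT d l)
          (vandermondeLT x l * (vandermondeLT x l).transpose) ν ∧
        ConvergesInLaw μ ν) ∧
    (numMonomialsLT d l < n → (p : ℕ∞) + 1 < 2 * r → Even p →
      ∃ ν : PMF (Finset (Fin n)),
        IsExtendedLEnsemble
          (α • (vandermondeEq x l * wronskianSchur (stationaryKernel d f) l *
            (vandermondeEq x l).transpose))
          (vandermondeLT x l) ν ∧
        ConvergesInLaw μ ν) ∧
    (numMonomialsLT d l < n → ∀ k : ℕ, r = (k : ℕ∞) → 2 * k = p + 1 →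
      ∃ ν : PMF (Finset (Fin n)),
        IsExtendedLEnsemble
          ((α * taylorCoeffAtZero f (2 * k - 1)) • distancePowerMatrix (2 * k - 1) x)
          (vandermondeLT x k) ν ∧
        ConvergesInLaw μ ν) := by
  subst hr
  -- Integrality upgrades `2r ≥ p + 1`: for `p = 2l` it gives `r ≥ l + 1`, as the even expansion
  -- needs.
  have key : (p : ℕ∞) + 1 ≤ 2 * smoothnessOrder f →
      ∀ M : ℕ, 2 * M ≤ p + 2 → (M : ℕ∞) ≤ smoothnessOrder f := by
    intro h M hM
    cases hs : smoothnessOrder f with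
    | top => exact le_top
    | coe k =>
      rw [hs] at h
      norm_cast at h ⊢
      omega
  have hPD : (p : ℕ∞) + 1 ≤ 2 * smoothnessOrder f →
      (wronskianLT (stationaryKernel d f) l).PosDef := fun h =>
    wronskianLT_posDef hd hf hκ (key h l (by omega)) hW
  have hodd : (p : ℕ∞) + 1 ≤ 2 * smoothnessOrder f → 2 * l = p + 1 → ∃ A,
      SingularDecomposition (fun ε => (α * (ε ^ p)⁻¹) • scaledKernelMatrix f ε x)
        (vandermondeLT x l)
        ((α * taylorCoeffAtZero f (2 * l - 1)) • distancePowerMatrix (2 * l - 1) x) A :=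
    fun h hlp => singularDecomposition_odd hf (by omega)
      (oddCoeffsVanish_of_le (key h l (by omega))) (hPD h) x hα (by omega)
  have heven : (p : ℕ∞) + 1 ≤ 2 * smoothnessOrder f → 2 * l = p → ∃ A,
      SingularDecomposition (fun ε => (α * (ε ^ p)⁻¹) • scaledKernelMatrix f ε x)
        (vandermondeLT x l)
        (α • (vandermondeEq x l * wronskianSchur (stationaryKernel d f) l *
          (vandermondeEq x l).transpose)) A :=
    fun h hlp => singularDecomposition_even hf
      (oddCoeffsVanish_of_le (key h (l + 1) (by omega))) (hPD h) x hα hlp.symm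
  have hrank : numMonomialsLT d l < n → (p : ℕ∞) + 1 ≤ 2 * smoothnessOrder f →
      (vandermondeLT x l).rank = Fintype.card (MonLT d l) := fun hn h => by
    rw [hV h, min_eq_right hn.le, card_monLT]
  have hsmall : 2 * smoothnessOrder f < (p : ℕ∞) + 1 →
      ConvergesInLaw μ (PMF.pure Finset.univ) := by
    intro h
    cases hs : smoothnessOrder f with
    | top => rw [hs, ENat.mul_top (by norm_num)] at h; exact absurd h not_top_lt
    | coe k =>
      rw [hs] at h
      norm_cast at h
      exact convergesInLaw_univ
        (tendsToInfty_of_smoothnessOrder_lt hd hf hκ hs (by omega) x hx hα) hμ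
  refine ⟨fun hn => ?_, hsmall, fun hn hr hp => ?_, fun hn hr hp => ?_, fun hn k hk hkp => ?_⟩
  -- The rank assumption is available only for `2r ≥ p + 1`; below that, the limit does not need it.
  · rcases lt_or_ge (2 * smoothnessOrder f) ((p : ℕ∞) + 1) with h | h
    · exact hsmall h
    · have hVt : (vandermondeLT x l).transpose.rank = Fintype.card (Fin n) := by
        rw [Matrix.rank_transpose, hV h, min_eq_left hn, Fintype.card_fin]
      have hinj := mulVec_injective_of_rank_eq _ hVt
      rcases hl with hl | hl
      · obtain ⟨A, hA⟩ := heven h hl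
        exact convergesInLaw_univ (hA.tendsToInfty hinj) hμ
      · obtain ⟨A, hA⟩ := hodd h hl
        exact convergesInLaw_univ (hA.tendsToInfty hinj) hμ
  · have hlp : 2 * l = p + 1 := hl.resolve_left fun h => by
      rw [← h] at hp
      exact Nat.not_odd_iff_even.mpr (even_two_mul l) hp
    obtain ⟨A, hA⟩ := hodd hr.le hlp
    have hlr : (l : ℕ∞) < smoothnessOrder f := by
      cases hs : smoothnessOrder f with
      | top => exact ENat.natCast_lt_top l
      | coe k =>
        rw [hs] at hr
        norm_cast at hr ⊢
        omega
    -- Here `l < r`, so `f_{2l-1} = 0` and the convergent part is zero; the bordered minors reduce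
    -- to those of a fixed-size ensemble.
    rw [taylorCoeff_eq_zero_of_lt (by omega) hlr, mul_zero, zero_smul] at hA
    obtain ⟨ν, ⟨Z, hZ, hν⟩, hlim⟩ :=
      hA.exists_limit_law (mulVec_injective_of_rank_eq _ (hrank hn hr.le)) hμ
    refine ⟨ν, ⟨?_, Z, hZ, fun X => ?_⟩, hlim⟩
    · simpa using Matrix.posSemidef_self_mul_conjTranspose (vandermondeLT x l)
    · rw [hν, borderedMinor_zero, card_monLT, ite_div, zero_div]
  · have hlp : 2 * l = p := hl.resolve_right fun h => by
      have := hp.two_dvd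
      omega
    obtain ⟨A, hA⟩ := heven hr.le hlp
    exact hA.exists_isExtendedLEnsemble (hrank hn hr.le) hμ
  · obtain rfl : l = k := by omega
    have h : (p : ℕ∞) + 1 ≤ 2 * smoothnessOrder f := by
      rw [hk]
      exact_mod_cast hkp.ge
    obtain ⟨A, hA⟩ := hodd h hkp
    exact hA.exists_isExtendedLEnsemble (hrank hn h) hμ
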